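/- Let $\mu_+,\mu_->0$ and put $\eta=\dfrac{\mu_--\mu_+}{\mu_-+\mu_+}$ and $b+e=\dfrac1{\mu_+}+\dfrac1{\mu_-}$. Two elastic half-planes $\pm x_2>0$ with shear moduli $\mu_\pm$ are bonded along a part of the line $x_2=0$. An antiplane displacement $u$ is in equilibrium if it is harmonic in each open half-plane and $C^1$ up to the line $x_2=0$ from each side except at the origin; its traction is $\sigma_{32}=\mu_\pm\,\partial u/\partial x_2$. Write $[\![f]\!](x_1)=f(x_1,0^+)-f(x_1,0^-)$ and $\langle f\rangle(x_1)=\tfrac12\big(f(x_1,0^+)+f(x_1,0^-)\big)$. **Weight functions.** A weight function is a complex-valued antiplane displacement $U_3$ in equilibrium, homogeneous of degree $-1/2$, with traction $\Sigma_{32}$ continuous across $x_2=0$ for $x_1<0$ and zero on both faces of the crack $x_1>0$, with $[\![U_3]\!]=0$ for $x_1<0$, and normalised by $\int_0^\infty[\![U_3]\!](x_1)e^{i\beta x_1}\,dx_1=\beta^{-1/2}$ for $\operatorname{Im}\beta>0$ (principal branch). A weight function exists, and every weight function satisfies $$[\![U_3]\!](x_1)=\begin{cases}\dfrac{1-i}{\sqrt{2\pi}}\,x_1^{-1/2},&x_1>0,\\0,&x_1<0,\end{cases}\qquad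 \Sigma_{32}(x_1)=\begin{cases}0,&x_1>0,\\ \dfrac{1-i}{2\sqrt{2\pi}\,(b+e)}(-x_1)^{-3/2},&x_1<0,\end{cases}$$ and $\langle U_3\rangle(x_1)=\dfrac{\eta}{2}[\![U_3]\!](x_1)$ for all $x_1\neq0$. For real $\beta\ne0$ let $[\![\overline U_3]\!]^+(\beta)$ and $\langle\overline U_3\rangle^+(\beta)$ be the limit values from the upper half-plane of the transforms $\int_0^\infty(\cdot)\,e^{i\beta x_1}dx_1$ of $[\![U_3]\!]$ and $\langle U_3\rangle$, and let $\overline\Sigma_{32}^-(\beta)$ be the Hadamard finite part of $\int_{-\infty}^0\Sigma_{32}(x_1)e^{i\beta x_1}dx_1$. Let $\beta_\pm^{1/2}=\sqrt\beta$ for $\beta>0$ and $\beta_\pm^{1/2}=\pm i\sqrt{-\beta}$ for $\beta<0$. Then these limits exist and $$[\![\overline U_3]\!]^+=\beta_+^{-1/2}=-\frac{\mu_++\mu_-}{\mu_+\mu_-}\frac{1}{|\beta|}\overline\Sigma_{32}^-,\qquad \overline\Sigma_{32}^-=-\frac{\beta_-^{1/2}}{b+e},\qquad \langle\overline U_3\rangle^+=\frac{\mu_+-\mu_-}{2\mu_+\mu_-}\frac{1}{|\beta|}\overline\Sigma_{32}^-=\frac{\eta}{2}[\![\overline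 U_3]\!]^+ .$$ **Stress intensity factor.** Let $p_3^\pm$ be real functions on $x_1<0$ that are integrable and vanish near $x_1=0$, and put $\langle p_3\rangle=\tfrac12(p_3^++p_3^-)$, $[\![p_3]\!]=p_3^+-p_3^-$. Let $u_3$ be a real antiplane displacement in equilibrium with $\sigma_{32}(x_1,0^\pm)=p_3^\pm(x_1)$ on the faces of the crack $x_1<0$, with $u_3$ and $\sigma_{32}$ continuous across $x_2=0$ for $x_1>0$, with finite elastic energy, and vanishing at infinity. Then there are real numbers $K_{\mathrm{III}},A_{\mathrm{III}}$ with $$\sigma_{32}(x_1,0)=\frac{K_{\mathrm{III}}}{\sqrt{2\pi}}x_1^{-1/2}+\frac{A_{\mathrm{III}}}{\sqrt{2\pi}}x_1^{1/2}+O(x_1^{3/2}),\quad x_1\to0^+,$$ $$[\![u_3]\!](x_1)=\frac{2(b+e)K_{\mathrm{III}}}{\sqrt{2\pi}}(-x_1)^{1/2}-\frac{2(b+e)A_{\mathrm{III}}}{3\sqrt{2\pi}}(-x_1)^{3/2}+O\big((-x_1)^{5/2}\big),\quad x_1\to0^-,$$ and, for every weight function $U_3$, $$K_{\mathrm{III}}=-(1+i)\lim_{x_1'\to0^+}\int_{-\infty}^0\Big\{[\![U_3]\!](x_1'-x_1)\langle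 p_3\rangle(x_1)+\langle U_3\rangle(x_1'-x_1)[\![p_3]\!](x_1)\Big\}dx_1=-\sqrt{\frac2\pi}\int_{-\infty}^0\Big\{\langle p_3\rangle(x_1)+\frac\eta2[\![p_3]\!](x_1)\Big\}(-x_1)^{-1/2}\,dx_1 .$$ If moreover $p_3^\pm$ are continuously differentiable on $x_1<0$ with integrable derivatives, then $$A_{\mathrm{III}}=-2(1+i)\lim_{x_1'\to0^+}\int_{-\infty}^0\Big\{[\![U_3]\!](x_1'-x_1)\frac{d\langle p_3\rangle}{dx_1}(x_1)+\langle U_3\rangle(x_1'-x_1)\frac{d[\![p_3]\!]}{dx_1}(x_1)\Big\}dx_1=-2\sqrt{\frac2\pi}\int_{-\infty}^0\Big\{\frac{d\langle p_3\rangle}{dx_1}(x_1)+\frac\eta2\frac{d[\![p_3]\!]}{dx_1}(x_1)\Big\}(-x_1)^{-1/2}\,dx_1 .$$ -/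

import Mathlib

open Set Filter Topology MeasureTheory

noncomputable section

namespace InterfaceCrack

/-- An antiplane displacement field of a bimaterial plane. The plane is identified with `ℂ` by
`(x₁, x₂) ↦ x₁ + i x₂`; `upper` is the out-of-plane displacement in the upper half-plane (shear
modulus `μp`), `lower` the one in the lower half-plane (shear modulus `μm`). The values of `upper`
on the real axis are its one-sided traces at `x₂ = 0⁺`, those of `lower` the traces at `x₂ = 0⁻`. -/
structure BimaterialField (E : Type*) where
  upper : ℂ → E
  lower : ℂ → E

/-- The closed upper half-plane without the crack tip. -/
def upperHalf : Set ℂ := {z | 0 ≤ z.im ∧ z ≠ 0}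

/-- The closed lower half-plane without the crack tip. -/
def lowerHalf : Set ℂ := {z | z.im ≤ 0 ∧ z ≠ 0}

section Fields

variable {E : Type*} [NormedAddCommGroup E] [NormedSpace ℝ E]

/-- The jump `⟦u⟧(x₁) = u(x₁, 0⁺) - u(x₁, 0⁻)`. -/
def jump (u : BimaterialField E) (x : ℝ) : E := u.upper (x : ℂ) - u.lower (x : ℂ)

/-- The average `⟨u⟩(x₁) = (u(x₁, 0⁺) + u(x₁, 0⁻)) / 2`. -/
def average (u : BimaterialField E) (x : ℝ) : E :=
  (1 / 2 : ℝ) • (u.upper (x : ℂ) + u.lower (x : ℂ))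

/-- The traction `σ₃₂(x₁, 0⁺) = μ₊ ∂u/∂x₂ (x₁, 0⁺)`. -/
def tractionUpper (μp : ℝ) (u : BimaterialField E) (x : ℝ) : E :=
  μp • fderivWithin ℝ u.upper upperHalf (x : ℂ) Complex.I

/-- The traction `σ₃₂(x₁, 0⁻) = μ₋ ∂u/∂x₂ (x₁, 0⁻)`. -/
def tractionLower (μm : ℝ) (u : BimaterialField E) (x : ℝ) : E :=
  μm • fderivWithin ℝ u.lower lowerHalf (x : ℂ) Complex.I

/-- Equilibrium without body forces. As `(σ₃₁, σ₃₂) = μ ∇u` with `μ` constant in each half-plane,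
the equation `∂σ₃₁/∂x₁ + ∂σ₃₂/∂x₂ = 0` is Laplace's equation there. The field is continuously
differentiable up to the interface and the crack faces, the crack tip excepted. -/
structure IsEquilibrium (u : BimaterialField E) : Prop where
  contDiff_upper : ContDiffOn ℝ 1 u.upper upperHalf
  contDiff_lower : ContDiffOn ℝ 1 u.lower lowerHalf
  harmonic_upper : InnerProductSpace.HarmonicOnNhd u.upper {z : ℂ | 0 < z.im}
  harmonic_lower : InnerProductSpace.HarmonicOnNhd u.lower {z : ℂ | z.im < 0}

end Fields

/-! ### Weight functions -/

/-- Singular solutions of the homogeneous problem; here the crack is `x₁ > 0`. The displacement is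
continuous across the interface `x₁ < 0`, the traction is continuous and vanishes on the crack
faces, and the field is homogeneous of degree `-1/2`. -/
structure IsSingularSolution (μp μm : ℝ) (U : BimaterialField ℂ) : Prop where
  equilibrium : IsEquilibrium U
  jump_eq_zero : ∀ x : ℝ, x < 0 → jump U x = 0
  traction_continuous : ∀ x : ℝ, x < 0 → tractionUpper μp U x = tractionLower μm U x
  traction_free_upper : ∀ x : ℝ, 0 < x → tractionUpper μp U x = 0
  traction_free_lower : ∀ x : ℝ, 0 < x → tractionLower μm U x = 0
  homogeneous_upper : ∀ t : ℝ, 0 < t → ∀ z ∈ upperHalf,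
    U.upper ((t : ℂ) * z) = ((t ^ (-1 / 2 : ℝ) : ℝ) : ℂ) * U.upper z
  homogeneous_lower : ∀ t : ℝ, 0 < t → ∀ z ∈ lowerHalf,
    U.lower ((t : ℂ) * z) = ((t ^ (-1 / 2 : ℝ) : ℝ) : ℂ) * U.lower z

/-- The transform `∫₀^∞ f(x) e^{iβx} dx`, for `β` in the upper half-plane. -/
def plusTransform (f : ℝ → ℂ) (β : ℂ) : ℂ :=
  ∫ x in Ioi (0 : ℝ), f x * Complex.exp (Complex.I * β * (x : ℂ))

/-- The weight function: the singular solution normalised by the condition that the transform of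
its jump is `β₊^{-1/2}` (principal branch on the upper half-plane). -/
structure IsWeightFunction (μp μm : ℝ) (U : BimaterialField ℂ) : Prop where
  singular : IsSingularSolution μp μm U
  normalised : ∀ β : ℂ, 0 < β.im → plusTransform (jump U) β = β ^ (-1 / 2 : ℂ)

/-- `c` is the limit value at the real point `β`, from the upper half-plane, of the transform of
`f`. -/
def HasPlusTransform (f : ℝ → ℂ) (β : ℝ) (c : ℂ) : Prop :=
  Tendsto (fun ε : ℝ => plusTransform f ((β : ℂ) + (ε : ℂ) * Complex.I)) (𝓝[>] 0) (𝓝 c)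

/-- `c` is the Hadamard finite part of `∫_{-∞}^0 f(x) e^{iβx} dx`, for a function `f` that may have
a singularity of order `(-x)^{-3/2}` at `0`. -/
def HasMinusTransform (f : ℝ → ℂ) (β : ℝ) (c : ℂ) : Prop :=
  ∃ a : ℂ, Tendsto (fun δ : ℝ =>
    (∫ x in Iio (-δ), f x * Complex.exp (Complex.I * (β : ℂ) * (x : ℂ)))
      - a * ((δ ^ (-1 / 2 : ℝ) : ℝ) : ℂ)) (𝓝[>] 0) (𝓝 c)

/-- The limit value `β₊^{1/2}` on the real axis. -/
def sqrtPlus (β : ℝ) : ℂ :=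
  if 0 < β then (Real.sqrt β : ℂ) else Complex.I * (Real.sqrt (-β) : ℂ)

/-- The limit value `β₋^{1/2}` on the real axis. -/
def sqrtMinus (β : ℝ) : ℂ :=
  if 0 < β then (Real.sqrt β : ℂ) else -Complex.I * (Real.sqrt (-β) : ℂ)

/-! ### Bimaterial constants and loads -/

/-- The bimaterial constant `η = (μ₋ - μ₊) / (μ₋ + μ₊)`. -/
def eta (μp μm : ℝ) : ℝ := (μm - μp) / (μm + μp)

/-- The bimaterial constant `b + e = 1/μ₊ + 1/μ₋`. -/
def compliance (μp μm : ℝ) : ℝ := 1 / μp + 1 / μm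

/-- The symmetric part `⟨p₃⟩` of the load. -/
def loadAverage (pp pm : ℝ → ℝ) (x : ℝ) : ℝ := (pp x + pm x) / 2

/-- The skew-symmetric part `⟦p₃⟧` of the load. -/
def loadJump (pp pm : ℝ → ℝ) (x : ℝ) : ℝ := pp x - pm x

/-- A load on one crack face: it vanishes near the crack tip and is integrable. -/
structure IsLoad (p : ℝ → ℝ) : Prop where
  vanishes_near_tip : ∃ δ > 0, ∀ x ∈ Ioo (-δ) 0, p x = 0
  integrable : IntegrableOn p (Iio 0)

/-- A load that is moreover continuously differentiable with integrable derivative. -/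
structure IsSmoothLoad (p : ℝ → ℝ) : Prop extends IsLoad p where
  contDiff : ContDiffOn ℝ 1 p (Iio 0)
  integrable_deriv : IntegrableOn (deriv p) (Iio 0)

/-! ### The physical problem -/

/-- The physical antiplane problem; here the crack is `x₁ < 0`. Its faces carry the tractions
`σ₃₂(x₁, 0^±) = p₃^±(x₁)`, displacement and traction are continuous across the interface `x₁ > 0`,
the elastic energy is finite and the displacement vanishes at infinity. -/
structure IsPhysicalSolution (μp μm : ℝ) (pp pm : ℝ → ℝ) (u : BimaterialField ℝ) : Prop where
  equilibrium : IsEquilibrium u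
  load_upper : ∀ x : ℝ, x < 0 → tractionUpper μp u x = pp x
  load_lower : ∀ x : ℝ, x < 0 → tractionLower μm u x = pm x
  jump_eq_zero : ∀ x : ℝ, 0 < x → jump u x = 0
  traction_continuous : ∀ x : ℝ, 0 < x → tractionUpper μp u x = tractionLower μm u x
  energy_upper : IntegrableOn (fun z => μp / 2 * ‖fderiv ℝ u.upper z‖ ^ 2) {z : ℂ | 0 < z.im}
  energy_lower : IntegrableOn (fun z => μm / 2 * ‖fderiv ℝ u.lower z‖ ^ 2) {z : ℂ | z.im < 0}
  vanishes_upper : Tendsto u.upper (cocompact ℂ ⊓ 𝓟 {z : ℂ | 0 ≤ z.im}) (𝓝 0)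
  vanishes_lower : Tendsto u.lower (cocompact ℂ ⊓ 𝓟 {z : ℂ | z.im ≤ 0}) (𝓝 0)

/-- `K` and `A` are the stress intensity factor `K_III` and the second-order coefficient `A_III`
of the field `u`: the coefficients in the asymptotics at the crack tip of the traction ahead of the
crack and of the crack opening. -/
def HasTipAsymptotics (μp μm : ℝ) (u : BimaterialField ℝ) (K A : ℝ) : Prop :=
  (fun x : ℝ => tractionUpper μp u x
      - (K / Real.sqrt (2 * Real.pi) * x ^ (-1 / 2 : ℝ)
        + A / Real.sqrt (2 * Real.pi) * x ^ (1 / 2 : ℝ)))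
    =O[𝓝[>] 0] (fun x : ℝ => x ^ (3 / 2 : ℝ)) ∧
  (fun x : ℝ => jump u x
      - (2 * compliance μp μm * K / Real.sqrt (2 * Real.pi) * (-x) ^ (1 / 2 : ℝ)
        - 2 * compliance μp μm * A / (3 * Real.sqrt (2 * Real.pi)) * (-x) ^ (3 / 2 : ℝ)))
    =O[𝓝[<] 0] (fun x : ℝ => (-x) ^ (5 / 2 : ℝ))

end InterfaceCrack

end

/-!
Everything rests on the complex gradient `h = ∂w/∂x₁ - i ∂w/∂x₂` of a real field `w` that is
harmonic in the upper half-plane and `C¹` up to its boundary without the origin: `h` is holomorphic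
inside and continuous up to the boundary, `Re h` is the tangential derivative there and `-Im h` the
normal one. Fields in the lower half-plane are reflected to the upper one, so that both halves of a
bimaterial field live on the same domain, and `z = exp s` maps the strip `0 ≤ Im s ≤ π` onto it.

*Weight functions.* The gradient of a field homogeneous of degree `-1/2` has degree `-3/2`, hence
`z^{3/2} h(z)` depends on `Im s` only; being holomorphic, it is constant
(`IsComplexGradient.exists_eq_const`). For each real component of a weight function the sum
`μ₊ u₊ + μ₋ u₋` has vanishing normal derivative on both half-lines, which forces the constant and
the sum to be zero. So `u₊` and `u₋` are fixed multiples of the jump, which gives `⟨U⟩ = (η/2) ⟦U⟧`,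
and the jump is determined up to one factor (`IsSingularSolution.exists_real_traces`). The
normalisation fixes this factor by a Gaussian integral, and the same integral shows that a multiple
of `Re z^{-1/2}` is a weight function (`exists_isWeightFunction`). The finite part transform of the
traction is reduced by an integration by parts to the same integral for complex frequency, followed
by passage to the real axis (`hasMinusTransform`).

*Coefficients at the tip.* For a physical solution, `w = u₊ - u₋` (reflected) vanishes ahead of the
tip and has normal derivative `p⁺/μ₊ + p⁻/μ₋` on the crack. In the strip, `√z h(z)` therefore has
real part zero on one boundary line and prescribed real part on the other. Finite energy provides,
in every dyadic annulus, a half circle on which `√z h(z)` is small enough for the contributions of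
both ends of the strip to vanish (`exists_seq_arcs`), so `√z h(z)` is a Cauchy integral of the
prescribed values (`schwarz_formula`). As the loads vanish near the tip, the Cauchy kernel can be
expanded there (`IsMixedSolution.exists_expansion`). The two leading coefficients, moments of the
load with weights `(-t)^{-1/2}` and `(-t)^{-3/2}`, are up to factors `K` and `A`
(`IsPhysicalSolution.hasTipAsymptotics`); an integration by parts turns the second into a moment of
the derivative of the load. The integrals against a weight function converge to these moments by
dominated convergence (`IsWeightFunction.tendsto_integral`).
-/

namespace InterfaceCrack

/-! ### Complex gradients -/

/-- The real-linear functional `v ↦ Re (c v)` on `ℂ`. Every real differential of a real function of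
a complex variable has this form, with `c = ∂f/∂x₁ - i ∂f/∂x₂`. -/
noncomputable def reMul (c : ℂ) : ℂ →L[ℝ] ℝ := Complex.reCLM ∘L ContinuousLinearMap.mul ℝ ℂ c

@[simp]
lemma reMul_apply (c v : ℂ) : reMul c v = (c * v).re := by simp [reMul]

lemma eq_reMul (L : ℂ →L[ℝ] ℝ) : L = reMul ((L 1 : ℂ) - Complex.I * (L Complex.I : ℂ)) := by
  ext v
  have hv : v = v.re • (1 : ℂ) + v.im • Complex.I := by
    simp [Complex.re_add_im]
  conv_lhs => rw [hv, map_add, map_smul, map_smul]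
  simp [mul_comm]

lemma norm_le_norm_reMul (c : ℂ) : ‖c‖ ≤ ‖reMul c‖ := by
  rcases eq_or_ne c 0 with rfl | hc
  · simp
  have h := (reMul c).le_opNorm ((starRingEnd ℂ) c)
  have hre : (c * (starRingEnd ℂ) c).re = ‖c‖ * ‖c‖ := by
    rw [Complex.mul_conj, Complex.ofReal_re, Complex.normSq_eq_norm_sq, sq]
  rw [reMul_apply, hre, RCLike.norm_conj, Real.norm_eq_abs, abs_mul_self] at h
  exact le_of_mul_le_mul_right h (norm_pos_iff.2 hc)

lemma isOpen_im_pos : IsOpen {z : ℂ | 0 < z.im} := isOpen_lt continuous_const Complex.continuous_im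

lemma isOpen_im_neg : IsOpen {z : ℂ | z.im < 0} := isOpen_lt Complex.continuous_im continuous_const

lemma im_pos_subset_upperHalf : {z : ℂ | 0 < z.im} ⊆ upperHalf := fun z hz =>
  ⟨le_of_lt hz, fun h => by simp [h] at hz⟩

lemma im_neg_subset_lowerHalf : {z : ℂ | z.im < 0} ⊆ lowerHalf := fun z hz =>
  ⟨le_of_lt hz, fun h => by simp [h] at hz⟩

lemma ofReal_mem_upperHalf {x : ℝ} (hx : x ≠ 0) : (x : ℂ) ∈ upperHalf :=
  ⟨by simp, by simpa using hx⟩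

lemma ofReal_mem_lowerHalf {x : ℝ} (hx : x ≠ 0) : (x : ℂ) ∈ lowerHalf :=
  ⟨by simp, by simpa using hx⟩

lemma conj_mem_lowerHalf {z : ℂ} (hz : z ∈ upperHalf) : (starRingEnd ℂ) z ∈ lowerHalf :=
  ⟨by simpa using hz.1, by simpa using hz.2⟩

lemma conj_mem_upperHalf {z : ℂ} (hz : z ∈ lowerHalf) : (starRingEnd ℂ) z ∈ upperHalf :=
  ⟨by simpa using hz.1, by simpa using hz.2⟩

lemma uniqueDiffOn_upperHalf : UniqueDiffOn ℝ upperHalf := by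
  have h1 : UniqueDiffOn ℝ {z : ℂ | 0 ≤ z.im} :=
    uniqueDiffOn_convex (convex_halfSpace_im_ge 0)
      ⟨Complex.I, mem_interior.2 ⟨{z : ℂ | 0 < z.im}, fun z (h : 0 < z.im) => h.le,
        isOpen_im_pos, by simp⟩⟩
  exact h1.inter isOpen_compl_singleton

lemma uniqueDiffOn_lowerHalf : UniqueDiffOn ℝ lowerHalf := by
  have h1 : UniqueDiffOn ℝ {z : ℂ | z.im ≤ 0} :=
    uniqueDiffOn_convex (convex_halfSpace_im_le 0)
      ⟨-Complex.I, mem_interior.2 ⟨{z : ℂ | z.im < 0}, fun z (h : z.im < 0) => h.le,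
        isOpen_im_neg, by simp⟩⟩
  exact h1.inter isOpen_compl_singleton

lemma upperHalf_mem_nhds {z : ℂ} (hz : 0 < z.im) : upperHalf ∈ 𝓝 z :=
  mem_of_superset (isOpen_im_pos.mem_nhds hz) im_pos_subset_upperHalf

lemma lowerHalf_mem_nhds {z : ℂ} (hz : z.im < 0) : lowerHalf ∈ 𝓝 z :=
  mem_of_superset (isOpen_im_neg.mem_nhds hz) im_neg_subset_lowerHalf

/-- `h` is the complex gradient `∂w/∂x₁ - i ∂w/∂x₂` of the real function `w` on the closed upper
half-plane without the origin; it is continuous there and, as for a harmonic `w`, holomorphic in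
the open half-plane. -/
structure IsComplexGradient (w : ℂ → ℝ) (h : ℂ → ℂ) : Prop where
  hasFDerivWithinAt : ∀ z ∈ upperHalf, HasFDerivWithinAt w (reMul (h z)) upperHalf z
  continuousOn : ContinuousOn h upperHalf
  differentiableOn : DifferentiableOn ℂ h {z | 0 < z.im}

namespace IsComplexGradient

variable {w w₁ w₂ : ℂ → ℝ} {h h₁ h₂ : ℂ → ℂ}

lemma fderivWithin_eq (H : IsComplexGradient w h) {z : ℂ} (hz : z ∈ upperHalf) :
    fderivWithin ℝ w upperHalf z = reMul (h z) :=
  (H.hasFDerivWithinAt z hz).fderivWithin (uniqueDiffOn_upperHalf z hz)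

lemma hasFDerivAt (H : IsComplexGradient w h) {z : ℂ} (hz : 0 < z.im) :
    HasFDerivAt w (reMul (h z)) z :=
  (H.hasFDerivWithinAt z (im_pos_subset_upperHalf hz)).hasFDerivAt (upperHalf_mem_nhds hz)

lemma linearCombination (H₁ : IsComplexGradient w₁ h₁) (H₂ : IsComplexGradient w₂ h₂) (a b : ℝ) :
    IsComplexGradient (fun z => a * w₁ z + b * w₂ z) (fun z => a * h₁ z + b * h₂ z) where
  hasFDerivWithinAt z hz := by
    have := ((H₁.hasFDerivWithinAt z hz).const_mul a).add ((H₂.hasFDerivWithinAt z hz).const_mul b)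
    convert! this using 1
    ext v
    simp only [reMul_apply, _root_.add_apply, _root_.smul_apply, smul_eq_mul, add_mul, mul_assoc,
      Complex.add_re, Complex.re_ofReal_mul]
  continuousOn := (continuousOn_const.mul H₁.continuousOn).add
    (continuousOn_const.mul H₂.continuousOn)
  differentiableOn := (H₁.differentiableOn.const_mul _).add (H₂.differentiableOn.const_mul _)

/-- The derivative of `w` along a differentiable curve in the half-plane. -/
lemma hasDerivWithinAt_comp (H : IsComplexGradient w h) {γ : ℝ → ℂ} {γ' : ℂ} {s : Set ℝ} {t : ℝ}
    (hγ : HasDerivWithinAt γ γ' s t) (ht : γ t ∈ upperHalf) (hs : MapsTo γ s upperHalf) :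
    HasDerivWithinAt (fun t => w (γ t)) ((h (γ t) * γ').re) s t := by
  have := (H.hasFDerivWithinAt _ ht).comp_hasDerivWithinAt t hγ hs
  rwa [reMul_apply] at this

lemma of_contDiffOn (hw : ContDiffOn ℝ 1 w upperHalf)
    (hd : DifferentiableOn ℂ
      (fun z => (fderiv ℝ w z 1 : ℂ) - Complex.I * (fderiv ℝ w z Complex.I : ℂ)) {z | 0 < z.im}) :
    IsComplexGradient w fun z => (fderivWithin ℝ w upperHalf z 1 : ℂ)
      - Complex.I * (fderivWithin ℝ w upperHalf z Complex.I : ℂ) where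
  hasFDerivWithinAt z hz := by
    rw [← eq_reMul]
    exact (hw.differentiableOn one_ne_zero z hz).hasFDerivWithinAt
  continuousOn := by
    have hc := hw.continuousOn_fderivWithin uniqueDiffOn_upperHalf le_rfl
    have h1 := hc.clm_apply (continuousOn_const (c := (1 : ℂ)))
    have h2 := hc.clm_apply (continuousOn_const (c := Complex.I))
    exact (Complex.continuous_ofReal.comp_continuousOn h1).sub
      (continuousOn_const.mul (Complex.continuous_ofReal.comp_continuousOn h2))
  differentiableOn := hd.congr fun z hz => by
    rw [fderivWithin_of_mem_nhds (upperHalf_mem_nhds hz)]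

end IsComplexGradient

/-- A harmonic function in the upper half-plane, `C¹` up to the boundary, has a complex gradient. -/
lemma exists_isComplexGradient_of_upper {f : ℂ → ℝ} (hf : ContDiffOn ℝ 1 f upperHalf)
    (hh : InnerProductSpace.HarmonicOnNhd f {z : ℂ | 0 < z.im}) : ∃ h, IsComplexGradient f h :=
  ⟨_, .of_contDiffOn hf fun z hz =>
    (HarmonicAt.differentiableAt_complex_partial (hh z hz)).differentiableWithinAt⟩

lemma contDiffOn_comp_conj {f : ℂ → ℝ} (hf : ContDiffOn ℝ 1 f lowerHalf) :
    ContDiffOn ℝ 1 (fun z => f ((starRingEnd ℂ) z)) upperHalf :=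
  hf.comp (Complex.conjCLE.contDiff.contDiffOn) fun _ hz => conj_mem_lowerHalf hz

/-- The reflection of a harmonic function in the lower half-plane has a complex gradient. -/
lemma exists_isComplexGradient_of_lower {f : ℂ → ℝ} (hf : ContDiffOn ℝ 1 f lowerHalf)
    (hh : InnerProductSpace.HarmonicOnNhd f {z : ℂ | z.im < 0}) :
    ∃ h, IsComplexGradient (fun z => f ((starRingEnd ℂ) z)) h := by
  refine ⟨_, .of_contDiffOn (contDiffOn_comp_conj hf) fun z hz => ?_⟩
  have hz' : ((starRingEnd ℂ) z).im < 0 := by simpa using hz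
  have hd := (HarmonicAt.differentiableAt_complex_partial (hh _ hz')).conj_conj
  rw [Complex.conj_conj] at hd
  refine (hd.congr_of_eventuallyEq ?_).differentiableWithinAt
  filter_upwards [isOpen_im_pos.mem_nhds hz] with y hy
  have hy' : ((starRingEnd ℂ) y).im < 0 := by simpa using hy
  have hfd : HasFDerivAt f (fderiv ℝ f ((starRingEnd ℂ) y)) (Complex.conjCLE y) :=
    ((hh _ hy').1.differentiableAt two_ne_zero).hasFDerivAt
  have h2 : HasFDerivAt (fun z => f ((starRingEnd ℂ) z))
      ((fderiv ℝ f ((starRingEnd ℂ) y)).comp (Complex.conjCLE : ℂ →L[ℝ] ℂ)) y :=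
    hfd.comp y Complex.conjCLE.hasFDerivAt
  rw [h2.fderiv]
  simp

section Tractions

variable {u : BimaterialField ℝ} {h : ℂ → ℂ}

lemma tractionUpper_eq (H : IsComplexGradient u.upper h) (μ : ℝ) {x : ℝ} (hx : x ≠ 0) :
    tractionUpper μ u x = -(μ * (h x).im) := by
  rw [tractionUpper, H.fderivWithin_eq (ofReal_mem_upperHalf hx)]
  simp

lemma hasFDerivWithinAt_lower (H : IsComplexGradient (fun z => u.lower ((starRingEnd ℂ) z)) h)
    {z : ℂ} (hz : z ∈ upperHalf) : HasFDerivWithinAt u.lower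
      ((reMul (h z)).comp (Complex.conjCLE : ℂ →L[ℝ] ℂ)) lowerHalf ((starRingEnd ℂ) z) := by
  have h1 : HasFDerivWithinAt (fun z => u.lower ((starRingEnd ℂ) z)) (reMul (h z)) upperHalf
      (Complex.conjCLE ((starRingEnd ℂ) z)) := by
    simpa using H.hasFDerivWithinAt z hz
  have h2 := h1.comp ((starRingEnd ℂ) z) (Complex.conjCLE.hasFDerivAt.hasFDerivWithinAt)
    (s := lowerHalf) fun _ hy => conj_mem_upperHalf hy
  have h3 : (fun z => u.lower ((starRingEnd ℂ) z)) ∘ Complex.conjCLE = u.lower := by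
    ext z; simp
  rwa [h3] at h2

lemma tractionLower_eq (H : IsComplexGradient (fun z => u.lower ((starRingEnd ℂ) z)) h) (μ : ℝ)
    {x : ℝ} (hx : x ≠ 0) : tractionLower μ u x = μ * (h x).im := by
  have h1 := hasFDerivWithinAt_lower H (ofReal_mem_upperHalf hx)
  rw [Complex.conj_ofReal] at h1
  rw [tractionLower, h1.fderivWithin (uniqueDiffOn_lowerHalf _ (ofReal_mem_lowerHalf hx))]
  simp

end Tractions

/-! ### A Schwarz formula in the strip `0 < Im s < π` -/

/-- The closed strip `0 ≤ Im s ≤ π`, which `exp` maps onto the closed upper half-plane without the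
origin. -/
def closedStrip : Set ℂ := {s | 0 ≤ s.im ∧ s.im ≤ Real.pi}

/-- The open strip `0 < Im s < π`, which `exp` maps onto the open upper half-plane. -/
def openStrip : Set ℂ := {s | 0 < s.im ∧ s.im < Real.pi}

lemma openStrip_subset_closedStrip : openStrip ⊆ closedStrip := fun _ hs => ⟨hs.1.le, hs.2.le⟩

lemma isOpen_openStrip : IsOpen openStrip :=
  (isOpen_lt continuous_const Complex.continuous_im).inter
    (isOpen_lt Complex.continuous_im continuous_const)

lemma closedStrip_subset_closure : closedStrip ⊆ closure openStrip := by
  have h : openStrip = Complex.im ⁻¹' Ioo 0 Real.pi := rfl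
  rw [h, Complex.closure_preimage_im, closure_Ioo Real.pi_pos.ne]
  exact fun s hs => hs

lemma exp_im_pos {s : ℂ} (hs : s ∈ openStrip) : 0 < (Complex.exp s).im := by
  rw [Complex.exp_im]
  exact mul_pos (Real.exp_pos _) (Real.sin_pos_of_pos_of_lt_pi hs.1 hs.2)

lemma exp_mem_upperHalf {s : ℂ} (hs : s ∈ closedStrip) : Complex.exp s ∈ upperHalf := by
  refine ⟨?_, Complex.exp_ne_zero s⟩
  rw [Complex.exp_im]
  exact mul_nonneg (Real.exp_pos _).le (Real.sin_nonneg_of_nonneg_of_le_pi hs.1 hs.2)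

lemma exp_sub_exp_ne_zero {s ζ : ℂ} (hs : s ∈ closedStrip) (hζ : ζ ∈ openStrip) (h : s ≠ ζ) :
    Complex.exp s - Complex.exp ζ ≠ 0 := fun h0 => h <| by
  have hpi := Real.pi_pos
  exact Complex.exp_inj_of_neg_pi_lt_of_le_pi (by linarith [hs.1]) hs.2 (by linarith [hζ.1])
    hζ.2.le (sub_eq_zero.1 h0)

lemma exp_sub_conj_exp_ne_zero {s ζ : ℂ} (hs : s ∈ closedStrip) (hζ : ζ ∈ openStrip) :
    Complex.exp s - (starRingEnd ℂ) (Complex.exp ζ) ≠ 0 := fun h0 => by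
  have h1 := congrArg Complex.im (sub_eq_zero.1 h0)
  rw [Complex.conj_im] at h1
  linarith [(exp_mem_upperHalf hs).1, exp_im_pos hζ]

/-- The Cauchy kernel `dw / (w - z)` in the coordinate `w = exp s`. -/
noncomputable def kernel (z s : ℂ) : ℂ := Complex.exp s / (Complex.exp s - z)

/-- The integral over the boundary of the rectangle `[a, b] × [0, π]`. -/
noncomputable def rectIntegral (f : ℂ → ℂ) (a b : ℝ) : ℂ :=
  (∫ x in a..b, f x) - (∫ x in a..b, f (x + Real.pi * Complex.I))
    + Complex.I * (∫ y in (0 : ℝ)..Real.pi, f (b + y * Complex.I))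
    - Complex.I * (∫ y in (0 : ℝ)..Real.pi, f (a + y * Complex.I))

lemma ofReal_mem_closedStrip (x : ℝ) : (x : ℂ) ∈ closedStrip := by
  constructor <;> simp [Real.pi_pos.le]

lemma add_pi_mem_closedStrip (x : ℝ) : (x + Real.pi * Complex.I : ℂ) ∈ closedStrip := by
  constructor <;> simp [Real.pi_pos.le]

lemma add_mul_I_mem_closedStrip (x : ℝ) {y : ℝ} (hy : y ∈ Icc 0 Real.pi) :
    (x + y * Complex.I : ℂ) ∈ closedStrip := by
  constructor <;> simp [hy.1, hy.2]

lemma rectIntegral_eq_zero {f : ℂ → ℂ} (hc : ContinuousOn f closedStrip)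
    (hd : DifferentiableOn ℂ f openStrip) (a b : ℝ) : rectIntegral f a b = 0 := by
  have := Complex.integral_boundary_rect_eq_zero_of_continuousOn_of_differentiableOn f
    (a : ℂ) (b + Real.pi * Complex.I : ℂ) ?_ ?_
  · simpa [rectIntegral] using this
  · refine hc.mono fun s hs => ?_
    have h2 := hs.2
    simp only [mem_preimage, Complex.ofReal_im, Complex.add_im, Complex.mul_im, Complex.ofReal_re,
      Complex.I_im, Complex.I_re, mul_one, mul_zero, zero_add, add_zero,
      uIcc_of_le Real.pi_pos.le] at h2
    exact h2
  · refine hd.mono fun s hs => ?_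
    have h2 := hs.2
    simp only [mem_preimage, Complex.ofReal_im, Complex.add_im, Complex.mul_im, Complex.ofReal_re,
      Complex.I_im, Complex.I_re, mul_one, mul_zero, zero_add, add_zero,
      min_eq_left Real.pi_pos.le, max_eq_right Real.pi_pos.le] at h2
    exact h2

section Boundary

variable {f : ℂ → ℂ} {ζ : ℂ}

lemma ofReal_ne_of_mem (hζ : ζ ∈ openStrip) (x : ℝ) : (x : ℂ) ≠ ζ := fun h => by
  have := hζ.1; rw [← h] at this; simp at this

lemma add_pi_ne_of_mem (hζ : ζ ∈ openStrip) (x : ℝ) : (x + Real.pi * Complex.I : ℂ) ≠ ζ :=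
  fun h => by have := hζ.2; rw [← h] at this; simp at this

lemma add_mul_I_ne {x : ℝ} (hx : x ≠ ζ.re) (y : ℝ) : (x + y * Complex.I : ℂ) ≠ ζ :=
  fun h => hx (by simp [← h])

lemma continuous_bottom (hf : ContinuousOn f (closedStrip \ {ζ})) (hζ : ζ ∈ openStrip) :
    Continuous fun x : ℝ => f x :=
  hf.comp_continuous Complex.continuous_ofReal fun x =>
    ⟨ofReal_mem_closedStrip x, ofReal_ne_of_mem hζ x⟩

lemma continuous_top (hf : ContinuousOn f (closedStrip \ {ζ})) (hζ : ζ ∈ openStrip) :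
    Continuous fun x : ℝ => f (x + Real.pi * Complex.I) :=
  hf.comp_continuous (by fun_prop) fun x => ⟨add_pi_mem_closedStrip x, add_pi_ne_of_mem hζ x⟩

lemma continuousOn_side (hf : ContinuousOn f (closedStrip \ {ζ})) {x : ℝ} (hx : x ≠ ζ.re) :
    ContinuousOn (fun y : ℝ => f (x + y * Complex.I)) (uIcc 0 Real.pi) := by
  rw [uIcc_of_le Real.pi_pos.le]
  exact hf.comp (by fun_prop) fun y hy => ⟨add_mul_I_mem_closedStrip x hy, add_mul_I_ne hx y⟩

lemma rectIntegral_sub_const_mul {g : ℂ → ℂ} (hf : ContinuousOn f (closedStrip \ {ζ}))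
    (hg : ContinuousOn g (closedStrip \ {ζ})) (hζ : ζ ∈ openStrip) {a b : ℝ} (ha : a ≠ ζ.re)
    (hb : b ≠ ζ.re) (c : ℂ) :
    rectIntegral (fun s => f s - c * g s) a b = rectIntegral f a b - c * rectIntegral g a b := by
  have hcg : ContinuousOn (fun s => c * g s) (closedStrip \ {ζ}) := continuousOn_const.mul hg
  unfold rectIntegral
  rw [intervalIntegral.integral_sub ((continuous_bottom hf hζ).intervalIntegrable _ _)
      ((continuous_bottom hcg hζ).intervalIntegrable _ _),
    intervalIntegral.integral_sub ((continuous_top hf hζ).intervalIntegrable _ _)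
      ((continuous_top hcg hζ).intervalIntegrable _ _),
    intervalIntegral.integral_sub (continuousOn_side hf hb).intervalIntegrable
      (continuousOn_side hcg hb).intervalIntegrable,
    intervalIntegral.integral_sub (continuousOn_side hf ha).intervalIntegrable
      (continuousOn_side hcg ha).intervalIntegrable]
  simp only [intervalIntegral.integral_const_mul]
  ring

lemma rectIntegral_congr {g : ℂ → ℂ} (hfg : EqOn f g (closedStrip \ {ζ})) (hζ : ζ ∈ openStrip)
    {a b : ℝ} (ha : a ≠ ζ.re) (hb : b ≠ ζ.re) : rectIntegral f a b = rectIntegral g a b := by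
  have hside : ∀ x : ℝ, x ≠ ζ.re → (∫ y in (0 : ℝ)..Real.pi, f (x + y * Complex.I))
      = ∫ y in (0 : ℝ)..Real.pi, g (x + y * Complex.I) := fun x hx =>
    intervalIntegral.integral_congr fun y hy => by
      rw [uIcc_of_le Real.pi_pos.le] at hy
      exact hfg ⟨add_mul_I_mem_closedStrip x hy, add_mul_I_ne hx y⟩
  unfold rectIntegral
  rw [hside a ha, hside b hb]
  simp only [fun x : ℝ => hfg ⟨ofReal_mem_closedStrip x, ofReal_ne_of_mem hζ x⟩,
    fun x : ℝ => hfg ⟨add_pi_mem_closedStrip x, add_pi_ne_of_mem hζ x⟩]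

lemma continuousOn_kernel (hζ : ζ ∈ openStrip) :
    ContinuousOn (kernel (Complex.exp ζ)) (closedStrip \ {ζ}) :=
  Complex.continuous_exp.continuousOn.div
    (Complex.continuous_exp.sub continuous_const).continuousOn
    fun _ hs => exp_sub_exp_ne_zero hs.1 hζ hs.2

lemma continuousOn_kernel_conj (hζ : ζ ∈ openStrip) :
    ContinuousOn (kernel ((starRingEnd ℂ) (Complex.exp ζ))) closedStrip :=
  Complex.continuous_exp.continuousOn.div
    (Complex.continuous_exp.sub continuous_const).continuousOn
    fun _ hs => exp_sub_conj_exp_ne_zero hs hζ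

lemma differentiableOn_kernel_conj (hζ : ζ ∈ openStrip) :
    DifferentiableOn ℂ (kernel ((starRingEnd ℂ) (Complex.exp ζ))) openStrip :=
  Complex.differentiable_exp.differentiableOn.div
    (Complex.differentiable_exp.sub_const _).differentiableOn
    fun _ hs => exp_sub_conj_exp_ne_zero (openStrip_subset_closedStrip hs) hζ

/-- Cauchy's formula on a rectangle, with the index of the contour left as an integral. -/
lemma rectIntegral_mul_kernel (hc : ContinuousOn f closedStrip)
    (hd : DifferentiableOn ℂ f openStrip) (hζ : ζ ∈ openStrip) {a b : ℝ} (ha : a < ζ.re)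
    (hb : ζ.re < b) : rectIntegral (fun s => f s * kernel (Complex.exp ζ) s) a b
      = f ζ * rectIntegral (kernel (Complex.exp ζ)) a b := by
  have hmem : closedStrip ∈ 𝓝 ζ :=
    mem_of_superset (isOpen_openStrip.mem_nhds hζ) openStrip_subset_closedStrip
  have hmem' := isOpen_openStrip.mem_nhds hζ
  have hne : ∀ s ∈ closedStrip, dslope Complex.exp ζ s ≠ 0 := fun s hs => by
    rcases eq_or_ne s ζ with rfl | h
    · rw [dslope_same, Complex.deriv_exp]
      exact Complex.exp_ne_zero _
    · rw [dslope_of_ne _ h, slope_def_field]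
      exact div_ne_zero (exp_sub_exp_ne_zero hs hζ h) (sub_ne_zero.2 h)
  -- the difference quotient extends `(f s - f ζ) / (exp s - exp ζ)` across its pole
  have h0 : rectIntegral (fun s => dslope f ζ s * (Complex.exp s / dslope Complex.exp ζ s)) a b
      = 0 := by
    refine rectIntegral_eq_zero ?_ ?_ a b
    · exact ((continuousOn_dslope hmem).2 ⟨hc, hd.differentiableAt hmem'⟩).mul
        (Complex.continuous_exp.continuousOn.div ((continuousOn_dslope hmem).2
          ⟨Complex.continuous_exp.continuousOn, Complex.differentiable_exp ζ⟩) hne)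
    · exact ((Complex.differentiableOn_dslope hmem').2 hd).mul
        (Complex.differentiable_exp.differentiableOn.div
          ((Complex.differentiableOn_dslope hmem').2 Complex.differentiable_exp.differentiableOn)
          fun s hs => hne s (openStrip_subset_closedStrip hs))
  have h1 : EqOn (fun s => dslope f ζ s * (Complex.exp s / dslope Complex.exp ζ s))
      (fun s => f s * kernel (Complex.exp ζ) s - f ζ * kernel (Complex.exp ζ) s)
      (closedStrip \ {ζ}) := fun s hs => by
    have hs2 : s ≠ ζ := hs.2
    have h3 := exp_sub_exp_ne_zero hs.1 hζ hs2
    have h4 := sub_ne_zero.2 hs2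
    simp only [dslope_of_ne _ hs2, slope_def_field, kernel]
    field_simp
  have h2 : ContinuousOn (fun s => f s * kernel (Complex.exp ζ) s) (closedStrip \ {ζ}) :=
    (hc.mono sdiff_subset).mul (continuousOn_kernel hζ)
  rw [rectIntegral_congr h1 hζ ha.ne hb.ne', rectIntegral_sub_const_mul h2
    (continuousOn_kernel hζ) hζ ha.ne hb.ne' (f ζ)] at h0
  exact sub_eq_zero.1 h0

end Boundary

section KernelBounds

lemma norm_exp_add_mul_I (x y : ℝ) : ‖Complex.exp (x + y * Complex.I)‖ = Real.exp x := by
  rw [Complex.norm_exp]; simp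

lemma norm_kernel_le_two {z : ℂ} {x : ℝ} (hx : 2 * ‖z‖ ≤ Real.exp x) (y : ℝ) :
    ‖kernel z (x + y * Complex.I)‖ ≤ 2 := by
  have h1 := norm_sub_norm_le (Complex.exp (x + y * Complex.I)) z
  have h2 := Real.exp_pos x
  rw [norm_exp_add_mul_I] at h1
  rw [kernel, norm_div, norm_exp_add_mul_I]
  rw [div_le_iff₀ (by linarith [norm_nonneg z])]
  linarith

lemma norm_kernel_le {z : ℂ} (hz : z ≠ 0) {x : ℝ} (hx : 2 * Real.exp x ≤ ‖z‖) (y : ℝ) :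
    ‖kernel z (x + y * Complex.I)‖ ≤ 2 / ‖z‖ * Real.exp x := by
  have hz' := norm_pos_iff.2 hz
  have h1 := norm_sub_norm_le z (Complex.exp (x + y * Complex.I))
  have h2 := Real.exp_pos x
  rw [norm_exp_add_mul_I, norm_sub_rev] at h1
  rw [kernel, norm_div, norm_exp_add_mul_I, div_le_iff₀ (by linarith)]
  calc Real.exp x = 2 / ‖z‖ * Real.exp x * (‖z‖ / 2) := by field_simp
    _ ≤ _ := by gcongr; linarith

end KernelBounds

variable {ζ : ℂ}

lemma conj_kernel_conj (z : ℂ) (x : ℝ) :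
    (starRingEnd ℂ) (kernel ((starRingEnd ℂ) z) x) = kernel z x := by
  simp [kernel, ← Complex.exp_conj]

lemma exp_add_pi (x : ℝ) : Complex.exp (x + Real.pi * Complex.I) = -(Real.exp x : ℂ) := by
  rw [Complex.exp_add, Complex.exp_pi_mul_I]; simp

lemma kernel_add_pi (z : ℂ) (x : ℝ) :
    kernel z (x + Real.pi * Complex.I) = Real.exp x / (Real.exp x + z) := by
  rw [kernel, exp_add_pi, ← neg_div_neg_eq]
  ring_nf

lemma conj_kernel_conj_add_pi (z : ℂ) (x : ℝ) :
    (starRingEnd ℂ) (kernel ((starRingEnd ℂ) z) (x + Real.pi * Complex.I))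
      = kernel z (x + Real.pi * Complex.I) := by
  rw [kernel_add_pi, kernel_add_pi]
  simp only [map_div₀, map_add, Complex.conj_ofReal, Complex.conj_conj]

lemma ofReal_sub_mul_conj (t : ℝ) (z : ℂ) :
    ((t : ℂ) - z) * (t - (starRingEnd ℂ) z) = (((t - z.re) ^ 2 + z.im ^ 2 : ℝ) : ℂ) := by
  apply Complex.ext <;>
    simp only [Complex.mul_re, Complex.mul_im, Complex.sub_re, Complex.sub_im, Complex.ofReal_re,
      Complex.ofReal_im, Complex.conj_re, Complex.conj_im] <;> ring

lemma ofReal_ne_of_im_pos {z : ℂ} (hz : 0 < z.im) (t : ℝ) : (t : ℂ) - z ≠ 0 := fun h => by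
  have := congrArg Complex.im h; simp at this; linarith

lemma kernel_sub_kernel_conj {z : ℂ} (hz : 0 < z.im) (x : ℝ) :
    kernel z x - kernel ((starRingEnd ℂ) z) x
      = 2 * Complex.I * ((z.im * Real.exp x / ((Real.exp x - z.re) ^ 2 + z.im ^ 2) : ℝ) : ℂ) := by
  have h1 := ofReal_ne_of_im_pos hz (Real.exp x)
  have h2 : ((Real.exp x : ℝ) : ℂ) - (starRingEnd ℂ) z ≠ 0 := fun h => h1 <| by
    rw [← Complex.conj_ofReal, ← map_sub] at h
    exact (map_eq_zero _).1 h
  have h3 : (2 * Complex.I * z.im : ℂ) = z - (starRingEnd ℂ) z := by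
    rw [Complex.sub_conj]; push_cast; ring
  simp only [kernel, ← Complex.ofReal_exp]
  rw [Complex.ofReal_div, ← ofReal_sub_mul_conj, Complex.ofReal_mul, mul_div_assoc', ← mul_assoc,
    h3]
  field_simp
  ring

lemma integral_poisson {X Y : ℝ} (hY : 0 < Y) (a b : ℝ) :
    (∫ x in a..b, Y * Real.exp x / ((Real.exp x - X) ^ 2 + Y ^ 2))
      = Real.arctan ((Real.exp b - X) / Y) - Real.arctan ((Real.exp a - X) / Y) := by
  have hpos : ∀ x, (Real.exp x - X) ^ 2 + Y ^ 2 ≠ 0 := fun x => by positivity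
  refine intervalIntegral.integral_eq_sub_of_hasDerivAt
    (f := fun x => Real.arctan ((Real.exp x - X) / Y)) (fun x _ => ?_) ?_
  · convert! (((Real.hasDerivAt_exp x).sub_const X).div_const Y).arctan using 1
    have := hpos x
    field_simp
    ring
  · exact (Continuous.div (by fun_prop) (by fun_prop) hpos).intervalIntegrable _ _

lemma tendsto_integral_poisson {X Y : ℝ} (hY : 0 < Y) {a b : ℕ → ℝ} (ha : Tendsto a atTop atBot)
    (hb : Tendsto b atTop atTop) :
    Tendsto (fun n => (∫ x in a n..b n, Y * Real.exp x / ((Real.exp x - X) ^ 2 + Y ^ 2)))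
      atTop (𝓝 (Real.pi / 2 + Real.arctan (X / Y))) := by
  simp_rw [integral_poisson hY]
  have h1 : Tendsto (fun n => Real.arctan ((Real.exp (b n) - X) / Y)) atTop (𝓝 (Real.pi / 2)) :=
    (tendsto_nhds_of_tendsto_nhdsWithin Real.tendsto_arctan_atTop).comp
      ((tendsto_atTop_add_const_right _ (-X) (Real.tendsto_exp_atTop.comp hb)).atTop_div_const hY)
  have h2 : Tendsto (fun n => Real.arctan ((Real.exp (a n) - X) / Y)) atTop
      (𝓝 (Real.arctan ((0 - X) / Y))) :=
    (Real.continuous_arctan.tendsto _).comp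
      (((Real.tendsto_exp_atBot.comp ha).sub_const X).div_const Y)
  convert! h1.sub h2 using 2
  rw [zero_sub, neg_div, Real.arctan_neg, sub_neg_eq_add]

/-- An arc integral of `f * kernel z` is small if the arc integral of `‖f‖` is. -/
lemma norm_integral_side_le {f : ℂ → ℂ} {z : ℂ} {x C : ℝ}
    (hf : ContinuousOn f closedStrip)
    (hC : ∀ y : ℝ, ‖kernel z (x + y * Complex.I)‖ ≤ C) :
    ‖∫ y in (0 : ℝ)..Real.pi, f (x + y * Complex.I) * kernel z (x + y * Complex.I)‖
      ≤ C * ∫ y in (0 : ℝ)..Real.pi, ‖f (x + y * Complex.I)‖ := by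
  rw [← intervalIntegral.integral_const_mul]
  refine intervalIntegral.norm_integral_le_of_norm_le Real.pi_pos.le (ae_of_all _ fun y _ => ?_) ?_
  · rw [norm_mul, mul_comm]
    gcongr
    exact hC y
  · have h1 : ContinuousOn (fun y : ℝ => f (x + y * Complex.I)) (uIcc 0 Real.pi) := by
      rw [uIcc_of_le Real.pi_pos.le]
      exact hf.comp (by fun_prop) fun y hy => add_mul_I_mem_closedStrip x hy
    exact (h1.norm.const_smul C).intervalIntegrable

lemma tendsto_side_atTop {f : ℂ → ℂ} {z : ℂ} {b : ℕ → ℝ} (hf : ContinuousOn f closedStrip)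
    (hb : Tendsto b atTop atTop)
    (hfb : Tendsto (fun n => ∫ y in (0 : ℝ)..Real.pi, ‖f (b n + y * Complex.I)‖) atTop (𝓝 0)) :
    Tendsto (fun n => ∫ y in (0 : ℝ)..Real.pi,
      f (b n + y * Complex.I) * kernel z (b n + y * Complex.I)) atTop (𝓝 0) := by
  refine squeeze_zero_norm' ?_ (by simpa using hfb.const_mul 2)
  filter_upwards [(Real.tendsto_exp_atTop.comp hb).eventually_ge_atTop (2 * ‖z‖)] with n hn
  exact norm_integral_side_le hf fun y => norm_kernel_le_two hn y

lemma tendsto_side_atBot {f : ℂ → ℂ} {z : ℂ} (hz : z ≠ 0) {a : ℕ → ℝ}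
    (hf : ContinuousOn f closedStrip) (ha : Tendsto a atTop atBot)
    (hfa : Tendsto (fun n => Real.exp (a n) *
      ∫ y in (0 : ℝ)..Real.pi, ‖f (a n + y * Complex.I)‖) atTop (𝓝 0)) :
    Tendsto (fun n => ∫ y in (0 : ℝ)..Real.pi,
      f (a n + y * Complex.I) * kernel z (a n + y * Complex.I)) atTop (𝓝 0) := by
  refine squeeze_zero_norm' ?_ (by simpa using hfa.const_mul (2 / ‖z‖))
  have h1 := ((Real.tendsto_exp_atBot.comp ha).const_mul 2).eventually_le_const
    (u := ‖z‖) (by simpa using hz)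
  filter_upwards [h1] with n hn
  rw [← mul_assoc]
  exact norm_integral_side_le hf fun y => norm_kernel_le hz hn y

lemma integral_bottom_sub {z : ℂ} (hz : 0 < z.im) (a b : ℝ) :
    (∫ x : ℝ in a..b, (kernel z x - kernel ((starRingEnd ℂ) z) x))
      = 2 * Complex.I * ((∫ x in a..b,
        z.im * Real.exp x / ((Real.exp x - z.re) ^ 2 + z.im ^ 2) : ℝ) : ℂ) := by
  simp_rw [kernel_sub_kernel_conj hz, intervalIntegral.integral_const_mul,
    intervalIntegral.integral_ofReal]

lemma kernel_sub_kernel_conj_add_pi {z : ℂ} (hz : 0 < z.im) (x : ℝ) :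
    kernel z (x + Real.pi * Complex.I) - kernel ((starRingEnd ℂ) z) (x + Real.pi * Complex.I)
      = -(2 * Complex.I
        * ((z.im * Real.exp x / ((Real.exp x - -z.re) ^ 2 + z.im ^ 2) : ℝ) : ℂ)) := by
  -- reflect in the imaginary axis: `-conj z` lies in the upper half-plane too
  have h := kernel_sub_kernel_conj (z := -(starRingEnd ℂ) z) (by simpa using hz) x
  simp only [Complex.neg_im, Complex.conj_im, neg_neg, Complex.neg_re, Complex.conj_re, map_neg,
    Complex.conj_conj] at h
  rw [← h, kernel_add_pi, kernel_add_pi]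
  simp only [kernel, sub_neg_eq_add, Complex.ofReal_exp, neg_sub]

/-- The index of the point `ζ` with respect to large rectangles. -/
lemma tendsto_rectIntegral_kernel (hζ : ζ ∈ openStrip) {a b : ℕ → ℝ}
    (ha : Tendsto a atTop atBot) (hb : Tendsto b atTop atTop) :
    Tendsto (fun n => rectIntegral (kernel (Complex.exp ζ)) (a n) (b n)) atTop
      (𝓝 (2 * Real.pi * Complex.I)) := by
  set z := Complex.exp ζ with hzdef
  have hz : 0 < z.im := exp_im_pos hζ
  have hz0 : z ≠ 0 := Complex.exp_ne_zero ζ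
  have hzc : (starRingEnd ℂ) z ≠ 0 := by simpa using hz0
  have hcont : ContinuousOn (kernel z) (closedStrip \ {ζ}) := continuousOn_kernel hζ
  have hcontc : ContinuousOn (kernel ((starRingEnd ℂ) z)) closedStrip := continuousOn_kernel_conj hζ
  have hzero : ∀ n, rectIntegral (kernel ((starRingEnd ℂ) z)) (a n) (b n) = 0 := fun n =>
    rectIntegral_eq_zero hcontc (differentiableOn_kernel_conj hζ) _ _
  -- subtracting the vanishing integral leaves the Poisson kernel, which is integrable
  set k : ℂ → ℂ := fun s => kernel z s - 1 * kernel ((starRingEnd ℂ) z) s with hk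
  have hdiff : ∀ᶠ n in atTop, rectIntegral k (a n) (b n) = rectIntegral (kernel z) (a n) (b n) := by
    filter_upwards [ha.eventually (eventually_lt_atBot ζ.re),
      hb.eventually (eventually_gt_atTop ζ.re)] with n han hbn
    rw [hk, rectIntegral_sub_const_mul hcont (hcontc.mono sdiff_subset) hζ han.ne hbn.ne' 1,
      hzero, mul_zero, sub_zero]
  refine Tendsto.congr' hdiff ?_
  have hsideA : Tendsto (fun n => ∫ y in (0 : ℝ)..Real.pi, k (a n + y * Complex.I)) atTop
      (𝓝 0) := by
    have hone : Tendsto (fun n => Real.exp (a n) *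
        ∫ y in (0 : ℝ)..Real.pi, ‖(fun _ => (1 : ℂ)) (a n + y * Complex.I)‖) atTop (𝓝 0) := by
      simpa using (Real.tendsto_exp_atBot.comp ha).mul_const Real.pi
    have h1 := tendsto_side_atBot hz0 (continuousOn_const (c := (1 : ℂ))) ha hone
    have h2 := tendsto_side_atBot hzc (continuousOn_const (c := (1 : ℂ))) ha hone
    have h3 := h1.sub h2
    rw [sub_zero] at h3
    refine h3.congr' ?_
    filter_upwards [ha.eventually (eventually_lt_atBot ζ.re)] with n han
    simp only [one_mul, hk]
    exact (intervalIntegral.integral_sub (continuousOn_side hcont han.ne).intervalIntegrable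
      (continuousOn_side (hcontc.mono sdiff_subset) han.ne).intervalIntegrable).symm
  have hsideB : Tendsto (fun n => ∫ y in (0 : ℝ)..Real.pi, k (b n + y * Complex.I)) atTop
      (𝓝 0) := by
    -- `k s = kernel z s * (z - conj z) * exp (-s) * kernel (conj z) s` decays on the right
    have h0 : Tendsto (fun n => 2 * (‖z - (starRingEnd ℂ) z‖ * Real.exp (-(b n)) * 2) * Real.pi)
        atTop (𝓝 0) := by
      have := Real.tendsto_exp_neg_atTop_nhds_zero.comp hb
      simpa using (((this.const_mul ‖z - (starRingEnd ℂ) z‖).mul_const 2).const_mul 2).mul_const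
        Real.pi
    refine squeeze_zero_norm' ?_ h0
    filter_upwards [hb.eventually (eventually_gt_atTop ζ.re),
      (Real.tendsto_exp_atTop.comp hb).eventually_ge_atTop (2 * ‖z‖)] with n hbn hn
    have hn' : 2 * ‖(starRingEnd ℂ) z‖ ≤ Real.exp (b n) := by simpa using hn
    have h2 := intervalIntegral.norm_integral_le_of_norm_le_const (a := 0) (b := Real.pi)
      (f := fun y : ℝ => k (b n + y * Complex.I))
      (C := 2 * (‖z - (starRingEnd ℂ) z‖ * Real.exp (-(b n)) * 2)) fun y hy => by
        rw [uIoc_of_le Real.pi_pos.le] at hy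
        set s : ℂ := b n + y * Complex.I with hs
        have hmem : s ∈ closedStrip := add_mul_I_mem_closedStrip _ (Ioc_subset_Icc_self hy)
        have h5 := exp_sub_exp_ne_zero hmem hζ (add_mul_I_ne hbn.ne' y)
        have h6 := exp_sub_conj_exp_ne_zero hmem hζ
        rw [← hzdef] at h5 h6
        have h7 : k s = kernel z s * ((z - (starRingEnd ℂ) z) * Complex.exp (-s)
            * kernel ((starRingEnd ℂ) z) s) := by
          simp only [hk, kernel, Complex.exp_neg]
          have := Complex.exp_ne_zero s
          field_simp
          ring
        have h8 : ‖Complex.exp (-s)‖ = Real.exp (-(b n)) := by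
          rw [Complex.norm_exp]; simp [hs]
        rw [h7, norm_mul, norm_mul, norm_mul, h8]
        gcongr
        · exact norm_kernel_le_two hn y
        · exact norm_kernel_le_two hn' y
    rwa [sub_zero, abs_of_pos Real.pi_pos] at h2
  have hX := ((tendsto_integral_poisson (X := z.re) hz ha hb).add
    (tendsto_integral_poisson (X := -z.re) hz ha hb))
  have hX' := ((Complex.continuous_ofReal.tendsto _).comp hX).const_mul (2 * Complex.I)
  have hlim := ((hX'.add (hsideB.const_mul Complex.I)).sub (hsideA.const_mul Complex.I))
  refine (hlim.congr fun n => ?_).trans_eq ?_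
  · simp only [rectIntegral, hk, one_mul, integral_bottom_sub hz, kernel_sub_kernel_conj_add_pi hz,
      intervalIntegral.integral_neg, intervalIntegral.integral_const_mul,
      intervalIntegral.integral_ofReal, Function.comp, Complex.ofReal_add]
    ring
  · rw [neg_div, Real.arctan_neg]
    push_cast
    ring_nf

/-- **Schwarz formula** in the strip. A holomorphic function `f` whose real part vanishes on the
line `Im s = 0` and equals `φ` on the line `Im s = π` is given by a Cauchy integral of `φ`, provided
that its integrals over a sequence of vertical segments decay. -/
theorem schwarz_formula {f : ℂ → ℂ} {φ : ℝ → ℝ} (hc : ContinuousOn f closedStrip)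
    (hd : DifferentiableOn ℂ f openStrip) (hbot : ∀ x : ℝ, (f x).re = 0)
    (htop : ∀ x : ℝ, (f (x + Real.pi * Complex.I)).re = φ x) {a b : ℕ → ℝ}
    (ha : Tendsto a atTop atBot) (hb : Tendsto b atTop atTop)
    (hfa : Tendsto (fun n => Real.exp (a n) *
      ∫ y in (0 : ℝ)..Real.pi, ‖f (a n + y * Complex.I)‖) atTop (𝓝 0))
    (hfb : Tendsto (fun n => ∫ y in (0 : ℝ)..Real.pi, ‖f (b n + y * Complex.I)‖) atTop (𝓝 0))
    (hζ : ζ ∈ openStrip)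
    (hint : Integrable fun x : ℝ => (φ x : ℂ) * (Real.exp x / (Real.exp x + Complex.exp ζ))) :
    f ζ = Complex.I / Real.pi *
      ∫ x : ℝ, (φ x : ℂ) * (Real.exp x / (Real.exp x + Complex.exp ζ)) := by
  set z := Complex.exp ζ with hzdef
  have hz0 : z ≠ 0 := Complex.exp_ne_zero ζ
  have hzc : (starRingEnd ℂ) z ≠ 0 := by simpa using hz0
  have hkc := continuousOn_kernel_conj hζ
  have hfk : ContinuousOn (fun s => f s * kernel z s) (closedStrip \ {ζ}) :=
    (hc.mono sdiff_subset).mul (continuousOn_kernel hζ)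
  have hzero : ∀ n, rectIntegral (fun s => f s * kernel ((starRingEnd ℂ) z) s) (a n) (b n) = 0 :=
    fun n => rectIntegral_eq_zero (hc.mul hkc) (hd.mul (differentiableOn_kernel_conj hζ)) _ _
  set A₁ := fun n => ∫ y in (0 : ℝ)..Real.pi,
    f (a n + y * Complex.I) * kernel z (a n + y * Complex.I)
  set A₂ := fun n => ∫ y in (0 : ℝ)..Real.pi,
    f (a n + y * Complex.I) * kernel ((starRingEnd ℂ) z) (a n + y * Complex.I)
  set B₁ := fun n => ∫ y in (0 : ℝ)..Real.pi,
    f (b n + y * Complex.I) * kernel z (b n + y * Complex.I)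
  set B₂ := fun n => ∫ y in (0 : ℝ)..Real.pi,
    f (b n + y * Complex.I) * kernel ((starRingEnd ℂ) z) (b n + y * Complex.I)
  have hA₁ : Tendsto A₁ atTop (𝓝 0) := tendsto_side_atBot hz0 hc ha hfa
  have hA₂ : Tendsto A₂ atTop (𝓝 0) := tendsto_side_atBot hzc hc ha hfa
  have hB₁ : Tendsto B₁ atTop (𝓝 0) := tendsto_side_atTop hc hb hfb
  have hB₂ : Tendsto B₂ atTop (𝓝 0) := tendsto_side_atTop hc hb hfb
  have hconj : ∀ (g : ℝ → ℂ) (c d : ℝ),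
      (starRingEnd ℂ) (∫ x in c..d, g x) = ∫ x in c..d, (starRingEnd ℂ) (g x) := fun g c d => by
    rw [intervalIntegral, intervalIntegral, map_sub, integral_conj, integral_conj]
  have hb2 : ∀ n, (starRingEnd ℂ) (∫ x : ℝ in a n..b n, f x * kernel ((starRingEnd ℂ) z) x)
      = -∫ x : ℝ in a n..b n, f x * kernel z x := fun n => by
    rw [hconj, ← intervalIntegral.integral_neg]
    refine intervalIntegral.integral_congr fun x _ => ?_
    have h1 : (starRingEnd ℂ) (f x) = -f x := by
      apply Complex.ext <;> simp [hbot]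
    simp only [map_mul, conj_kernel_conj, h1, neg_mul]
  have ht2 : ∀ n, (starRingEnd ℂ) (∫ x : ℝ in a n..b n, f (x + Real.pi * Complex.I)
        * kernel ((starRingEnd ℂ) z) (x + Real.pi * Complex.I))
      = 2 * (∫ x : ℝ in a n..b n, (φ x : ℂ) * (Real.exp x / (Real.exp x + z)))
        - ∫ x : ℝ in a n..b n, f (x + Real.pi * Complex.I)
          * kernel z (x + Real.pi * Complex.I) := fun n => by
    rw [hconj, ← intervalIntegral.integral_const_mul, ← intervalIntegral.integral_sub
      (hint.intervalIntegrable.const_mul 2) ((continuous_top hfk hζ).intervalIntegrable _ _)]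
    refine intervalIntegral.integral_congr fun x _ => ?_
    have h1 : (starRingEnd ℂ) (f (x + Real.pi * Complex.I))
        = 2 * (φ x : ℂ) - f (x + Real.pi * Complex.I) := by
      rw [← htop]
      apply Complex.ext
      · simp; ring
      · simp
    rw [map_mul, conj_kernel_conj_add_pi, h1, kernel_add_pi]
    ring
  have hmain : ∀ᶠ n in atTop, f ζ * rectIntegral (kernel z) (a n) (b n)
      = -(2 * (∫ x : ℝ in a n..b n, (φ x : ℂ) * (Real.exp x / (Real.exp x + z))))
        + Complex.I * B₁ n - Complex.I * A₁ n
        - Complex.I * (starRingEnd ℂ) (B₂ n) + Complex.I * (starRingEnd ℂ) (A₂ n) := by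
    filter_upwards [ha.eventually (eventually_lt_atBot ζ.re),
      hb.eventually (eventually_gt_atTop ζ.re)] with n han hbn
    have h1 := congrArg (starRingEnd ℂ) (hzero n)
    rw [rectIntegral] at h1
    simp only [map_add, map_sub, map_mul, Complex.conj_I, map_zero, hb2, ht2] at h1
    rw [← rectIntegral_mul_kernel hc hd hζ han hbn, rectIntegral]
    linear_combination -h1
  have hl := ((tendsto_rectIntegral_kernel hζ ha hb).const_mul (f ζ)).congr' hmain
  have hcc : ∀ {g : ℕ → ℂ}, Tendsto g atTop (𝓝 0) →
      Tendsto (fun n => Complex.I * (starRingEnd ℂ) (g n)) atTop (𝓝 0) := fun {g} hg => by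
    simpa using ((Complex.continuous_conj.tendsto _).comp hg).const_mul Complex.I
  have hr := (((((intervalIntegral_tendsto_integral hint ha hb).const_mul 2).neg.add
    (hB₁.const_mul Complex.I)).sub (hA₁.const_mul Complex.I)).sub (hcc hB₂)).add (hcc hA₂)
  have huniq := tendsto_nhds_unique hl hr
  have hpi : (Real.pi : ℂ) ≠ 0 := by exact_mod_cast Real.pi_ne_zero
  simp only [mul_zero, add_zero, sub_zero] at huniq
  rw [div_mul_eq_mul_div, eq_div_iff hpi]
  linear_combination (-Complex.I / 2) * huniq + (f ζ * Real.pi) * Complex.I_sq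

/-! ### Finite energy and small arcs -/

lemma polarCoord_symm_eq_exp (r θ : ℝ) :
    Complex.polarCoord.symm (r, θ) = r * Complex.exp (θ * Complex.I) := by
  rw [Complex.polarCoord_symm_apply, Complex.exp_mul_I, Complex.ofReal_cos, Complex.ofReal_sin]

lemma mul_exp_im_pos {r θ : ℝ} (hr : 0 < r) (hθ : θ ∈ Ioo 0 Real.pi) :
    0 < ((r : ℂ) * Complex.exp (θ * Complex.I)).im := by
  rw [Complex.im_ofReal_mul, Complex.exp_ofReal_mul_I_im]
  exact mul_pos hr (Real.sin_pos_of_mem_Ioo hθ)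

lemma mul_exp_mem_upperHalf {r θ : ℝ} (hr : 0 < r) (hθ : θ ∈ Icc 0 Real.pi) :
    (r : ℂ) * Complex.exp (θ * Complex.I) ∈ upperHalf := by
  refine ⟨?_, by simp [hr.ne']⟩
  rw [Complex.im_ofReal_mul, Complex.exp_ofReal_mul_I_im]
  exact mul_nonneg hr.le (Real.sin_nonneg_of_mem_Icc hθ)

/-- If `h` is square integrable on the half-plane, every dyadic annulus contains an arc on which
`r² ∫ ‖h‖² dθ` is bounded by a fixed constant. -/
lemma exists_arc {h : ℂ → ℂ} (hc : ContinuousOn h upperHalf)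
    (hi : IntegrableOn (fun z => ‖h z‖ ^ 2) {z : ℂ | 0 < z.im}) :
    ∃ C : ℝ, ∀ R : ℝ, 0 < R → ∃ r ∈ Ioo R (2 * R),
      r ^ 2 * ∫ θ in (0 : ℝ)..Real.pi, ‖h (r * Complex.exp (θ * Complex.I))‖ ^ 2 ≤ C := by
  set U : Set ℂ := {z : ℂ | 0 < z.im} with hU
  set S : Set (ℝ × ℝ) := Ioi (0 : ℝ) ×ˢ Ioo (0 : ℝ) Real.pi with hS
  set g : ℝ × ℝ → ENNReal := fun p =>
    ENNReal.ofReal p.1 * ENNReal.ofReal (‖h (p.1 * Complex.exp (p.2 * Complex.I))‖ ^ 2) with hg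
  set E : ENNReal := ∫⁻ z in U, ENNReal.ofReal (‖h z‖ ^ 2) with hE
  have hEtop : E ≠ ⊤ := by
    have := hi.2
    rw [hasFiniteIntegral_iff_ofReal (ae_of_all _ fun z => by positivity)] at this
    exact this.ne
  have hSmeas : MeasurableSet S := measurableSet_Ioi.prod measurableSet_Ioo
  have hgle : ∫⁻ p in S, g p ≤ E := by
    have h1 := Complex.lintegral_comp_polarCoord_symm
      (U.indicator fun z => ENNReal.ofReal (‖h z‖ ^ 2))
    rw [lintegral_indicator isOpen_im_pos.measurableSet] at h1
    rw [hE, ← h1]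
    refine le_trans (le_of_eq ?_) (lintegral_mono_set (s := S) ?_)
    · refine setLIntegral_congr_fun hSmeas fun p hp => ?_
      have hmem : Complex.polarCoord.symm p ∈ U := by
        obtain ⟨r, θ⟩ := p
        rw [polarCoord_symm_eq_exp]
        exact mul_exp_im_pos hp.1 hp.2
      simp only [indicator_of_mem hmem, hg, smul_eq_mul]
      obtain ⟨r, θ⟩ := p
      rw [polarCoord_symm_eq_exp]
    · rintro ⟨r, θ⟩ ⟨hr, hθ⟩
      exact ⟨hr, by linarith [hθ.1, Real.pi_pos], hθ.2⟩
  have hhc : ContinuousOn (fun p : ℝ × ℝ => h (p.1 * Complex.exp (p.2 * Complex.I))) S :=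
    hc.comp (Continuous.continuousOn (by fun_prop)) fun p hp =>
      mul_exp_mem_upperHalf hp.1 (Ioo_subset_Icc_self hp.2)
  have hgm : AEMeasurable g (volume.restrict S) :=
    (measurable_fst.ennreal_ofReal.aemeasurable).mul
      ((hhc.norm.pow 2).aemeasurable hSmeas).ennreal_ofReal
  have hvol : (volume.restrict S : Measure (ℝ × ℝ))
      = (volume.restrict (Ioi (0 : ℝ))).prod (volume.restrict (Ioo (0 : ℝ) Real.pi)) := by
    rw [hS, Measure.volume_eq_prod, Measure.prod_restrict]
  rw [hvol] at hgm hgle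
  rw [lintegral_prod _ hgm] at hgle
  have hMm := hgm.lintegral_prod_right'
  set M : ℝ → ENNReal := fun r => ∫⁻ θ in Ioo (0 : ℝ) Real.pi, g (r, θ) with hM
  refine ⟨2 * E.toReal, fun R hR => ?_⟩
  have hsub : Ioo R (2 * R) ⊆ Ioi 0 := fun r hr => hR.trans hr.1
  have hvolR : volume (Ioo R (2 * R)) = ENNReal.ofReal R := by
    rw [Real.volume_Ioo]; congr 1; ring
  obtain ⟨r, hr, hle⟩ := exists_le_setLAverage (μ := volume) (s := Ioo R (2 * R)) (f := M)
    (by rw [hvolR]; simpa using hR) (by rw [hvolR]; simp)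
    (hMm.mono_measure (Measure.restrict_mono hsub le_rfl))
  refine ⟨r, hr, ?_⟩
  have hr0 : 0 < r := hsub hr
  rw [setLAverage_eq, hvolR] at hle
  have hle2 : M r ≤ E / ENNReal.ofReal R :=
    hle.trans (by gcongr; exact (lintegral_mono_set hsub).trans hgle)
  have hcont : ContinuousOn (fun θ : ℝ => ‖h (r * Complex.exp (θ * Complex.I))‖ ^ 2)
      (Icc 0 Real.pi) :=
    (hc.comp (Continuous.continuousOn (by fun_prop)) fun θ hθ =>
      mul_exp_mem_upperHalf hr0 hθ).norm.pow 2
  have hMr : M r = ENNReal.ofReal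
      (r * ∫ θ in (0 : ℝ)..Real.pi, ‖h (r * Complex.exp (θ * Complex.I))‖ ^ 2) := by
    rw [ENNReal.ofReal_mul hr0.le, intervalIntegral.integral_of_le Real.pi_pos.le,
      integral_Ioc_eq_integral_Ioo, ofReal_integral_eq_lintegral_ofReal
        (hcont.integrableOn_Icc.mono_set Ioo_subset_Icc_self) (ae_of_all _ fun θ => by positivity),
      ← lintegral_const_mul' _ _ ENNReal.ofReal_ne_top]
  rw [hMr, ENNReal.le_div_iff_mul_le (by simp [hR]) (by simp), ← ENNReal.ofReal_mul' hR.le,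
    ENNReal.ofReal_le_iff_le_toReal hEtop] at hle2
  set J := ∫ θ in (0 : ℝ)..Real.pi, ‖h (r * Complex.exp (θ * Complex.I))‖ ^ 2 with hJ
  have hJ0 : 0 ≤ J := intervalIntegral.integral_nonneg Real.pi_pos.le fun θ _ => by positivity
  calc r ^ 2 * J = r * J * r := by ring
    _ ≤ r * J * (2 * R) := by gcongr; exact hr.2.le
    _ = 2 * (r * J * R) := by ring
    _ ≤ _ := by gcongr

/-- On the arcs of `exists_arc`, the integral of `‖√w h(w)‖` is controlled. -/
lemma integral_norm_exp_half_le {h : ℂ → ℂ} (hc : ContinuousOn h upperHalf) {r C : ℝ} (hr : 0 < r)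
    (hC : r ^ 2 * ∫ θ in (0 : ℝ)..Real.pi, ‖h (r * Complex.exp (θ * Complex.I))‖ ^ 2 ≤ C) :
    ∫ y in (0 : ℝ)..Real.pi, ‖Complex.exp ((Real.log r + y * Complex.I) / 2)
      * h (Complex.exp (Real.log r + y * Complex.I))‖
      ≤ Real.exp (-(Real.log r) / 2) * ((Real.pi + C) / 2) := by
  have hexp : ∀ y : ℝ, Complex.exp (Real.log r + y * Complex.I) = r * Complex.exp (y * Complex.I) :=
    fun y => by rw [Complex.exp_add, ← Complex.ofReal_exp, Real.exp_log hr]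
  have hcont : ContinuousOn (fun θ : ℝ => h (r * Complex.exp (θ * Complex.I)))
      (uIcc 0 Real.pi) := by
    rw [uIcc_of_le Real.pi_pos.le]
    exact hc.comp (Continuous.continuousOn (by fun_prop)) fun θ hθ => mul_exp_mem_upperHalf hr hθ
  have hnorm : ∀ y : ℝ, ‖Complex.exp ((Real.log r + y * Complex.I) / 2)‖
      = Real.exp (-(Real.log r) / 2) * r := fun y => by
    have h1 : ((Real.log r + y * Complex.I : ℂ) / 2).re = -(Real.log r) / 2 + Real.log r := by
      simp; ring
    rw [Complex.norm_exp, h1, Real.exp_add, Real.exp_log hr]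
  have hint1 : IntervalIntegrable (fun θ : ℝ => ‖h (r * Complex.exp (θ * Complex.I))‖ ^ 2) volume
      0 Real.pi := (hcont.norm.pow 2).intervalIntegrable
  have hle : ∫ y in (0 : ℝ)..Real.pi, ‖Complex.exp ((Real.log r + y * Complex.I) / 2)
      * h (Complex.exp (Real.log r + y * Complex.I))‖
      ≤ ∫ y in (0 : ℝ)..Real.pi, Real.exp (-(Real.log r) / 2)
        * ((1 + r ^ 2 * ‖h (r * Complex.exp (y * Complex.I))‖ ^ 2) / 2) := by
    refine intervalIntegral.integral_mono_on Real.pi_pos.le ?_ ?_ fun y _ => ?_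
    · simp only [norm_mul, hnorm, hexp]
      exact (hcont.norm.const_smul (Real.exp (-(Real.log r) / 2) * r)).intervalIntegrable
    · exact (((intervalIntegrable_const (c := (1 : ℝ))).add
        (hint1.const_mul (r ^ 2))).div_const 2).const_mul _
    · rw [norm_mul, hnorm, hexp, mul_assoc]
      gcongr
      nlinarith [sq_nonneg (r * ‖h (r * Complex.exp (y * Complex.I))‖ - 1)]
  refine hle.trans ?_
  rw [intervalIntegral.integral_const_mul, intervalIntegral.integral_div,
    intervalIntegral.integral_add intervalIntegrable_const (hint1.const_mul (r ^ 2)),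
    intervalIntegral.integral_const_mul, intervalIntegral.integral_const]
  gcongr
  simp

/-- Finite energy makes the vertical segments in `schwarz_formula` negligible along suitable
sequences. -/
lemma exists_seq_arcs {h : ℂ → ℂ} (hc : ContinuousOn h upperHalf)
    (hi : IntegrableOn (fun z => ‖h z‖ ^ 2) {z : ℂ | 0 < z.im}) :
    ∃ a b : ℕ → ℝ, Tendsto a atTop atBot ∧ Tendsto b atTop atTop ∧
      Tendsto (fun n => Real.exp (a n) * ∫ y in (0 : ℝ)..Real.pi,
        ‖Complex.exp ((a n + y * Complex.I) / 2) * h (Complex.exp (a n + y * Complex.I))‖)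
        atTop (𝓝 0) ∧
      Tendsto (fun n => ∫ y in (0 : ℝ)..Real.pi,
        ‖Complex.exp ((b n + y * Complex.I) / 2) * h (Complex.exp (b n + y * Complex.I))‖)
        atTop (𝓝 0) := by
  obtain ⟨C, hC⟩ := exists_arc hc hi
  choose! ρ hρ hρC using hC
  have key : ∀ t : ℝ, t < Real.log (ρ (Real.exp t)) ∧
      Real.log (ρ (Real.exp t)) < Real.log 2 + t := fun t => by
    have h1 := hρ _ (Real.exp_pos t)
    have h0 := (Real.exp_pos t).trans h1.1
    refine ⟨(Real.lt_log_iff_exp_lt h0).2 h1.1, ?_⟩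
    rw [Real.log_lt_iff_lt_exp h0, Real.exp_add, Real.exp_log two_pos]
    exact h1.2
  have hnat : Tendsto (fun n : ℕ => (n : ℝ)) atTop atTop := tendsto_natCast_atTop_atTop
  have hbt : Tendsto (fun n : ℕ => Real.log (ρ (Real.exp n))) atTop atTop :=
    tendsto_atTop_mono (fun n => (key n).1.le) hnat
  have hat : Tendsto (fun n : ℕ => Real.log (ρ (Real.exp (-n)))) atTop atBot :=
    tendsto_atBot_mono (fun n => (key (-n)).2.le)
      (tendsto_atBot_add_const_left _ _ (tendsto_neg_atTop_atBot.comp hnat))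
  have hpos : ∀ t : ℝ, 0 < ρ (Real.exp t) := fun t =>
    (Real.exp_pos t).trans (hρ _ (Real.exp_pos t)).1
  have hbound := fun t : ℝ => integral_norm_exp_half_le hc (hpos t) (hρC _ (Real.exp_pos t))
  have hnn : ∀ x : ℝ, 0 ≤ ∫ y in (0 : ℝ)..Real.pi,
      ‖Complex.exp ((x + y * Complex.I) / 2) * h (Complex.exp (x + y * Complex.I))‖ := fun x =>
    intervalIntegral.integral_nonneg Real.pi_pos.le fun y _ => norm_nonneg _
  refine ⟨_, _, hat, hbt, ?_, ?_⟩
  · refine squeeze_zero (fun n => mul_nonneg (Real.exp_pos _).le (hnn _)) (fun n =>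
      mul_le_mul_of_nonneg_left (hbound (-n)) (Real.exp_pos _).le) ?_
    have h1 := (Real.tendsto_exp_atBot.comp (hat.atBot_div_const two_pos)).mul_const
      ((Real.pi + C) / 2)
    rw [zero_mul] at h1
    refine h1.congr fun n => ?_
    rw [Function.comp, ← mul_assoc, ← Real.exp_add]
    congr 2
    ring
  · refine squeeze_zero (fun n => hnn _) (fun n => hbound n) ?_
    have h1 := (Real.tendsto_exp_atBot.comp ((tendsto_neg_atTop_atBot.comp hbt).atBot_div_const
      two_pos)).mul_const ((Real.pi + C) / 2)
    rw [zero_mul] at h1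
    exact h1

/-! ### The mixed problem near the tip -/

/-- A solution of the mixed problem in the upper half-plane: `w` vanishes on the positive real axis,
`∂w/∂x₂ = g` on the negative one, and the Dirichlet integral of `w` is finite. -/
structure IsMixedSolution (g : ℝ → ℝ) (w : ℂ → ℝ) (h : ℂ → ℂ) : Prop
    extends IsComplexGradient w h where
  dirichlet : ∀ x : ℝ, 0 < x → w x = 0
  neumann : ∀ x : ℝ, x < 0 → (h x).im = -g x
  energy : IntegrableOn (fun z => ‖h z‖ ^ 2) {z : ℂ | 0 < z.im}

lemma norm_rpow_le_of_nonpos {δ t : ℝ} (hδ : 0 < δ) (ht : δ ≤ t) {p : ℝ} (hp : p ≤ 0) :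
    ‖t ^ p‖ ≤ δ ^ p := by
  rw [Real.norm_of_nonneg (Real.rpow_nonneg (hδ.le.trans ht) _)]
  exact Real.rpow_le_rpow_of_nonpos hδ ht hp

/-- A load that vanishes near the tip stays integrable when multiplied by a negative power of the
distance to the tip. -/
lemma integrableOn_mul_rpow {g : ℝ → ℝ} (hg : IntegrableOn g (Iio 0)) {δ : ℝ} (hδ : 0 < δ)
    (h0 : ∀ x ∈ Ioo (-δ) 0, g x = 0) {p : ℝ} (hp : p ≤ 0) :
    IntegrableOn (fun t => g t * (-t) ^ p) (Iio 0) := by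
  have hm : Measurable fun t : ℝ => (-t) ^ p := measurable_neg.pow_const p
  refine (hg.norm.const_mul (δ ^ p)).mono' (hg.aestronglyMeasurable.mul hm.aestronglyMeasurable) ?_
  filter_upwards [ae_restrict_mem measurableSet_Iio] with t ht
  rcases lt_or_ge (-δ) t with h | h
  · simp [h0 t ⟨h, ht⟩]
  · rw [norm_mul, mul_comm]
    gcongr
    exact norm_rpow_le_of_nonpos hδ (by linarith) hp

lemma image_neg_exp : (fun x : ℝ => -Real.exp x) '' univ = Iio 0 := by
  ext t
  simp only [image_univ, mem_range, mem_Iio]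
  constructor
  · rintro ⟨x, rfl⟩
    linarith [Real.exp_pos x]
  · intro ht
    exact ⟨Real.log (-t), by rw [Real.exp_log (by linarith)]; ring⟩

lemma hasDerivWithinAt_neg_exp (x : ℝ) (_ : x ∈ (univ : Set ℝ)) :
    HasDerivWithinAt (fun x : ℝ => -Real.exp x) (-Real.exp x) univ x :=
  (Real.hasDerivAt_exp x).neg.hasDerivWithinAt

lemma injOn_neg_exp : InjOn (fun x : ℝ => -Real.exp x) univ := fun _ _ _ _ h =>
  Real.exp_injective (neg_injective h)

lemma exp_mul_exp_rpow (x p : ℝ) : Real.exp x * Real.exp x ^ p = Real.exp ((1 + p) * x) := by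
  rw [← Real.exp_mul, ← Real.exp_add]; ring_nf

lemma integrableOn_Iio_iff_exp (g : ℝ → ℝ) (p : ℝ) :
    IntegrableOn (fun t => g t * (-t) ^ p) (Iio 0)
      ↔ Integrable fun x : ℝ => Real.exp ((1 + p) * x) * g (-Real.exp x) := by
  rw [← image_neg_exp, integrableOn_image_iff_integrableOn_abs_deriv_smul MeasurableSet.univ
    hasDerivWithinAt_neg_exp injOn_neg_exp, integrableOn_univ]
  refine integrable_congr (ae_of_all _ fun x => ?_)
  simp only [abs_neg, Real.abs_exp, smul_eq_mul, neg_neg, ← exp_mul_exp_rpow]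
  ring

lemma integral_Iio_eq_exp (g : ℝ → ℝ) (p : ℝ) :
    ∫ t in Iio (0 : ℝ), g t * (-t) ^ p
      = ∫ x : ℝ, Real.exp ((1 + p) * x) * g (-Real.exp x) := by
  rw [← image_neg_exp, integral_image_eq_integral_abs_deriv_smul MeasurableSet.univ
    hasDerivWithinAt_neg_exp injOn_neg_exp, setIntegral_univ]
  refine integral_congr_ae (ae_of_all _ fun x => ?_)
  simp only [abs_neg, Real.abs_exp, smul_eq_mul, neg_neg, ← exp_mul_exp_rpow]
  ring

namespace IsMixedSolution

variable {g : ℝ → ℝ} {w : ℂ → ℝ} {h : ℂ → ℂ}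

/-- The tangential derivative vanishes where `w` does. -/
lemma re_eq_zero (H : IsMixedSolution g w h) {x : ℝ} (hx : 0 < x) : (h x).re = 0 := by
  have h1 := H.hasDerivWithinAt_comp (γ := fun t : ℝ => (t : ℂ)) (s := Ioi 0)
    (Complex.ofRealCLM.hasDerivAt (x := x)).hasDerivWithinAt (ofReal_mem_upperHalf hx.ne')
    fun t ht => ofReal_mem_upperHalf (ne_of_gt ht)
  have h2 := (h1.congr (f₁ := fun _ => 0) (fun t ht => (H.dirichlet t ht).symm)
    (H.dirichlet x hx).symm).hasDerivAt (Ioi_mem_nhds hx)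
  simpa using h2.unique (hasDerivAt_const x (0 : ℝ))

/-- The function `√z h(z)` in the coordinate `z = exp s`. -/
noncomputable def stripFunction (h : ℂ → ℂ) (s : ℂ) : ℂ := Complex.exp (s / 2) * h (Complex.exp s)

lemma stripFunction_continuousOn (H : IsMixedSolution g w h) :
    ContinuousOn (stripFunction h) closedStrip :=
  (Continuous.continuousOn (by fun_prop)).mul
    (H.continuousOn.comp Complex.continuous_exp.continuousOn fun _ hs => exp_mem_upperHalf hs)

lemma stripFunction_differentiableOn (H : IsMixedSolution g w h) :
    DifferentiableOn ℂ (stripFunction h) openStrip :=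
  (Differentiable.differentiableOn (by fun_prop)).mul
    (H.differentiableOn.comp Complex.differentiable_exp.differentiableOn fun _ hs => exp_im_pos hs)

lemma stripFunction_ofReal (h : ℂ → ℂ) (x : ℝ) :
    stripFunction h x = (Real.exp (x / 2) : ℂ) * h (Real.exp x : ℝ) := by
  simp [stripFunction]

lemma stripFunction_add_pi (h : ℂ → ℂ) (x : ℝ) : stripFunction h (x + Real.pi * Complex.I)
    = Complex.I * ((Real.exp (x / 2) : ℂ) * h ((-Real.exp x : ℝ) : ℂ)) := by
  have h1 : ((x : ℂ) + Real.pi * Complex.I) / 2 = ((x / 2 : ℝ) : ℂ) + Real.pi / 2 * Complex.I := by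
    push_cast; ring
  rw [stripFunction, exp_add_pi, h1, Complex.exp_add, Complex.exp_pi_div_two_mul_I,
    ← Complex.ofReal_exp, Complex.ofReal_neg]
  ring

/-- The expansion of `√z h(z)` to second order at the tip; its coefficients are the moments of `g`
with weights `(-t)^{-1/2}` and `(-t)^{-3/2}`. -/
lemma exists_expansion (H : IsMixedSolution g w h) (hg : IntegrableOn g (Iio 0)) {δ : ℝ}
    (hδ : 0 < δ) (h0 : ∀ x ∈ Ioo (-δ) 0, g x = 0) : ∃ C, ∀ s ∈ closedStrip,
      Real.exp s.re < δ / 2 → ‖stripFunction h s - Complex.I / Real.pi *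
        (((∫ t in Iio (0 : ℝ), g t * (-t) ^ (-1 / 2 : ℝ) : ℝ) : ℂ)
          - Complex.exp s * (∫ t in Iio (0 : ℝ), g t * (-t) ^ (-3 / 2 : ℝ) : ℝ))‖
        ≤ C * Real.exp s.re ^ 2 := by
  set φ : ℝ → ℝ := fun x => Real.exp (x / 2) * g (-Real.exp x) with hφ
  have hφe : (fun x : ℝ => Real.exp ((1 + -1 / 2) * x) * g (-Real.exp x)) = fun x => φ x := by
    funext x
    simp only [hφ]
    congr 2
    ring
  have hφe2 : (fun x : ℝ => Real.exp ((1 + -3 / 2) * x) * g (-Real.exp x))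
      = fun x => φ x * Real.exp (-x) := by
    funext x
    simp only [hφ]
    rw [mul_right_comm, ← Real.exp_add]
    congr 2
    ring
  have hφi : Integrable φ := by
    have := (integrableOn_Iio_iff_exp g (-1 / 2)).1
      (integrableOn_mul_rpow hg hδ h0 (by norm_num))
    rwa [hφe] at this
  have hφi2 : Integrable fun x => φ x * Real.exp (-x) := by
    have := (integrableOn_Iio_iff_exp g (-3 / 2)).1
      (integrableOn_mul_rpow hg hδ h0 (by norm_num))
    rwa [hφe2] at this
  rw [integral_Iio_eq_exp, integral_Iio_eq_exp, hφe, hφe2]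
  have hφ0 : ∀ x, Real.exp x < δ → φ x = 0 := fun x hx => by
    have : g (-Real.exp x) = 0 := h0 _ ⟨by linarith, by linarith [Real.exp_pos x]⟩
    simp [hφ, this]
  obtain ⟨a, b, ha, hb, hfa, hfb⟩ := exists_seq_arcs H.continuousOn H.energy
  -- geometric series of the kernel, on the support of `φ`
  have hden : ∀ s : ℂ, Real.exp s.re < δ / 2 → ∀ x : ℝ, δ ≤ Real.exp x →
      Real.exp x / 2 ≤ ‖(Real.exp x : ℂ) + Complex.exp s‖ := fun s hs x hx => by
    have h1 := norm_sub_norm_le (Real.exp x : ℂ) (-Complex.exp s)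
    rw [sub_neg_eq_add, norm_neg, Complex.norm_exp,
      Complex.norm_of_nonneg (Real.exp_pos x).le] at h1
    linarith
  have hopen : ∀ s ∈ openStrip, Real.exp s.re < δ / 2 → ‖stripFunction h s - Complex.I / Real.pi *
        (((∫ x, φ x : ℝ) : ℂ) - Complex.exp s * (∫ x, φ x * Real.exp (-x) : ℝ))‖
        ≤ 1 / Real.pi * (2 / δ ^ 2 * ∫ x, ‖φ x‖) * Real.exp s.re ^ 2 := by
    intro s hs hsδ
    have hfin : Integrable fun x : ℝ =>
        (φ x : ℂ) * (Real.exp x / (Real.exp x + Complex.exp s)) := by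
      refine (hφi.norm.mul_const 2).mono' ?_ (ae_of_all _ fun x => ?_)
      · refine hφi.ofReal.aestronglyMeasurable.mul (Measurable.aestronglyMeasurable ?_)
        fun_prop
      · rcases lt_or_ge (Real.exp x) δ with hx | hx
        · simp [hφ0 x hx]
        · have h1 := hden s hsδ x hx
          have h2 := Real.exp_pos x
          rw [norm_mul, norm_div, Complex.norm_real, Complex.norm_of_nonneg h2.le]
          gcongr
          rw [div_le_iff₀ (by linarith)]
          linarith
    have hrep := schwarz_formula (φ := φ) H.stripFunction_continuousOn
      H.stripFunction_differentiableOn (fun x => by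
        rw [stripFunction_ofReal, Complex.re_ofReal_mul, H.re_eq_zero (Real.exp_pos x), mul_zero])
      (fun x => by
        rw [stripFunction_add_pi, Complex.I_mul_re, Complex.im_ofReal_mul,
          H.neumann _ (neg_lt_zero.2 (Real.exp_pos x))]
        simp [hφ]) ha hb hfa hfb hs hfin
    have hφc : Integrable fun x => (φ x : ℂ) := hφi.ofReal
    have hi3 : Integrable fun x : ℝ => Complex.exp s * ((φ x * Real.exp (-x) : ℝ) : ℂ) :=
      hφi2.ofReal.const_mul _
    have hi4 : Integrable fun x : ℝ => (φ x : ℂ)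
        - Complex.exp s * ((φ x * Real.exp (-x) : ℝ) : ℂ) := hφc.sub hi3
    rw [hrep, ← mul_sub, ← integral_complex_ofReal, ← integral_complex_ofReal, ← integral_const_mul,
      ← integral_sub hφc hi3, ← integral_sub hfin hi4, norm_mul, mul_assoc]
    have hpi : ‖Complex.I / (Real.pi : ℂ)‖ = 1 / Real.pi := by
      rw [norm_div, Complex.norm_I, Complex.norm_of_nonneg Real.pi_pos.le]
    rw [hpi]
    gcongr
    rw [← integral_const_mul, ← integral_mul_const]
    refine norm_integral_le_of_norm_le ((hφi.norm.const_mul _).mul_const _)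
      (ae_of_all _ fun x => ?_)
    rcases lt_or_ge (Real.exp x) δ with hx | hx
    · simp [hφ0 x hx]
    · have h1 := hden s hsδ x hx
      have h2 := Real.exp_pos x
      have hne : (Real.exp x : ℂ) ≠ 0 := by exact_mod_cast h2.ne'
      have hne2 : (Real.exp x : ℂ) + Complex.exp s ≠ 0 := norm_pos_iff.1 (by linarith)
      have h3 : (φ x : ℂ) * (Real.exp x / (Real.exp x + Complex.exp s))
          - ((φ x : ℂ) - Complex.exp s * ((φ x * Real.exp (-x) : ℝ) : ℂ))
          = φ x * (Complex.exp s ^ 2 / (Real.exp x * (Real.exp x + Complex.exp s))) := by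
        rw [Real.exp_neg]
        push_cast
        rw [Complex.ofReal_exp] at hne hne2
        field_simp
        ring
      calc _ = _ := congrArg norm h3
        _ = ‖φ x‖ * (Real.exp s.re ^ 2
            / (Real.exp x * ‖(Real.exp x : ℂ) + Complex.exp s‖)) := by
          rw [norm_mul, norm_div, norm_mul, norm_pow, Complex.norm_real, Complex.norm_exp,
            Complex.norm_of_nonneg h2.le]
        _ ≤ ‖φ x‖ * (Real.exp s.re ^ 2 / (δ * (δ / 2))) := by
          gcongr
          linarith
        _ = _ := by
          field_simp
  refine ⟨1 / Real.pi * (2 / δ ^ 2 * ∫ x, ‖φ x‖), fun s hs hsδ => ?_⟩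
  -- the estimate extends to the boundary lines by continuity
  set T : Set ℂ := openStrip ∩ {s | Real.exp s.re < δ / 2} with hT
  have hcl : s ∈ closure T :=
    (isOpen_lt (by fun_prop) continuous_const).closure_inter ⟨closedStrip_subset_closure hs, hsδ⟩
  have hTc : T ⊆ closedStrip := fun x hx => openStrip_subset_closedStrip hx.1
  have hcs := (H.stripFunction_continuousOn s hs).mono hTc
  have hne : (𝓝[T] s).NeBot := mem_closure_iff_nhdsWithin_neBot.1 hcl
  have hl : ContinuousWithinAt (fun s : ℂ => stripFunction h s - Complex.I / Real.pi *
      (((∫ x, φ x : ℝ) : ℂ) - Complex.exp s * (∫ x, φ x * Real.exp (-x) : ℝ))) T s :=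
    hcs.sub (Continuous.continuousWithinAt (by fun_prop))
  have hr : ContinuousWithinAt (fun s : ℂ => 1 / Real.pi * (2 / δ ^ 2 * ∫ x, ‖φ x‖)
      * Real.exp s.re ^ 2) T s := Continuous.continuousWithinAt (by fun_prop)
  exact le_of_tendsto_of_tendsto hl.norm hr
    (eventually_nhdsWithin_of_forall fun x hx => hopen x hx.1 hx.2)

lemma exp_half_log {x : ℝ} (hx : 0 < x) : Real.exp (Real.log x / 2) = √x := by
  rw [Real.sqrt_eq_rpow, Real.rpow_def_of_pos hx]; ring_nf

/-- Near the tip, `|h(z)| ≤ C |z|^{-1/2}` up to the boundary. -/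
lemma exists_norm_le (H : IsMixedSolution g w h) (hg : IntegrableOn g (Iio 0)) {δ : ℝ}
    (hδ : 0 < δ) (h0 : ∀ x ∈ Ioo (-δ) 0, g x = 0) : ∃ C, ∀ y ∈ Ioo 0 (δ / 2),
      ∀ θ ∈ Icc 0 Real.pi, √y * ‖h (y * Complex.exp (θ * Complex.I))‖ ≤ C := by
  obtain ⟨C, hC⟩ := H.exists_expansion hg hδ h0
  set m₁ := ∫ t in Iio (0 : ℝ), g t * (-t) ^ (-1 / 2 : ℝ)
  set m₂ := ∫ t in Iio (0 : ℝ), g t * (-t) ^ (-3 / 2 : ℝ)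
  refine ⟨|C| * (δ / 2) ^ 2 + 1 / Real.pi * (|m₁| + δ / 2 * |m₂|), fun y hy θ hθ => ?_⟩
  set s : ℂ := Real.log y + θ * Complex.I with hs
  have hre : Real.exp s.re = y := by simp [hs, Real.exp_log hy.1]
  have hexp : Complex.exp s = y * Complex.exp (θ * Complex.I) := by
    rw [hs, Complex.exp_add, ← Complex.ofReal_exp, Real.exp_log hy.1]
  have h1 := hC s (add_mul_I_mem_closedStrip _ hθ) (by rw [hre]; exact hy.2)
  have h2 : ‖stripFunction h s‖ = √y * ‖h (y * Complex.exp (θ * Complex.I))‖ := by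
    rw [stripFunction, norm_mul, hexp, Complex.norm_exp, ← exp_half_log hy.1]
    simp [hs]
  have h3 : ‖Complex.I / Real.pi * ((m₁ : ℂ) - Complex.exp s * m₂)‖
      ≤ 1 / Real.pi * (|m₁| + δ / 2 * |m₂|) := by
    rw [norm_mul, norm_div, Complex.norm_I, Complex.norm_of_nonneg Real.pi_pos.le]
    gcongr
    refine (norm_sub_le _ _).trans ?_
    rw [norm_mul, Complex.norm_exp, hre, Complex.norm_real, Complex.norm_real, Real.norm_eq_abs,
      Real.norm_eq_abs]
    gcongr
    exact hy.2.le
  have h4 : C * Real.exp s.re ^ 2 ≤ |C| * (δ / 2) ^ 2 := by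
    rw [hre]
    have := hy.1
    gcongr
    · exact le_abs_self C
    · exact hy.2.le
  rw [← h2]
  have h5 := norm_sub_norm_le (stripFunction h s)
    (Complex.I / Real.pi * ((m₁ : ℂ) - Complex.exp s * m₂))
  linarith

/-- The solution is continuous at the tip along the negative real axis. -/
lemma tendsto_zero (H : IsMixedSolution g w h) (hg : IntegrableOn g (Iio 0)) {δ : ℝ}
    (hδ : 0 < δ) (h0 : ∀ x ∈ Ioo (-δ) 0, g x = 0) :
    Tendsto (fun y : ℝ => w ((-y : ℝ) : ℂ)) (𝓝[>] 0) (𝓝 0) := by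
  obtain ⟨C, hC⟩ := H.exists_norm_le hg hδ h0
  have hlim : Tendsto (fun y : ℝ => √y * C * Real.pi) (𝓝[>] 0) (𝓝 0) := by
    have : Continuous fun y : ℝ => √y * C * Real.pi := by fun_prop
    simpa using (this.tendsto 0).mono_left nhdsWithin_le_nhds
  refine squeeze_zero_norm' ?_ hlim
  filter_upwards [Ioo_mem_nhdsGT (half_pos hδ)] with y hy
  have hmem : ∀ θ ∈ Icc 0 Real.pi, (y : ℂ) * Complex.exp (θ * Complex.I) ∈ upperHalf :=
    fun θ hθ => mul_exp_mem_upperHalf hy.1 hθ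
  -- integrate along the half circle from `y`, where `w` vanishes, to `-y`
  have hderiv : ∀ θ ∈ Icc 0 Real.pi, HasDerivWithinAt
      (fun θ : ℝ => w (y * Complex.exp (θ * Complex.I)))
      ((h (y * Complex.exp (θ * Complex.I)) * (y * (Complex.exp (θ * Complex.I) * Complex.I))).re)
      (Icc 0 Real.pi) θ := fun θ hθ => by
    refine H.hasDerivWithinAt_comp (γ := fun θ : ℝ => (y : ℂ) * Complex.exp (θ * Complex.I)) ?_
      (hmem θ hθ) hmem
    have h1 : HasDerivAt (fun θ : ℝ => (θ : ℂ) * Complex.I) Complex.I θ := by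
      simpa using (Complex.ofRealCLM.hasDerivAt (x := θ)).mul_const Complex.I
    exact (h1.cexp.const_mul (y : ℂ)).hasDerivWithinAt
  have hbound : ∀ θ ∈ Icc 0 Real.pi, ‖(h (y * Complex.exp (θ * Complex.I))
      * (y * (Complex.exp (θ * Complex.I) * Complex.I))).re‖ ≤ √y * C := fun θ hθ => by
    refine (Complex.abs_re_le_norm _).trans ?_
    rw [norm_mul, norm_mul, norm_mul, Complex.norm_exp_ofReal_mul_I, Complex.norm_I,
      Complex.norm_of_nonneg hy.1.le, mul_one, mul_one]
    have h1 := hC y hy θ hθ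
    calc _ = √y * (√y * ‖h (y * Complex.exp (θ * Complex.I))‖) := by
          rw [← mul_assoc, Real.mul_self_sqrt hy.1.le, mul_comm]
      _ ≤ _ := by gcongr
  have hmv := (convex_Icc (0 : ℝ) Real.pi).norm_image_sub_le_of_norm_hasDerivWithin_le hderiv hbound
    (left_mem_Icc.2 Real.pi_pos.le) (right_mem_Icc.2 Real.pi_pos.le)
  have hw0 := H.dirichlet y hy.1
  simpa [Complex.exp_pi_mul_I, hw0, abs_of_pos Real.pi_pos] using hmv

lemma sq_div_sqrt {y : ℝ} (hy : 0 < y) : y ^ 2 / √y = y ^ (3 / 2 : ℝ) := by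
  rw [Real.sqrt_eq_rpow, ← Real.rpow_natCast, ← Real.rpow_sub hy]; norm_num

/-- The normal derivative ahead of the tip. -/
lemma im_isBigO (H : IsMixedSolution g w h) (hg : IntegrableOn g (Iio 0)) {δ : ℝ}
    (hδ : 0 < δ) (h0 : ∀ x ∈ Ioo (-δ) 0, g x = 0) : (fun x : ℝ => (h x).im
      - ((∫ t in Iio (0 : ℝ), g t * (-t) ^ (-1 / 2 : ℝ))
        - x * ∫ t in Iio (0 : ℝ), g t * (-t) ^ (-3 / 2 : ℝ)) / (Real.pi * √x))
      =O[𝓝[>] 0] fun x : ℝ => x ^ (3 / 2 : ℝ) := by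
  obtain ⟨C, hC⟩ := H.exists_expansion hg hδ h0
  set m₁ := ∫ t in Iio (0 : ℝ), g t * (-t) ^ (-1 / 2 : ℝ)
  set m₂ := ∫ t in Iio (0 : ℝ), g t * (-t) ^ (-3 / 2 : ℝ)
  refine Asymptotics.IsBigO.of_bound C ?_
  filter_upwards [Ioo_mem_nhdsGT (half_pos hδ)] with x hx
  have h1 := hC (Real.log x : ℝ) (ofReal_mem_closedStrip _)
    (by simpa [Real.exp_log hx.1] using hx.2)
  rw [stripFunction_ofReal, exp_half_log hx.1, Real.exp_log hx.1, ← Complex.ofReal_exp,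
    Real.exp_log hx.1, Complex.ofReal_re, Real.exp_log hx.1] at h1
  have h2 := (Complex.abs_im_le_norm _).trans h1
  have h3 : ((√x : ℂ) * h x - Complex.I / Real.pi * ((m₁ : ℂ) - x * m₂)).im
      = √x * (h x).im - (m₁ - x * m₂) / Real.pi := by
    have : Complex.I / (Real.pi : ℂ) * ((m₁ : ℂ) - x * m₂)
        = Complex.I * (((m₁ - x * m₂) / Real.pi : ℝ) : ℂ) := by push_cast; ring
    rw [this, Complex.sub_im, Complex.im_ofReal_mul, Complex.I_mul_im, Complex.ofReal_re]
  have hs := Real.sqrt_pos.2 hx.1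
  rw [h3] at h2
  have h4 : (h x).im - (m₁ - x * m₂) / (Real.pi * √x)
      = (√x * (h x).im - (m₁ - x * m₂) / Real.pi) / √x := by
    field_simp
  rw [h4, Real.norm_eq_abs, abs_div, abs_of_pos hs, Real.norm_of_nonneg
    (Real.rpow_nonneg hx.1.le _), ← sq_div_sqrt hx.1, ← mul_div_assoc]
  gcongr

/-- The solution on the Neumann side of the tip, by integration of the tangential derivative from
the tip. -/
lemma isBigO_neg (H : IsMixedSolution g w h) (hg : IntegrableOn g (Iio 0)) {δ : ℝ}
    (hδ : 0 < δ) (h0 : ∀ x ∈ Ioo (-δ) 0, g x = 0) : (fun y : ℝ => w ((-y : ℝ) : ℂ)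
      + 2 / Real.pi * ((∫ t in Iio (0 : ℝ), g t * (-t) ^ (-1 / 2 : ℝ)) * y ^ (1 / 2 : ℝ)
        + (∫ t in Iio (0 : ℝ), g t * (-t) ^ (-3 / 2 : ℝ)) / 3 * y ^ (3 / 2 : ℝ)))
      =O[𝓝[>] 0] fun y : ℝ => y ^ (5 / 2 : ℝ) := by
  obtain ⟨C, hC⟩ := H.exists_expansion hg hδ h0
  set m₁ := ∫ t in Iio (0 : ℝ), g t * (-t) ^ (-1 / 2 : ℝ)
  set m₂ := ∫ t in Iio (0 : ℝ), g t * (-t) ^ (-3 / 2 : ℝ)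
  set e : ℝ → ℝ := fun y => w ((-y : ℝ) : ℂ)
    + 2 / Real.pi * (m₁ * y ^ (1 / 2 : ℝ) + m₂ / 3 * y ^ (3 / 2 : ℝ)) with he
  have hre : ∀ y ∈ Ioo 0 (δ / 2),
      |(h ((-y : ℝ) : ℂ)).re - (m₁ + y * m₂) / (Real.pi * √y)| ≤ C * y ^ (3 / 2 : ℝ) := by
    intro y hy
    have h1 := hC (Real.log y + Real.pi * Complex.I) (add_pi_mem_closedStrip _)
      (by simpa [Real.exp_log hy.1] using hy.2)
    rw [stripFunction_add_pi, exp_half_log hy.1, Real.exp_log hy.1, exp_add_pi,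
      Real.exp_log hy.1] at h1
    have h2 := (Complex.abs_im_le_norm _).trans h1
    have h3 : (Complex.I * ((√y : ℂ) * h ((-y : ℝ) : ℂ))
        - Complex.I / Real.pi * ((m₁ : ℂ) - -(y : ℂ) * m₂)).im
        = √y * (h ((-y : ℝ) : ℂ)).re - (m₁ + y * m₂) / Real.pi := by
      have : Complex.I / (Real.pi : ℂ) * ((m₁ : ℂ) - -(y : ℂ) * m₂)
          = Complex.I * (((m₁ + y * m₂) / Real.pi : ℝ) : ℂ) := by push_cast; ring
      rw [this, Complex.sub_im, Complex.I_mul_im, Complex.re_ofReal_mul, Complex.I_mul_im,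
        Complex.ofReal_re]
    have hs := Real.sqrt_pos.2 hy.1
    rw [h3] at h2
    have h4 : (h ((-y : ℝ) : ℂ)).re - (m₁ + y * m₂) / (Real.pi * √y)
        = (√y * (h ((-y : ℝ) : ℂ)).re - (m₁ + y * m₂) / Real.pi) / √y := by
      field_simp
    rw [h4, abs_div, abs_of_pos hs, ← sq_div_sqrt hy.1, ← mul_div_assoc]
    gcongr
    simpa [Real.exp_log hy.1] using h2
  have hderiv : ∀ y ∈ Ioo 0 (δ / 2), HasDerivAt e
      (-((h ((-y : ℝ) : ℂ)).re - (m₁ + y * m₂) / (Real.pi * √y))) y := by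
    intro y hy
    have hγ : HasDerivAt (fun t : ℝ => ((-t : ℝ) : ℂ)) (-1) y := by
      simpa using (hasDerivAt_neg y).ofReal_comp
    have h1 := (H.hasDerivWithinAt_comp hγ.hasDerivWithinAt
      (ofReal_mem_upperHalf (neg_ne_zero.2 hy.1.ne')) (s := Ioi 0) fun t ht =>
        ofReal_mem_upperHalf (neg_ne_zero.2 (ne_of_gt ht))).hasDerivAt (Ioi_mem_nhds hy.1)
    have h2 := Real.hasDerivAt_rpow_const (p := 1 / 2) (Or.inl hy.1.ne')
    have h3 := Real.hasDerivAt_rpow_const (p := 3 / 2) (Or.inl hy.1.ne')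
    have h4 := h1.add (((h2.const_mul m₁).add (h3.const_mul (m₂ / 3))).const_mul (2 / Real.pi))
    convert! h4 using 1
    have hs := Real.sqrt_pos.2 hy.1
    have e1 : y ^ ((1 / 2 : ℝ) - 1) = 1 / √y := by
      rw [Real.sqrt_eq_rpow, one_div (y ^ _), ← Real.rpow_neg hy.1.le]; norm_num
    have e2 : y ^ ((3 / 2 : ℝ) - 1) = y / √y := by
      rw [Real.div_sqrt, Real.sqrt_eq_rpow]; norm_num
    rw [e1, e2]
    simp only [mul_neg, mul_one, Complex.neg_re]
    field_simp
    ring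
  have hlim : Tendsto e (𝓝[>] 0) (𝓝 0) := by
    have hc : Continuous fun y : ℝ =>
        2 / Real.pi * (m₁ * y ^ (1 / 2 : ℝ) + m₂ / 3 * y ^ (3 / 2 : ℝ)) := by
      have h1 := Real.continuous_rpow_const (q := 1 / 2) (by norm_num)
      have h2 := Real.continuous_rpow_const (q := 3 / 2) (by norm_num)
      fun_prop
    have := (H.tendsto_zero hg hδ h0).add ((hc.tendsto 0).mono_left nhdsWithin_le_nhds)
    simpa [Real.zero_rpow, he] using this
  refine Asymptotics.IsBigO.of_bound |C| ?_
  filter_upwards [Ioo_mem_nhdsGT (half_pos hδ)] with y hy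
  -- mean value estimate on `[y₀, y]`, then `y₀ → 0`
  have hmv : ∀ y₀ ∈ Ioo 0 y, ‖e y - e y₀‖ ≤ |C| * y ^ (3 / 2 : ℝ) * y := fun y₀ hy₀ => by
    have hsub : Icc y₀ y ⊆ Ioo 0 (δ / 2) := fun t ht => ⟨hy₀.1.trans_le ht.1, ht.2.trans_lt hy.2⟩
    have h1 := (convex_Icc y₀ y).norm_image_sub_le_of_norm_hasDerivWithin_le (f := e)
      (fun t ht => (hderiv t (hsub ht)).hasDerivWithinAt) (C := |C| * y ^ (3 / 2 : ℝ))
      (fun t ht => by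
        rw [norm_neg, Real.norm_eq_abs]
        refine (hre t (hsub ht)).trans ?_
        have := (hsub ht).1
        gcongr
        · exact le_abs_self C
        · exact ht.2) (left_mem_Icc.2 hy₀.2.le) (right_mem_Icc.2 hy₀.2.le)
    refine h1.trans ?_
    have := hy.1
    gcongr
    rw [Real.norm_eq_abs, abs_of_nonneg (by linarith [hy₀.2])]
    linarith [hy₀.1]
  have h5 : ‖e y - 0‖ ≤ |C| * y ^ (3 / 2 : ℝ) * y :=
    le_of_tendsto (hlim.const_sub (e y)).norm (by
      filter_upwards [Ioo_mem_nhdsGT hy.1] with y₀ hy₀ using hmv y₀ hy₀)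
  rw [sub_zero] at h5
  refine h5.trans_eq ?_
  rw [Real.norm_of_nonneg (Real.rpow_nonneg hy.1.le _), mul_assoc]
  congr 1
  nth_rw 2 [← Real.rpow_one y]
  rw [← Real.rpow_add hy.1]
  norm_num

end IsMixedSolution

/-! ### The stress intensity factor and the second-order coefficient -/

section Loads

variable {μp μm : ℝ} {p pp pm : ℝ → ℝ}

/-- The combination `p⁺/μ₊ + p⁻/μ₋` of the loads, which is the normal derivative of the reflected
jump `u(z) - u(conj z)` on the crack. -/
noncomputable def effectiveLoad (μp μm : ℝ) (pp pm : ℝ → ℝ) (x : ℝ) : ℝ := pp x / μp + pm x / μm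

lemma compliance_pos (hμp : 0 < μp) (hμm : 0 < μm) : 0 < compliance μp μm := by
  unfold compliance; positivity

lemma effectiveLoad_div_compliance (hμp : 0 < μp) (hμm : 0 < μm) (x : ℝ) :
    loadAverage pp pm x + eta μp μm / 2 * loadJump pp pm x
      = effectiveLoad μp μm pp pm x / compliance μp μm := by
  unfold loadAverage eta loadJump effectiveLoad compliance
  field_simp
  ring

lemma IsLoad.const_mul_add (hp : IsLoad pp) (hm : IsLoad pm) (a b : ℝ) :
    IsLoad fun x => a * pp x + b * pm x := by
  obtain ⟨δ₁, h₁, hz₁⟩ := hp.vanishes_near_tip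
  obtain ⟨δ₂, h₂, hz₂⟩ := hm.vanishes_near_tip
  refine ⟨⟨min δ₁ δ₂, lt_min h₁ h₂, fun x hx => ?_⟩,
    (hp.integrable.const_mul a).add (hm.integrable.const_mul b)⟩
  rw [hz₁ x ⟨by linarith [hx.1, min_le_left δ₁ δ₂], hx.2⟩,
    hz₂ x ⟨by linarith [hx.1, min_le_right δ₁ δ₂], hx.2⟩]
  simp

lemma IsLoad.effectiveLoad (hp : IsLoad pp) (hm : IsLoad pm) :
    IsLoad (effectiveLoad μp μm pp pm) := by
  have h := hp.const_mul_add hm μp⁻¹ μm⁻¹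
  have e : (fun x => μp⁻¹ * pp x + μm⁻¹ * pm x) = InterfaceCrack.effectiveLoad μp μm pp pm := by
    funext x
    unfold InterfaceCrack.effectiveLoad
    ring
  rwa [e] at h

/-- Away from the tip, a load can be multiplied by a negative power of the distance. -/
lemma IsLoad.integrableOn_mul_rpow (hp : IsLoad p) {q : ℝ} (hq : q ≤ 0) :
    IntegrableOn (fun t => p t * (-t) ^ q) (Iio 0) := by
  obtain ⟨δ, hδ, h0⟩ := hp.vanishes_near_tip
  exact InterfaceCrack.integrableOn_mul_rpow hp.integrable hδ h0 hq

lemma IsSmoothLoad.hasDerivAt (hp : IsSmoothLoad p) {x : ℝ} (hx : x < 0) :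
    HasDerivAt p (deriv p x) x :=
  ((hp.contDiff.differentiableOn one_ne_zero).differentiableAt (Iio_mem_nhds hx)).hasDerivAt

lemma IsSmoothLoad.isLoad_deriv (hp : IsSmoothLoad p) : IsLoad (deriv p) := by
  obtain ⟨δ, hδ, h0⟩ := hp.vanishes_near_tip
  refine ⟨⟨δ, hδ, fun x hx => ?_⟩, hp.integrable_deriv⟩
  have h : p =ᶠ[𝓝 x] fun _ => 0 := by
    filter_upwards [Ioo_mem_nhds hx.1 hx.2] with y hy using h0 y hy
  rw [h.deriv_eq, deriv_const]

/-- Integration by parts: the moment of a load with weight `(-t)^{-3/2}` is a moment of its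
derivative with weight `(-t)^{-1/2}`. -/
lemma IsSmoothLoad.integral_deriv_mul_rpow (hp : IsSmoothLoad p) :
    ∫ t in Iio (0 : ℝ), deriv p t * (-t) ^ (-1 / 2 : ℝ)
      = -(1 / 2) * ∫ t in Iio (0 : ℝ), p t * (-t) ^ (-3 / 2 : ℝ) := by
  obtain ⟨δ, hδ, h0⟩ := hp.vanishes_near_tip
  set F : ℝ → ℝ := fun t => p t * (-t) ^ (-1 / 2 : ℝ) with hF
  have hderiv : ∀ t ∈ Iio (0 : ℝ), HasDerivAt F
      (deriv p t * (-t) ^ (-1 / 2 : ℝ) + 1 / 2 * (p t * (-t) ^ (-3 / 2 : ℝ))) t := fun t ht => by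
    have h1 := (hasDerivAt_neg t).rpow_const (p := (-1 / 2 : ℝ))
      (Or.inl (neg_ne_zero.2 (ne_of_lt ht)))
    convert! (hp.hasDerivAt ht).mul h1 using 1
    norm_num
    ring
  have hi1 := hp.isLoad_deriv.integrableOn_mul_rpow (q := -1 / 2) (by norm_num)
  have hi2 := (hp.toIsLoad.integrableOn_mul_rpow (q := -3 / 2) (by norm_num)).const_mul (1 / 2)
  have hi := hi1.add hi2
  have hiF := hp.toIsLoad.integrableOn_mul_rpow (q := -1 / 2) (by norm_num)
  -- `0 ^ (-1 / 2) = 0`, so that `F` vanishes on `(-δ, 0]`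
  have hcont : ContinuousWithinAt F (Iic 0) 0 := by
    have h1 : F =ᶠ[𝓝[≤] 0] fun _ => 0 := by
      filter_upwards [Ioc_mem_nhdsLE (neg_lt_zero.2 hδ)] with t ht
      rcases ht.2.eq_or_lt with h | h
      · simp [hF, h, Real.zero_rpow (show (-1 / 2 : ℝ) ≠ 0 by norm_num)]
      · simp [hF, h0 t ⟨ht.1, h⟩]
    exact continuousWithinAt_const.congr_of_eventuallyEq h1
      (by simp [hF, Real.zero_rpow (show (-1 / 2 : ℝ) ≠ 0 by norm_num)])
  have hsub : Iic (-1 : ℝ) ⊆ Iio 0 := fun t ht => by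
    have : t ≤ -1 := ht
    exact lt_of_le_of_lt this neg_one_lt_zero
  have hlim : Tendsto F atBot (𝓝 0) := tendsto_zero_of_hasDerivAt_of_integrableOn_Iic
    (fun t ht => hderiv t (hsub ht)) (hi.mono_set hsub) (hiF.mono_set hsub)
  have h := integral_Iic_of_hasDerivAt_of_tendsto hcont hderiv
    (hi.congr_set_ae Iio_ae_eq_Iic.symm) hlim
  have hF0 : F 0 = 0 := by simp [hF, Real.zero_rpow (show (-1 / 2 : ℝ) ≠ 0 by norm_num)]
  rw [hF0, sub_zero, integral_Iic_eq_integral_Iio, integral_add hi1 hi2, integral_const_mul] at h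
  linarith

lemma deriv_loads (hp : IsSmoothLoad pp) (hm : IsSmoothLoad pm) {x : ℝ} (hx : x < 0) :
    deriv (loadAverage pp pm) x = loadAverage (deriv pp) (deriv pm) x ∧
    deriv (loadJump pp pm) x = loadJump (deriv pp) (deriv pm) x :=
  ⟨(((hp.hasDerivAt hx).add (hm.hasDerivAt hx)).div_const 2).deriv,
    ((hp.hasDerivAt hx).sub (hm.hasDerivAt hx)).deriv⟩

end Loads

section Physical

variable {μp μm : ℝ} {pp pm : ℝ → ℝ} {u : BimaterialField ℝ}

lemma measurePreserving_conj : MeasurePreserving (starRingEnd ℂ) (volume : Measure ℂ) volume :=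
  Complex.conjLIE.measurePreserving

/-- Reflecting the lower half-plane, the jump of a physical solution solves the mixed problem. -/
lemma IsPhysicalSolution.exists_isMixedSolution (hμp : 0 < μp) (hμm : 0 < μm)
    (hu : IsPhysicalSolution μp μm pp pm u) :
    ∃ h, IsMixedSolution (effectiveLoad μp μm pp pm)
      (fun z => u.upper z - u.lower ((starRingEnd ℂ) z)) h ∧
      ∀ x : ℝ, 0 < x → tractionUpper μp u x = -(h x).im / compliance μp μm := by
  obtain ⟨h₁, H₁⟩ := exists_isComplexGradient_of_upper hu.equilibrium.contDiff_upper
    hu.equilibrium.harmonic_upper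
  obtain ⟨h₂, H₂⟩ := exists_isComplexGradient_of_lower hu.equilibrium.contDiff_lower
    hu.equilibrium.harmonic_lower
  have hUmeas : MeasurableSet {z : ℂ | 0 < z.im} := isOpen_im_pos.measurableSet
  have hm₁ : AEStronglyMeasurable h₁ (volume.restrict {z : ℂ | 0 < z.im}) :=
    (H₁.continuousOn.mono im_pos_subset_upperHalf).aestronglyMeasurable hUmeas
  have hm₂ : AEStronglyMeasurable h₂ (volume.restrict {z : ℂ | 0 < z.im}) :=
    (H₂.continuousOn.mono im_pos_subset_upperHalf).aestronglyMeasurable hUmeas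
  have he₁ : IntegrableOn (fun z => ‖h₁ z‖ ^ 2) {z : ℂ | 0 < z.im} := by
    refine (hu.energy_upper.const_mul (2 / μp)).mono' (hm₁.norm.pow 2) ?_
    filter_upwards [ae_restrict_mem hUmeas] with z hz
    rw [(H₁.hasFDerivAt hz).fderiv, norm_pow, norm_norm, ← mul_assoc]
    have : 2 / μp * (μp / 2) = 1 := by field_simp
    rw [this, one_mul]
    gcongr
    exact norm_le_norm_reMul _
  have he₂ : IntegrableOn (fun z => ‖h₂ z‖ ^ 2) {z : ℂ | 0 < z.im} := by
    have hpre : (starRingEnd ℂ) ⁻¹' {z : ℂ | z.im < 0} = {z : ℂ | 0 < z.im} := by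
      ext z; simp
    have hl := (measurePreserving_conj.integrableOn_comp_preimage
      Complex.conjCLE.toHomeomorph.measurableEmbedding).2 hu.energy_lower
    rw [hpre] at hl
    refine (hl.const_mul (2 / μm)).mono' (hm₂.norm.pow 2) ?_
    filter_upwards [ae_restrict_mem hUmeas] with z hz
    have hz' : ((starRingEnd ℂ) z).im < 0 := by simpa using hz
    have hfd : HasFDerivAt u.lower ((reMul (h₂ z)).comp (Complex.conjCLE : ℂ →L[ℝ] ℂ))
        ((starRingEnd ℂ) z) :=
      (hasFDerivWithinAt_lower H₂ (im_pos_subset_upperHalf hz)).hasFDerivAt (lowerHalf_mem_nhds hz')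
    have hle : ‖h₂ z‖ ≤ ‖fderiv ℝ u.lower ((starRingEnd ℂ) z)‖ := by
      rw [hfd.fderiv]
      have e : reMul (h₂ z) = ((reMul (h₂ z)).comp (Complex.conjCLE : ℂ →L[ℝ] ℂ)).comp
          (Complex.conjCLE : ℂ →L[ℝ] ℂ) := by
        ext v; simp
      refine (norm_le_norm_reMul _).trans ?_
      nth_rw 1 [e]
      refine (ContinuousLinearMap.opNorm_comp_le _ _).trans_eq ?_
      rw [Complex.conjCLE_norm, mul_one]
    rw [norm_pow, norm_norm, Function.comp, ← mul_assoc]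
    have : 2 / μm * (μm / 2) = 1 := by field_simp
    rw [this, one_mul]
    gcongr
  have H := H₁.linearCombination H₂ 1 (-1)
  have e : (fun z => 1 * u.upper z + -1 * u.lower ((starRingEnd ℂ) z))
      = fun z => u.upper z - u.lower ((starRingEnd ℂ) z) := by
    funext z; ring
  rw [e] at H
  refine ⟨_, ⟨H, fun x hx => ?_, fun x hx => ?_, ?_⟩, fun x hx => ?_⟩
  · simpa [jump] using hu.jump_eq_zero x hx
  · have h1 := hu.load_upper x hx
    have h2 := hu.load_lower x hx
    rw [tractionUpper_eq H₁ μp hx.ne] at h1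
    rw [tractionLower_eq H₂ μm hx.ne] at h2
    rw [Complex.add_im, Complex.im_ofReal_mul, Complex.im_ofReal_mul, effectiveLoad, ← h1, ← h2]
    field_simp
    ring
  · refine ((he₁.const_mul 2).add (he₂.const_mul 2)).mono'
      (((hm₁.const_mul _).add (hm₂.const_mul _)).norm.pow 2) (ae_of_all _ fun z => ?_)
    rw [norm_pow, norm_norm]
    have h1 : ‖((1 : ℝ) : ℂ) * h₁ z + ((-1 : ℝ) : ℂ) * h₂ z‖ ≤ ‖h₁ z‖ + ‖h₂ z‖ := by
      refine (norm_add_le _ _).trans ?_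
      simp
    calc _ ≤ (‖h₁ z‖ + ‖h₂ z‖) ^ 2 := by gcongr
      _ ≤ 2 * ‖h₁ z‖ ^ 2 + 2 * ‖h₂ z‖ ^ 2 := by nlinarith [sq_nonneg (‖h₁ z‖ - ‖h₂ z‖)]
  · have h1 := hu.traction_continuous x hx
    rw [tractionUpper_eq H₁ μp hx.ne', tractionLower_eq H₂ μm hx.ne'] at h1
    rw [tractionUpper_eq H₁ μp hx.ne', Complex.add_im, Complex.im_ofReal_mul,
      Complex.im_ofReal_mul, eq_div_iff (compliance_pos hμp hμm).ne', compliance]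
    field_simp
    linear_combination h1

lemma sqrt_two_div_pi : √(2 / Real.pi) = √(2 * Real.pi) / Real.pi := by
  have hpi := Real.pi_pos
  rw [eq_div_iff hpi.ne', ← Real.sqrt_sq hpi.le, ← Real.sqrt_mul (by positivity),
    Real.sqrt_sq hpi.le]
  congr 1
  field_simp

/-- The coefficients at the tip are moments of the effective load. -/
theorem IsPhysicalSolution.hasTipAsymptotics (hμp : 0 < μp) (hμm : 0 < μm) (hp : IsLoad pp)
    (hm : IsLoad pm) (hu : IsPhysicalSolution μp μm pp pm u) :
    HasTipAsymptotics μp μm u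
      (-√(2 / Real.pi) * ((∫ t in Iio (0 : ℝ), effectiveLoad μp μm pp pm t * (-t) ^ (-1 / 2 : ℝ))
        / compliance μp μm))
      (√(2 / Real.pi) * ((∫ t in Iio (0 : ℝ), effectiveLoad μp μm pp pm t * (-t) ^ (-3 / 2 : ℝ))
        / compliance μp μm)) := by
  obtain ⟨h, H, hσ⟩ := hu.exists_isMixedSolution hμp hμm
  have hg := hp.effectiveLoad (μp := μp) (μm := μm) hm
  obtain ⟨δ, hδ, h0⟩ := hg.vanishes_near_tip
  have hA := H.im_isBigO hg.integrable hδ h0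
  have hB := H.isBigO_neg hg.integrable hδ h0
  set m₁ := ∫ t in Iio (0 : ℝ), effectiveLoad μp μm pp pm t * (-t) ^ (-1 / 2 : ℝ)
  set m₂ := ∫ t in Iio (0 : ℝ), effectiveLoad μp μm pp pm t * (-t) ^ (-3 / 2 : ℝ)
  have hc := compliance_pos hμp hμm
  have hpi := Real.pi_pos
  have h2pi : 0 < √(2 * Real.pi) := by positivity
  rw [sqrt_two_div_pi]
  constructor
  · refine (hA.const_mul_left (-1 / compliance μp μm)).congr' ?_ .rfl
    filter_upwards [self_mem_nhdsWithin] with x hx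
    have hx : 0 < x := hx
    have hs := Real.sqrt_pos.2 hx
    have e1 : x ^ (-1 / 2 : ℝ) = 1 / √x := by
      rw [Real.sqrt_eq_rpow, one_div (x ^ _), ← Real.rpow_neg hx.le]; norm_num
    have e2 : x ^ (1 / 2 : ℝ) = x / √x := by rw [Real.div_sqrt, Real.sqrt_eq_rpow]
    rw [hσ x hx, e1, e2]
    field_simp
    ring
  · have hneg : Tendsto (fun x : ℝ => -x) (𝓝[<] 0) (𝓝[>] 0) := by
      simpa using tendsto_neg_nhdsLT (a := (0 : ℝ))
    refine (hB.comp_tendsto hneg).congr (fun x => ?_) fun x => rfl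
    simp only [Function.comp, neg_neg, jump, Complex.conj_ofReal]
    field_simp
    ring

end Physical

/-! ### Homogeneous fields -/

section Homogeneous

variable {w : ℂ → ℝ} {h : ℂ → ℂ}

lemma reMul_injective : Function.Injective reMul := fun c d hcd => by
  have h1 := congrArg (fun L : ℂ →L[ℝ] ℝ => L 1) hcd
  have h2 := congrArg (fun L : ℂ →L[ℝ] ℝ => L Complex.I) hcd
  simp only [reMul_apply, mul_one, Complex.mul_I_re, neg_inj] at h1 h2
  exact Complex.ext h1 h2

lemma ofReal_mul_mem_upperHalf {t : ℝ} (ht : 0 < t) {z : ℂ} (hz : z ∈ upperHalf) :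
    (t : ℂ) * z ∈ upperHalf :=
  ⟨by rw [Complex.im_ofReal_mul]; exact mul_nonneg ht.le hz.1,
    mul_ne_zero (by exact_mod_cast ht.ne') hz.2⟩

namespace IsComplexGradient

/-- Euler's relation. -/
lemma euler (H : IsComplexGradient w h)
    (hom : ∀ t : ℝ, 0 < t → ∀ z ∈ upperHalf, w ((t : ℂ) * z) = t ^ (-1 / 2 : ℝ) * w z)
    {z : ℂ} (hz : z ∈ upperHalf) : w z = -2 * (z * h z).re := by
  have hγ : HasDerivAt (fun t : ℝ => (t : ℂ) * z) z 1 := by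
    simpa using (Complex.ofRealCLM.hasDerivAt (x := 1)).mul_const z
  have h1 := (H.hasDerivWithinAt_comp hγ.hasDerivWithinAt (s := Ioi 0) (by simpa using hz)
    fun t ht => ofReal_mul_mem_upperHalf ht hz).hasDerivAt (Ioi_mem_nhds one_pos)
  have h2 : HasDerivAt (fun t : ℝ => t ^ (-1 / 2 : ℝ) * w z) (-1 / 2 * w z) 1 := by
    simpa using (Real.hasDerivAt_rpow_const (x := 1) (p := (-1 / 2 : ℝ))
      (Or.inl one_ne_zero)).mul_const (w z)
  have h3 := h1.unique (h2.congr_of_eventuallyEq (by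
    filter_upwards [Ioi_mem_nhds one_pos] with t ht using hom t ht z hz))
  simp only [Complex.ofReal_one, one_mul] at h3
  rw [mul_comm z, h3]
  ring

/-- The gradient is homogeneous of degree `-3/2`. -/
lemma homogeneous (H : IsComplexGradient w h)
    (hom : ∀ t : ℝ, 0 < t → ∀ z ∈ upperHalf, w ((t : ℂ) * z) = t ^ (-1 / 2 : ℝ) * w z)
    {t : ℝ} (ht : 0 < t) {z : ℂ} (hz : z ∈ upperHalf) :
    h (t * z) = (t ^ (-3 / 2 : ℝ) : ℝ) * h z := by
  have h1 : HasFDerivWithinAt (fun z => w ((t : ℂ) * z)) (reMul (t * h (t * z))) upperHalf z := by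
    have hm : HasFDerivWithinAt (fun z : ℂ => (t : ℂ) * z) (t • ContinuousLinearMap.id ℝ ℂ)
        upperHalf z := by
      exact (t • ContinuousLinearMap.id ℝ ℂ).hasFDerivWithinAt.congr (fun y _ => by simp) (by simp)
    have := (H.hasFDerivWithinAt _ (ofReal_mul_mem_upperHalf ht hz)).comp z hm
      fun y hy => ofReal_mul_mem_upperHalf ht hy
    convert! this using 1
    ext v
    simp only [reMul_apply, ContinuousLinearMap.comp_apply, _root_.smul_apply,
      ContinuousLinearMap.id_apply, Complex.real_smul]
    ring_nf
  have h2 : HasFDerivWithinAt (fun z => w ((t : ℂ) * z))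
      (reMul ((t ^ (-1 / 2 : ℝ) : ℝ) * h z)) upperHalf z := by
    have := (H.hasFDerivWithinAt z hz).const_mul (t ^ (-1 / 2 : ℝ))
    refine (this.congr (fun y hy => hom t ht y hy) (hom t ht z hz)).congr_fderiv ?_
    ext v
    simp only [reMul_apply, _root_.smul_apply, smul_eq_mul, mul_assoc, Complex.re_ofReal_mul]
  have h3 := reMul_injective ((uniqueDiffOn_upperHalf z hz).eq h1 h2)
  have ht' : (t : ℂ) ≠ 0 := by exact_mod_cast ht.ne'
  apply mul_left_cancel₀ ht'
  rw [h3, ← mul_assoc, ← Complex.ofReal_mul]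
  congr 2
  nth_rw 2 [← Real.rpow_one t]
  rw [← Real.rpow_add ht]
  norm_num

/-- In the coordinate `z = exp s`, the function `z^{3/2} h(z)` is holomorphic and independent of
`Re s`, hence constant. -/
lemma exists_eq_const (H : IsComplexGradient w h)
    (hom : ∀ t : ℝ, 0 < t → ∀ z ∈ upperHalf, w ((t : ℂ) * z) = t ^ (-1 / 2 : ℝ) * w z) :
    ∃ c : ℂ, ∀ s ∈ closedStrip, Complex.exp (3 / 2 * s) * h (Complex.exp s) = c := by
  set G : ℂ → ℂ := fun s => Complex.exp (3 / 2 * s) * h (Complex.exp s) with hG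
  have hGd : DifferentiableOn ℂ G openStrip :=
    (Differentiable.differentiableOn (by fun_prop)).mul
      (H.differentiableOn.comp Complex.differentiable_exp.differentiableOn
        fun _ hs => exp_im_pos hs)
  have hGc : ContinuousOn G closedStrip :=
    (Continuous.continuousOn (by fun_prop)).mul
      (H.continuousOn.comp Complex.continuous_exp.continuousOn fun _ hs => exp_mem_upperHalf hs)
  have hinv : ∀ s ∈ closedStrip, ∀ x : ℝ, G (s + x) = G s := fun s hs x => by
    have h1 : Complex.exp (s + x) = (Real.exp x : ℝ) * Complex.exp s := by
      rw [Complex.exp_add, Complex.ofReal_exp, mul_comm]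
    have h2 : Complex.exp (3 / 2 * (s + x)) * ((Real.exp x ^ (-3 / 2 : ℝ) : ℝ) : ℂ)
        = Complex.exp (3 / 2 * s) := by
      rw [← Real.exp_mul, Complex.ofReal_exp, ← Complex.exp_add]
      congr 1
      push_cast
      ring
    simp only [hG]
    rw [h1, H.homogeneous hom (Real.exp_pos x) (exp_mem_upperHalf hs), ← mul_assoc, h2]
  have hderiv : EqOn (deriv G) 0 openStrip := fun s hs => by
    have hs1 := (hGd.differentiableAt (isOpen_openStrip.mem_nhds hs)).hasDerivAt
    have h1 : HasDerivAt (fun x : ℝ => G (s + x)) (deriv G s) 0 := by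
      have hγ : HasDerivAt (fun x : ℝ => s + (x : ℂ)) 1 0 := by
        simpa using (Complex.ofRealCLM.hasDerivAt (x := 0)).const_add s
      have hs2 : HasDerivAt G (deriv G s) (s + ((0 : ℝ) : ℂ)) := by simpa using hs1
      have := hs2.comp (0 : ℝ) hγ
      rwa [mul_one] at this
    exact (h1.unique ((hasDerivAt_const (0 : ℝ) (G s)).congr_of_eventuallyEq
      (Eventually.of_forall fun x => hinv s (openStrip_subset_closedStrip hs) x)))
  have hconv : Convex ℝ openStrip :=
    (convex_halfSpace_im_gt 0).inter (convex_halfSpace_im_lt Real.pi)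
  set s₀ : ℂ := (Real.pi / 2 : ℝ) * Complex.I
  have hs₀ : s₀ ∈ openStrip := by
    have := Real.pi_pos
    constructor <;> simp [s₀] <;> linarith
  have hopen : EqOn G (fun _ => G s₀) openStrip := fun s hs =>
    isOpen_openStrip.is_const_of_deriv_eq_zero hconv.isPreconnected hGd hderiv hs hs₀
  exact ⟨G s₀, fun s hs => hopen.of_subset_closure hGc continuousOn_const
    openStrip_subset_closedStrip closedStrip_subset_closure hs⟩

lemma exp_log_rpow {x : ℝ} (hx : 0 < x) (p : ℝ) : Real.exp (p * Real.log x) = x ^ p := by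
  rw [Real.rpow_def_of_pos hx, mul_comm]

/-- Traces of the gradient of a homogeneous field on the two half-lines. -/
lemma exists_traces (H : IsComplexGradient w h)
    (hom : ∀ t : ℝ, 0 < t → ∀ z ∈ upperHalf, w ((t : ℂ) * z) = t ^ (-1 / 2 : ℝ) * w z) :
    ∃ c : ℂ, (∀ x : ℝ, 0 < x → h x = (x ^ (-3 / 2 : ℝ) : ℝ) * c) ∧
      (∀ y : ℝ, 0 < y → h ((-y : ℝ) : ℂ) = (y ^ (-3 / 2 : ℝ) : ℝ) * (Complex.I * c)) ∧
      (c = 0 → ∀ z ∈ upperHalf, w z = 0) := by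
  obtain ⟨c, hc⟩ := H.exists_eq_const hom
  have hinv : ∀ x : ℝ, 0 < x → ((x ^ (-3 / 2 : ℝ) : ℝ) : ℂ)
      * Complex.exp (3 / 2 * (Real.log x : ℝ)) = 1 := fun x hx => by
    rw [← exp_log_rpow hx, Complex.ofReal_exp, ← Complex.exp_add, ← Complex.exp_zero]
    congr 1
    push_cast
    ring
  refine ⟨c, fun x hx => ?_, fun y hy => ?_, fun hc0 z hz => ?_⟩
  · rw [← hc _ (ofReal_mem_closedStrip (Real.log x)), ← mul_assoc, hinv x hx, one_mul,
      ← Complex.ofReal_exp, Real.exp_log hx]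
  · rw [← hc _ (add_pi_mem_closedStrip (Real.log y)), exp_add_pi, Real.exp_log hy, mul_add,
      Complex.exp_add]
    have h1 : Complex.exp (3 / 2 * (Real.pi * Complex.I)) = -Complex.I := by
      have : (3 / 2 * (Real.pi * Complex.I) : ℂ)
          = Real.pi * Complex.I + Real.pi / 2 * Complex.I := by ring
      rw [this, Complex.exp_add, Complex.exp_pi_mul_I, Complex.exp_pi_div_two_mul_I]
      ring
    rw [h1, Complex.ofReal_neg]
    linear_combination (-h (-(y : ℂ))) * hinv y hy
      + h (-(y : ℂ)) * ((y ^ (-3 / 2 : ℝ) : ℝ) : ℂ) * Complex.exp (3 / 2 * (Real.log y : ℝ))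
        * Complex.I_sq
  · have hs : Complex.log z ∈ closedStrip :=
      ⟨by rw [Complex.log_im]; exact Complex.arg_nonneg_iff.2 hz.1,
        by rw [Complex.log_im]; exact Complex.arg_le_pi z⟩
    have h1 := hc _ hs
    rw [Complex.exp_log hz.2, hc0] at h1
    rw [H.euler hom hz, (mul_eq_zero.1 h1).resolve_left (Complex.exp_ne_zero _)]
    simp

end IsComplexGradient

end Homogeneous

/-! ### Traces of the weight function -/

section Map

variable {E F : Type*} [NormedAddCommGroup E] [NormedSpace ℝ E] [NormedAddCommGroup F]
  [NormedSpace ℝ F] {u : BimaterialField E}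

/-- The field obtained by applying a linear map to the values of a field. -/
def BimaterialField.map (L : E →L[ℝ] F) (u : BimaterialField E) : BimaterialField F where
  upper z := L (u.upper z)
  lower z := L (u.lower z)

lemma IsEquilibrium.map (hu : IsEquilibrium u) (L : E →L[ℝ] F) : IsEquilibrium (u.map L) where
  contDiff_upper := L.contDiff.comp_contDiffOn hu.contDiff_upper
  contDiff_lower := L.contDiff.comp_contDiffOn hu.contDiff_lower
  harmonic_upper z hz := (hu.harmonic_upper z hz).comp_CLM L
  harmonic_lower z hz := (hu.harmonic_lower z hz).comp_CLM L

lemma IsEquilibrium.tractionUpper_map (hu : IsEquilibrium u) (L : E →L[ℝ] F) (μ : ℝ) {x : ℝ}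
    (hx : x ≠ 0) : tractionUpper μ (u.map L) x = L (tractionUpper μ u x) := by
  have hmem := ofReal_mem_upperHalf hx
  have h := L.hasFDerivAt.comp_hasFDerivWithinAt (x : ℂ)
    (hu.contDiff_upper.differentiableOn one_ne_zero _ hmem).hasFDerivWithinAt
  simp only [tractionUpper, map_smul]
  congr 1
  exact congrArg (fun T : ℂ →L[ℝ] F => T Complex.I) (h.fderivWithin (uniqueDiffOn_upperHalf _ hmem))

lemma IsEquilibrium.tractionLower_map (hu : IsEquilibrium u) (L : E →L[ℝ] F) (μ : ℝ) {x : ℝ}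
    (hx : x ≠ 0) : tractionLower μ (u.map L) x = L (tractionLower μ u x) := by
  have hmem := ofReal_mem_lowerHalf hx
  have h := L.hasFDerivAt.comp_hasFDerivWithinAt (x : ℂ)
    (hu.contDiff_lower.differentiableOn one_ne_zero _ hmem).hasFDerivWithinAt
  simp only [tractionLower, map_smul]
  congr 1
  exact congrArg (fun T : ℂ →L[ℝ] F => T Complex.I) (h.fderivWithin (uniqueDiffOn_lowerHalf _ hmem))

end Map

section Singular

variable {μp μm : ℝ} {U : BimaterialField ℂ}

lemma map_ofReal_mul (L : ℂ →L[ℝ] ℝ) (t : ℝ) (v : ℂ) : L ((t : ℂ) * v) = t * L v := by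
  rw [← Complex.real_smul, map_smul, smul_eq_mul]

/-- The traces of a real component of a singular solution, up to a constant. The weighted sum
`μ₊ u₊ + μ₋ u₋` of the two half-plane fields, the lower one reflected, has vanishing normal
derivative on the whole line and hence vanishes; the jump is determined by one real constant. -/
lemma IsSingularSolution.exists_real_traces (hμp : 0 < μp) (hμm : 0 < μm)
    (hU : IsSingularSolution μp μm U) (L : ℂ →L[ℝ] ℝ) : ∃ a : ℝ,
      (∀ x : ℝ, 0 < x → L (U.upper x) = μm / (μp + μm) * (a * x ^ (-1 / 2 : ℝ)) ∧
        L (U.lower x) = -μp / (μp + μm) * (a * x ^ (-1 / 2 : ℝ))) ∧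
      (∀ x : ℝ, x < 0 → L (U.upper x) = 0 ∧ L (U.lower x) = 0 ∧
        L (tractionUpper μp U x) = a / (2 * compliance μp μm) * (-x) ^ (-3 / 2 : ℝ)) := by
  have hE := hU.equilibrium.map L
  set u := U.map L with hu
  obtain ⟨h₁, H₁⟩ := exists_isComplexGradient_of_upper hE.contDiff_upper hE.harmonic_upper
  obtain ⟨h₂, H₂⟩ := exists_isComplexGradient_of_lower hE.contDiff_lower hE.harmonic_lower
  have hom₁ : ∀ t : ℝ, 0 < t → ∀ z ∈ upperHalf,
      u.upper ((t : ℂ) * z) = t ^ (-1 / 2 : ℝ) * u.upper z := fun t ht z hz => by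
    simp only [hu, BimaterialField.map]
    rw [hU.homogeneous_upper t ht z hz, map_ofReal_mul]
  have hom₂ : ∀ t : ℝ, 0 < t → ∀ z ∈ upperHalf, u.lower ((starRingEnd ℂ) ((t : ℂ) * z))
      = t ^ (-1 / 2 : ℝ) * u.lower ((starRingEnd ℂ) z) := fun t ht z hz => by
    simp only [hu, BimaterialField.map]
    rw [map_mul, Complex.conj_ofReal, hU.homogeneous_lower t ht _ (conj_mem_lowerHalf hz),
      map_ofReal_mul]
  have hTu : ∀ x : ℝ, x ≠ 0 → L (tractionUpper μp U x) = -(μp * (h₁ x).im) := fun x hx => by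
    rw [← hU.equilibrium.tractionUpper_map L μp hx, tractionUpper_eq H₁ μp hx]
  have hTl : ∀ x : ℝ, x ≠ 0 → L (tractionLower μm U x) = μm * (h₂ x).im := fun x hx => by
    rw [← hU.equilibrium.tractionLower_map L μm hx, tractionLower_eq H₂ μm hx]
  have hpos₁ : ∀ x : ℝ, 0 < x → (h₁ x).im = 0 := fun x hx => by
    have := hTu x hx.ne'
    rw [hU.traction_free_upper x hx, map_zero, eq_comm, neg_eq_zero] at this
    exact (mul_eq_zero.1 this).resolve_left hμp.ne'
  have hpos₂ : ∀ x : ℝ, 0 < x → (h₂ x).im = 0 := fun x hx => by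
    have := hTl x hx.ne'
    rw [hU.traction_free_lower x hx, map_zero, eq_comm] at this
    exact (mul_eq_zero.1 this).resolve_left hμm.ne'
  have hneg : ∀ x : ℝ, x < 0 → μp * (h₁ x).im + μm * (h₂ x).im = 0 := fun x hx => by
    have h1 := hTu x hx.ne
    rw [hU.traction_continuous x hx, hTl x hx.ne] at h1
    linarith
  -- the weighted sum vanishes
  have HS := H₁.linearCombination H₂ μp μm
  obtain ⟨c, hc1, hc2, hc3⟩ := HS.exists_traces fun t ht z hz => by
    rw [hom₁ t ht z hz, hom₂ t ht z hz]; ring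
  have hc : c = 0 := by
    have h1 := congrArg Complex.im (hc1 1 one_pos)
    have h2 := congrArg Complex.im (hc2 1 one_pos)
    simp only [Complex.add_im, Complex.im_ofReal_mul, Real.one_rpow, one_mul, hpos₁ 1 one_pos,
      hpos₂ 1 one_pos, hneg (-1) (by norm_num), Complex.I_mul_im] at h1 h2
    apply Complex.ext
    · simpa using h2.symm
    · simpa using h1.symm
  have hS := hc3 hc
  -- the jump
  have HJ := H₁.linearCombination H₂ 1 (-1)
  have homJ : ∀ t : ℝ, 0 < t → ∀ z ∈ upperHalf,
      1 * u.upper ((t : ℂ) * z) + -1 * u.lower ((starRingEnd ℂ) ((t : ℂ) * z))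
        = t ^ (-1 / 2 : ℝ) * (1 * u.upper z + -1 * u.lower ((starRingEnd ℂ) z)) :=
    fun t ht z hz => by rw [hom₁ t ht z hz, hom₂ t ht z hz]; ring
  obtain ⟨d, hd1, hd2, -⟩ := HJ.exists_traces homJ
  have hdim : d.im = 0 := by
    have h1 := congrArg Complex.im (hd1 1 one_pos)
    simp only [Complex.add_im, Complex.im_ofReal_mul, Real.one_rpow, one_mul, hpos₁ 1 one_pos,
      hpos₂ 1 one_pos] at h1
    simpa using h1.symm
  have hsum : 0 < μp + μm := by linarith
  refine ⟨-2 * d.re, fun x hx => ?_, fun x hx => ?_⟩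
  · have hmem := ofReal_mem_upperHalf hx.ne'
    have h1 := hS x hmem
    have h2 := HJ.euler homJ hmem
    rw [hd1 x hx, Complex.re_ofReal_mul, Complex.re_ofReal_mul, ← mul_assoc x] at h2
    have h3 : x * x ^ (-3 / 2 : ℝ) = x ^ (-1 / 2 : ℝ) := by
      nth_rw 1 [← Real.rpow_one x]
      rw [← Real.rpow_add hx]
      norm_num
    rw [h3] at h2
    simp only [Complex.conj_ofReal] at h1 h2
    change L (U.upper x) = _ ∧ L (U.lower x) = _
    change μp * L (U.upper x) + μm * L (U.lower x) = 0 at h1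
    change 1 * L (U.upper x) + -1 * L (U.lower x) = _ at h2
    generalize x ^ (-1 / 2 : ℝ) = r at h2 ⊢
    constructor
    · field_simp
      linear_combination h1 + μm * h2
    · field_simp
      linear_combination h1 - μp * h2
  · have hmem := ofReal_mem_upperHalf hx.ne
    have h1 := hS x hmem
    rw [Complex.conj_ofReal] at h1
    change μp * L (U.upper x) + μm * L (U.lower x) = 0 at h1
    have h2 : L (U.upper x) - L (U.lower x) = 0 := by
      rw [← map_sub]
      have := hU.jump_eq_zero x hx
      rw [jump] at this
      rw [this, map_zero]
    have h3 : (μp + μm) * L (U.upper x) = 0 := by linear_combination h1 + μm * h2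
    have h4 := (mul_eq_zero.1 h3).resolve_left hsum.ne'
    refine ⟨h4, by linarith, ?_⟩
    have h5 := congrArg Complex.im (hd2 (-x) (by linarith))
    have h6 := hneg x hx
    rw [neg_neg, Complex.add_im, Complex.im_ofReal_mul, Complex.im_ofReal_mul,
      Complex.im_ofReal_mul, Complex.I_mul_im] at h5
    rw [hTu x hx.ne, compliance]
    generalize (-x) ^ (-3 / 2 : ℝ) = r at h5 ⊢
    field_simp
    linear_combination (-μm) * h5 - h6

end Singular

/-! ### Normalisation and existence of the weight function -/

/-- The constant `(1 - i) / √(2π)` that normalises the jump of the weight function. -/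
noncomputable def weightConstant : ℂ := (1 - Complex.I) / (√(2 * Real.pi) : ℂ)

lemma exp_pi_div_four_mul_I :
    Complex.exp (Real.pi / 4 * Complex.I) = (1 + Complex.I) / (√2 : ℂ) := by
  have h : ((Real.pi : ℂ) / 4) = ((Real.pi / 4 : ℝ) : ℂ) := by push_cast; ring
  have h2 : (√2 : ℂ) ≠ 0 := by exact_mod_cast (Real.sqrt_pos.2 two_pos).ne'
  have h3 : (√2 : ℂ) * (√2 : ℂ) = 2 := by
    rw [← Complex.ofReal_mul, Real.mul_self_sqrt zero_le_two]; norm_num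
  rw [Complex.exp_mul_I, h, ← Complex.ofReal_cos, ← Complex.ofReal_sin, Real.cos_pi_div_four,
    Real.sin_pi_div_four, eq_div_iff h2]
  push_cast
  linear_combination (1 + Complex.I) / 2 * h3

lemma weightConstant_mul : weightConstant * (√Real.pi : ℂ) * Complex.exp (Real.pi / 4 * Complex.I)
    = 1 := by
  have h1 : (√2 : ℂ) ≠ 0 := by exact_mod_cast (Real.sqrt_pos.2 two_pos).ne'
  have h2 : (√Real.pi : ℂ) ≠ 0 := by exact_mod_cast (Real.sqrt_pos.2 Real.pi_pos).ne'
  have h3 : (√2 : ℂ) * (√2 : ℂ) = 2 := by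
    rw [← Complex.ofReal_mul, Real.mul_self_sqrt zero_le_two]; norm_num
  rw [exp_pi_div_four_mul_I, weightConstant, Real.sqrt_mul zero_le_two, Complex.ofReal_mul]
  field_simp
  linear_combination -h3 - Complex.I_sq

lemma integral_rpow_neg_half_mul_cexp {b : ℂ} (hb : 0 < b.re) :
    ∫ x in Ioi (0 : ℝ), ((x ^ (-1 / 2 : ℝ) : ℝ) : ℂ) * Complex.exp (-b * x)
      = (√Real.pi : ℂ) * b ^ (-1 / 2 : ℂ) := by
  -- substitute `x = u²` and use the Gaussian integral
  rw [← integral_comp_rpow_Ioi (fun x : ℝ => ((x ^ (-1 / 2 : ℝ) : ℝ) : ℂ) * Complex.exp (-b * x))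
    two_ne_zero]
  have h1 : ∀ u ∈ Ioi (0 : ℝ), (|(2 : ℝ)| * u ^ ((2 : ℝ) - 1)) •
      ((((u ^ (2 : ℝ)) ^ (-1 / 2 : ℝ) : ℝ) : ℂ) * Complex.exp (-b * ((u ^ (2 : ℝ) : ℝ) : ℂ)))
      = 2 * Complex.exp (-b * (u : ℂ) ^ 2) := fun u hu => by
    have hu : 0 < u := hu
    have hne : (u : ℂ) ≠ 0 := by exact_mod_cast hu.ne'
    have e1 : u ^ ((2 : ℝ) - 1) = u := by norm_num
    have e2 : (u ^ (2 : ℝ)) ^ (-1 / 2 : ℝ) = u⁻¹ := by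
      rw [← Real.rpow_mul hu.le]
      norm_num
      exact Real.rpow_neg_one u
    rw [e1, e2, abs_two, Real.rpow_two, Complex.real_smul]
    push_cast
    field_simp
  rw [setIntegral_congr_fun measurableSet_Ioi h1, integral_const_mul,
    integral_gaussian_complex_Ioi hb]
  have hb0 : b ≠ 0 := fun h => by simp [h] at hb
  have harg : b.arg ≠ Real.pi := fun h => by
    have := (Complex.arg_eq_pi_iff.1 h).1
    linarith
  have e3 : ((Real.pi : ℂ) / b) ^ (1 / 2 : ℂ) = (√Real.pi : ℂ) * b ^ (-1 / 2 : ℂ) := by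
    have hpi : (Real.pi : ℂ) ≠ 0 := by exact_mod_cast Real.pi_ne_zero
    have hsqrt : (√Real.pi : ℂ) = Complex.exp (1 / 2 * (Real.log Real.pi : ℝ)) := by
      rw [Real.sqrt_eq_rpow, Real.rpow_def_of_pos Real.pi_pos]
      push_cast
      ring_nf
    rw [div_eq_mul_inv, Complex.cpow_def_of_ne_zero (mul_ne_zero hpi (inv_ne_zero hb0)),
      Complex.log_ofReal_mul Real.pi_pos (inv_ne_zero hb0), Complex.log_inv _ harg,
      Complex.cpow_def_of_ne_zero hb0, hsqrt, ← Complex.exp_add]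
    congr 1
    ring
  rw [e3]
  ring

lemma log_neg_I_mul {β : ℂ} (hβ : 0 < β.im) :
    Complex.log (-Complex.I * β) = Complex.log β - Real.pi / 2 * Complex.I := by
  have hβ0 : β ≠ 0 := fun h => by simp [h] at hβ
  have h1 : 0 < β.arg := by
    refine lt_of_le_of_ne (Complex.arg_nonneg_iff.2 hβ.le) fun h => ?_
    have := (Complex.arg_eq_zero_iff.1 h.symm).2
    linarith
  have h2 := Complex.arg_le_pi β
  rw [Complex.log_mul (neg_ne_zero.2 Complex.I_ne_zero) hβ0, Complex.log_neg_I]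
  · ring
  · rw [Complex.arg_neg_I]
    constructor <;> linarith [Real.pi_pos]

lemma neg_I_mul_cpow {β : ℂ} (hβ : 0 < β.im) : (-Complex.I * β) ^ (-1 / 2 : ℂ)
    = Complex.exp (Real.pi / 4 * Complex.I) * β ^ (-1 / 2 : ℂ) := by
  have hβ0 : β ≠ 0 := fun h => by simp [h] at hβ
  rw [Complex.cpow_def_of_ne_zero (mul_ne_zero (neg_ne_zero.2 Complex.I_ne_zero) hβ0),
    Complex.cpow_def_of_ne_zero hβ0, log_neg_I_mul hβ, ← Complex.exp_add]
  congr 1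
  ring

/-- The transform of a function that equals a multiple of `x^{-1/2}` on the positive half-line. -/
lemma plusTransform_eq {f : ℝ → ℂ} {a : ℂ}
    (hf : ∀ x : ℝ, 0 < x → f x = a * ((x ^ (-1 / 2 : ℝ) : ℝ) : ℂ)) {β : ℂ} (hβ : 0 < β.im) :
    plusTransform f β
      = a * (√Real.pi : ℂ) * Complex.exp (Real.pi / 4 * Complex.I) * β ^ (-1 / 2 : ℂ) := by
  have h1 := integral_rpow_neg_half_mul_cexp (b := -Complex.I * β) (by simpa using hβ)
  rw [neg_I_mul_cpow hβ] at h1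
  rw [plusTransform, mul_assoc (a * _), mul_assoc a, ← h1, ← integral_const_mul]
  refine setIntegral_congr_fun measurableSet_Ioi fun x hx => ?_
  rw [hf x hx]
  ring_nf

/-- The branch of the logarithm on the closed upper half-plane that is continuous up to the negative
real axis. -/
noncomputable def upperLog (z : ℂ) : ℂ := Complex.log (-Complex.I * z) + Real.pi / 2 * Complex.I

/-- The branch of `z^{-1/2}` on the closed upper half-plane. -/
noncomputable def invSqrt (z : ℂ) : ℂ := Complex.exp (-(upperLog z) / 2)

lemma neg_I_mul_mem_slitPlane {z : ℂ} (hz : z ∈ upperHalf) :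
    -Complex.I * z ∈ Complex.slitPlane := by
  rw [Complex.mem_slitPlane_iff]
  rcases hz.1.lt_or_eq with h | h
  · exact Or.inl (by simpa using h)
  · refine Or.inr fun h' => hz.2 (Complex.ext ?_ h.symm)
    simpa using h'

lemma hasDerivAt_invSqrt {z : ℂ} (hz : -Complex.I * z ∈ Complex.slitPlane) :
    HasDerivAt invSqrt (-(invSqrt z) / (2 * z)) z := by
  have hz0 : z ≠ 0 := fun h => by simp [h] at hz
  have h1 : HasDerivAt (fun z : ℂ => -Complex.I * z) (-Complex.I) z := by
    simpa using (hasDerivAt_id z).const_mul (-Complex.I)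
  have h2 := (((h1.clog hz).add_const (Real.pi / 2 * Complex.I)).fun_neg.div_const 2).cexp
  refine h2.congr_deriv ?_
  have := Complex.I_ne_zero
  simp only [invSqrt, upperLog]
  field_simp

lemma analyticAt_invSqrt {z : ℂ} (hz : z ∈ upperHalf) : AnalyticAt ℂ invSqrt z := by
  have hopen : IsOpen {z : ℂ | -Complex.I * z ∈ Complex.slitPlane} :=
    Complex.isOpen_slitPlane.preimage (by fun_prop)
  exact DifferentiableOn.analyticAt (s := {z : ℂ | -Complex.I * z ∈ Complex.slitPlane})
    (fun y hy => (hasDerivAt_invSqrt hy).differentiableAt.differentiableWithinAt)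
    (hopen.mem_nhds (neg_I_mul_mem_slitPlane hz))

lemma invSqrt_ofReal_mul {t : ℝ} (ht : 0 < t) {z : ℂ} (hz : z ∈ upperHalf) :
    invSqrt (t * z) = (t ^ (-1 / 2 : ℝ) : ℝ) * invSqrt z := by
  have h1 : -Complex.I * (t * z) = t * (-Complex.I * z) := by ring
  rw [invSqrt, upperLog, h1, Complex.log_ofReal_mul ht
    (mul_ne_zero (neg_ne_zero.2 Complex.I_ne_zero) hz.2), invSqrt, upperLog,
    ← IsComplexGradient.exp_log_rpow ht, Complex.ofReal_exp, ← Complex.exp_add]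
  congr 1
  push_cast
  ring

lemma invSqrt_one : invSqrt 1 = 1 := by
  simp [invSqrt, upperLog, Complex.log_neg_I]

lemma invSqrt_neg_one : invSqrt (-1) = -Complex.I := by
  have h : -(Real.pi / 2 * Complex.I + Real.pi / 2 * Complex.I) / 2
      = -(Real.pi / 2 * Complex.I) := by ring
  rw [invSqrt, upperLog, neg_mul_neg, mul_one, Complex.log_I, h, Complex.exp_neg,
    Complex.exp_pi_div_two_mul_I, Complex.inv_I]

lemma invSqrt_ofReal {x : ℝ} (hx : 0 < x) : invSqrt x = (x ^ (-1 / 2 : ℝ) : ℝ) := by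
  have := invSqrt_ofReal_mul hx (z := 1) (by simpa using ofReal_mem_upperHalf one_ne_zero)
  rwa [mul_one, invSqrt_one, mul_one] at this

lemma invSqrt_ofReal_neg {x : ℝ} (hx : x < 0) :
    invSqrt x = -Complex.I * (((-x) ^ (-1 / 2 : ℝ) : ℝ) : ℂ) := by
  have := invSqrt_ofReal_mul (t := -x) (z := -1) (by linarith)
    (by simpa using ofReal_mem_upperHalf (neg_ne_zero.2 one_ne_zero))
  rw [invSqrt_neg_one, Complex.ofReal_neg, neg_mul_neg, mul_one] at this
  rw [this]
  ring

lemma isComplexGradient_invSqrt (a : ℝ) : IsComplexGradient (fun z => a * (invSqrt z).re)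
    (fun z => a * (-(invSqrt z) / (2 * z))) where
  hasFDerivWithinAt z hz := by
    have h1 := (Complex.reCLM.hasFDerivAt.comp z
      ((hasDerivAt_invSqrt (neg_I_mul_mem_slitPlane hz)).hasFDerivAt.restrictScalars ℝ)).const_mul a
    refine (h1.congr_fderiv ?_).hasFDerivWithinAt
    ext v
    simp only [reMul_apply, mul_assoc, Complex.re_ofReal_mul, _root_.smul_apply,
      ContinuousLinearMap.comp_apply, Complex.reCLM_apply, smul_eq_mul,
      ContinuousLinearMap.coe_restrictScalars', ContinuousLinearMap.toSpanSingleton_apply]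
    rw [mul_comm v]
  continuousOn := fun z hz => (continuousAt_const.mul
    ((analyticAt_invSqrt hz).continuousAt.neg.div (continuousAt_const.mul continuousAt_id)
      (mul_ne_zero two_ne_zero hz.2))).continuousWithinAt
  differentiableOn := fun z hz => ((((analyticAt_invSqrt
    (im_pos_subset_upperHalf hz)).differentiableAt.neg.div (differentiableAt_id.const_mul 2)
      (mul_ne_zero two_ne_zero (im_pos_subset_upperHalf hz).2)).const_mul
        (a : ℂ))).differentiableWithinAt

/-- The real field `Re z^{-1/2}`, distributed over the two half-planes so that the tractions are
continuous. -/
noncomputable def singularField (μp μm : ℝ) : BimaterialField ℝ where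
  upper z := μm / (μp + μm) * (invSqrt z).re
  lower z := -μp / (μp + μm) * (invSqrt ((starRingEnd ℂ) z)).re

section Existence

variable {μp μm : ℝ}

lemma isEquilibrium_singularField : IsEquilibrium (singularField μp μm) where
  contDiff_upper := contDiffOn_const.mul fun z hz =>
    (Complex.reCLM.contDiff.contDiffAt.comp z
      ((analyticAt_invSqrt hz).contDiffAt.restrict_scalars ℝ)).contDiffWithinAt
  contDiff_lower := contDiffOn_const.mul fun z hz => by
    have h1 : ContDiffAt ℝ 1 invSqrt (Complex.conjCLE z) :=
      (analyticAt_invSqrt (conj_mem_upperHalf hz)).contDiffAt.restrict_scalars ℝ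
    exact (Complex.reCLM.contDiff.contDiffAt.comp z
      (h1.comp z Complex.conjCLE.contDiff.contDiffAt)).contDiffWithinAt
  harmonic_upper z hz :=
    (analyticAt_invSqrt (im_pos_subset_upperHalf hz)).harmonicAt_re.const_smul
  harmonic_lower z hz := by
    have h1 : AnalyticAt ℂ (fun z => (starRingEnd ℂ) (invSqrt ((starRingEnd ℂ) z))) z := by
      refine DifferentiableOn.analyticAt (s := {z : ℂ | z.im < 0}) (fun y hy => ?_)
        (isOpen_im_neg.mem_nhds hz)
      have h2 : DifferentiableAt ℂ invSqrt ((starRingEnd ℂ) y) :=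
        (analyticAt_invSqrt (conj_mem_upperHalf (im_neg_subset_lowerHalf hy))).differentiableAt
      have h3 := h2.conj_conj
      rw [Complex.conj_conj] at h3
      exact h3.differentiableWithinAt
    have h4 := h1.harmonicAt_re.const_smul (c := -μp / (μp + μm))
    simp only [Complex.conj_re] at h4
    exact h4

/-- A weight function exists: a multiple of `singularField`. -/
theorem exists_isWeightFunction (hμp : 0 < μp) (hμm : 0 < μm) :
    ∃ U : BimaterialField ℂ, IsWeightFunction μp μm U := by
  have hsum : 0 < μp + μm := by linarith
  set L : ℝ →L[ℝ] ℂ := ContinuousLinearMap.toSpanSingleton ℝ weightConstant with hL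
  have hE := isEquilibrium_singularField (μp := μp) (μm := μm)
  have H₁ : IsComplexGradient (singularField μp μm).upper _ :=
    isComplexGradient_invSqrt (μm / (μp + μm))
  have H₂ : IsComplexGradient
      (fun z => (singularField μp μm).lower ((starRingEnd ℂ) z))
      (fun z => ((-μp / (μp + μm) : ℝ) : ℂ) * (-(invSqrt z) / (2 * z))) := by
    have := isComplexGradient_invSqrt (-μp / (μp + μm))
    simpa only [singularField, Complex.conj_conj] using this
  have hTu : ∀ x : ℝ, x ≠ 0 → tractionUpper μp ((singularField μp μm).map L) x = _ := fun x hx => by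
    rw [hE.tractionUpper_map L μp hx, tractionUpper_eq H₁ μp hx]
  have hTl : ∀ x : ℝ, x ≠ 0 → tractionLower μm ((singularField μp μm).map L) x = _ := fun x hx => by
    rw [hE.tractionLower_map L μm hx, tractionLower_eq H₂ μm hx]
  have him : ∀ x : ℝ, 0 < x → ((-(invSqrt x) / (2 * x) : ℂ)).im = 0 := fun x hx => by
    have : (-(invSqrt x) / (2 * x) : ℂ) = ((-(x ^ (-1 / 2 : ℝ)) / (2 * x) : ℝ) : ℂ) := by
      rw [invSqrt_ofReal hx]; push_cast; ring
    rw [this, Complex.ofReal_im]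
  have hLmul : ∀ (t : ℝ) (r : ℝ), L (t * r) = (t : ℂ) * L r := fun t r => by
    rw [← smul_eq_mul, map_smul, Complex.real_smul]
  have hjump : ∀ x : ℝ, jump ((singularField μp μm).map L) x = L (invSqrt x).re := fun x => by
    simp only [jump, BimaterialField.map, singularField, Complex.conj_ofReal]
    rw [← map_sub]
    congr 1
    field_simp
    ring
  refine ⟨(singularField μp μm).map L, ⟨hE.map L, fun x hx => ?_, fun x hx => ?_, fun x hx => ?_,
    fun x hx => ?_, fun t ht z hz => ?_, fun t ht z hz => ?_⟩, fun β hβ => ?_⟩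
  · rw [hjump, invSqrt_ofReal_neg hx]
    simp
  · rw [hTu x hx.ne, hTl x hx.ne, Complex.im_ofReal_mul, Complex.im_ofReal_mul]
    congr 1
    field_simp
  · rw [hTu x hx.ne', Complex.im_ofReal_mul, him x hx]
    simp
  · rw [hTl x hx.ne', Complex.im_ofReal_mul, him x hx]
    simp
  · simp only [BimaterialField.map, singularField]
    rw [invSqrt_ofReal_mul ht hz, Complex.re_ofReal_mul, mul_left_comm, hLmul]
  · simp only [BimaterialField.map, singularField]
    rw [map_mul (starRingEnd ℂ), Complex.conj_ofReal, invSqrt_ofReal_mul ht (conj_mem_upperHalf hz),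
      Complex.re_ofReal_mul, mul_left_comm, hLmul]
  · rw [plusTransform_eq (a := weightConstant) (fun x hx => ?_) hβ, weightConstant_mul, one_mul]
    rw [hjump, invSqrt_ofReal hx, Complex.ofReal_re, hL,
      ContinuousLinearMap.toSpanSingleton_apply, Complex.real_smul, mul_comm]

end Existence

section Traces

variable {μp μm : ℝ} {U : BimaterialField ℂ}

lemma IsSingularSolution.exists_traces (hμp : 0 < μp) (hμm : 0 < μm)
    (hU : IsSingularSolution μp μm U) : ∃ a : ℂ,
      (∀ x : ℝ, 0 < x →
        U.upper x = ((μm / (μp + μm) : ℝ) : ℂ) * (a * ((x ^ (-1 / 2 : ℝ) : ℝ) : ℂ)) ∧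
        U.lower x = ((-μp / (μp + μm) : ℝ) : ℂ) * (a * ((x ^ (-1 / 2 : ℝ) : ℝ) : ℂ))) ∧
      (∀ x : ℝ, x < 0 → U.upper x = 0 ∧ U.lower x = 0 ∧
        tractionUpper μp U x
          = a / ((2 * compliance μp μm : ℝ) : ℂ) * (((-x) ^ (-3 / 2 : ℝ) : ℝ) : ℂ)) := by
  obtain ⟨a, ha1, ha2⟩ := hU.exists_real_traces hμp hμm Complex.reCLM
  obtain ⟨b, hb1, hb2⟩ := hU.exists_real_traces hμp hμm Complex.imCLM
  refine ⟨⟨a, b⟩, fun x hx => ⟨?_, ?_⟩, fun x hx => ⟨?_, ?_, ?_⟩⟩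
  · apply Complex.ext
    · simpa only [Complex.reCLM_apply, Complex.re_ofReal_mul, Complex.re_mul_ofReal]
        using (ha1 x hx).1
    · simpa only [Complex.imCLM_apply, Complex.im_ofReal_mul, Complex.im_mul_ofReal]
        using (hb1 x hx).1
  · apply Complex.ext
    · simpa only [Complex.reCLM_apply, Complex.re_ofReal_mul, Complex.re_mul_ofReal]
        using (ha1 x hx).2
    · simpa only [Complex.imCLM_apply, Complex.im_ofReal_mul, Complex.im_mul_ofReal]
        using (hb1 x hx).2
  · exact Complex.ext (ha2 x hx).1 (hb2 x hx).1
  · exact Complex.ext (ha2 x hx).2.1 (hb2 x hx).2.1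
  · apply Complex.ext
    · simpa only [Complex.reCLM_apply, Complex.re_mul_ofReal, Complex.div_ofReal_re]
        using (ha2 x hx).2.2
    · simpa only [Complex.imCLM_apply, Complex.im_mul_ofReal, Complex.div_ofReal_im]
        using (hb2 x hx).2.2

/-- The traces of a weight function: the normalisation fixes the constant left free by
`IsSingularSolution.exists_traces`. -/
lemma IsWeightFunction.traces (hμp : 0 < μp) (hμm : 0 < μm) (hU : IsWeightFunction μp μm U) :
    (∀ x : ℝ, 0 < x → jump U x = weightConstant * ((x ^ (-1 / 2 : ℝ) : ℝ) : ℂ)) ∧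
    (∀ x : ℝ, x ≠ 0 → average U x = ((eta μp μm / 2 : ℝ) : ℂ) * jump U x) ∧
    (∀ x : ℝ, x < 0 → tractionUpper μp U x
      = weightConstant / ((2 * compliance μp μm : ℝ) : ℂ) * (((-x) ^ (-3 / 2 : ℝ) : ℝ) : ℂ)) := by
  obtain ⟨a, ha1, ha2⟩ := hU.singular.exists_traces hμp hμm
  have hsum : ((μp : ℂ) + μm) ≠ 0 := by
    rw [← Complex.ofReal_add]
    exact_mod_cast (by linarith : 0 < μp + μm).ne'
  have hj : ∀ x : ℝ, 0 < x → jump U x = a * ((x ^ (-1 / 2 : ℝ) : ℝ) : ℂ) := fun x hx => by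
    rw [jump, (ha1 x hx).1, (ha1 x hx).2]
    push_cast
    field_simp
    ring
  have ha : a = weightConstant := by
    have h1 := hU.normalised Complex.I (by simp)
    rw [plusTransform_eq hj (by simp)] at h1
    have hI : Complex.I ^ (-1 / 2 : ℂ) ≠ 0 := fun h => by
      rw [Complex.cpow_eq_zero_iff] at h
      exact Complex.I_ne_zero h.1
    have h2 := mul_right_cancel₀ hI (h1.trans (one_mul _).symm)
    rw [← weightConstant_mul] at h2
    have hpi : (√Real.pi : ℂ) ≠ 0 := by exact_mod_cast (Real.sqrt_pos.2 Real.pi_pos).ne'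
    exact mul_right_cancel₀ hpi (mul_right_cancel₀ (Complex.exp_ne_zero _) h2)
  rw [ha] at ha1 ha2 hj
  refine ⟨hj, fun x hx => ?_, fun x hx => (ha2 x hx).2.2⟩
  rcases hx.lt_or_gt with hx | hx
  · simp [average, jump, (ha2 x hx).1, (ha2 x hx).2.1]
  · rw [hj x hx, average, (ha1 x hx).1, (ha1 x hx).2, Complex.real_smul, eta]
    push_cast
    rw [add_comm (μm : ℂ)]
    field_simp
    ring

end Traces

/-! ### Transforms on the real axis -/

lemma cpow_eq_invSqrt {β : ℂ} (hβ : 0 < β.im) : β ^ (-1 / 2 : ℂ) = invSqrt β := by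
  have hβ0 : β ≠ 0 := fun h => by simp [h] at hβ
  rw [Complex.cpow_def_of_ne_zero hβ0, invSqrt, upperLog, log_neg_I_mul hβ]
  congr 1
  ring

lemma inv_sqrt_eq_rpow {x : ℝ} (hx : 0 < x) : (√x)⁻¹ = x ^ (-1 / 2 : ℝ) := by
  rw [Real.sqrt_eq_rpow, ← Real.rpow_neg hx.le]; norm_num

lemma invSqrt_eq_inv_sqrtPlus {β : ℝ} (hβ : β ≠ 0) : invSqrt β = (sqrtPlus β)⁻¹ := by
  rcases hβ.lt_or_gt with h | h
  · rw [invSqrt_ofReal_neg h, sqrtPlus, if_neg h.not_gt, mul_inv, Complex.inv_I,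
      ← inv_sqrt_eq_rpow (by linarith), Complex.ofReal_inv]
  · rw [invSqrt_ofReal h, sqrtPlus, if_pos h, ← inv_sqrt_eq_rpow h, Complex.ofReal_inv]

lemma hasPlusTransform {f : ℝ → ℂ} {a : ℂ}
    (hf : ∀ x : ℝ, 0 < x → f x = a * (weightConstant * ((x ^ (-1 / 2 : ℝ) : ℝ) : ℂ))) {β : ℝ}
    (hβ : β ≠ 0) : HasPlusTransform f β (a * (sqrtPlus β)⁻¹) := by
  have h1 : Tendsto (fun ε : ℝ => a * invSqrt ((β : ℂ) + (ε : ℂ) * Complex.I)) (𝓝[>] 0)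
      (𝓝 (a * invSqrt β)) := by
    have hc : ContinuousAt invSqrt ((β : ℂ) + ((0 : ℝ) : ℂ) * Complex.I) := by
      simpa using (analyticAt_invSqrt (ofReal_mem_upperHalf hβ)).continuousAt
    have h2 : Tendsto (fun ε : ℝ => (β : ℂ) + (ε : ℂ) * Complex.I) (𝓝[>] 0)
        (𝓝 ((β : ℂ) + ((0 : ℝ) : ℂ) * Complex.I)) :=
      (Continuous.tendsto (by fun_prop) (0 : ℝ)).mono_left nhdsWithin_le_nhds
    simpa using (hc.tendsto.comp h2).const_mul a
  rw [invSqrt_eq_inv_sqrtPlus hβ] at h1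
  refine h1.congr' ?_
  filter_upwards [self_mem_nhdsWithin] with ε hε
  have him : 0 < ((β : ℂ) + (ε : ℂ) * Complex.I).im := by simpa using hε
  rw [plusTransform_eq (a := a * weightConstant) (fun x hx => by rw [hf x hx, mul_assoc]) him,
    cpow_eq_invSqrt him, mul_assoc a, mul_assoc a, weightConstant_mul, mul_one]

section FinitePart

lemma norm_exp_sub_one_le_two {w : ℂ} (hw : w.re ≤ 0) : ‖Complex.exp w - 1‖ ≤ 2 := by
  refine (norm_sub_le _ _).trans ?_
  rw [Complex.norm_exp, norm_one]
  linarith [Real.exp_le_one_iff.2 hw]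

lemma norm_exp_sub_one_le_two_mul {w : ℂ} (hw : w.re ≤ 0) : ‖Complex.exp w - 1‖ ≤ 2 * ‖w‖ := by
  rcases le_total ‖w‖ 1 with h | h
  · exact Complex.norm_exp_sub_one_le h
  · linarith [norm_exp_sub_one_le_two hw]

/-- The integrand of the finite part integral, after subtraction of its divergent part. -/
noncomputable def finitePartIntegrand (r : ℂ) (t : ℝ) : ℂ :=
  ((t ^ (-3 / 2 : ℝ) : ℝ) : ℂ) * (Complex.exp (-r * t) - 1)

/-- An integrable majorant of `finitePartIntegrand r` for `|r| ≤ R`. -/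
noncomputable def finitePartBound (R t : ℝ) : ℝ :=
  (Ioc (0 : ℝ) 1).indicator (fun t => 2 * R * t ^ (-1 / 2 : ℝ)) t
    + (Ioi (1 : ℝ)).indicator (fun t => 2 * t ^ (-3 / 2 : ℝ)) t

lemma integrableOn_finitePartBound (R : ℝ) : IntegrableOn (finitePartBound R) (Ioi 0) := by
  refine Integrable.integrableOn (Integrable.add ?_ ?_)
  · rw [integrable_indicator_iff measurableSet_Ioc]
    refine Integrable.const_mul ?_ _
    exact (intervalIntegrable_iff_integrableOn_Ioc_of_le zero_le_one).1
      (intervalIntegral.intervalIntegrable_rpow' (by norm_num))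
  · rw [integrable_indicator_iff measurableSet_Ioi]
    exact ((integrableOn_Ioi_rpow_iff one_pos).2 (by norm_num)).const_mul 2

lemma norm_finitePartIntegrand_le {r : ℂ} {R : ℝ} (hr : 0 ≤ r.re) (hR : ‖r‖ ≤ R) {t : ℝ}
    (ht : 0 < t) : ‖finitePartIntegrand r t‖ ≤ finitePartBound R t := by
  have hre : (-r * (t : ℂ)).re ≤ 0 := by
    rw [Complex.re_mul_ofReal, Complex.neg_re]
    nlinarith [mul_nonneg hr ht.le]
  rw [finitePartIntegrand, norm_mul, Complex.norm_of_nonneg (Real.rpow_nonneg ht.le _),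
    finitePartBound]
  rcases le_or_gt t 1 with h | h
  · rw [indicator_of_mem (show t ∈ Ioc (0 : ℝ) 1 from ⟨ht, h⟩),
      indicator_of_notMem (show t ∉ Ioi (1 : ℝ) from not_lt.2 h), add_zero]
    have h1 := norm_exp_sub_one_le_two_mul hre
    rw [norm_mul, norm_neg, Complex.norm_of_nonneg ht.le] at h1
    have h2 : t ^ (-3 / 2 : ℝ) * t = t ^ (-1 / 2 : ℝ) := by
      nth_rw 2 [← Real.rpow_one t]
      rw [← Real.rpow_add ht]
      norm_num
    calc _ ≤ t ^ (-3 / 2 : ℝ) * (2 * (R * t)) := by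
          refine mul_le_mul_of_nonneg_left (h1.trans ?_) (Real.rpow_nonneg ht.le _)
          gcongr
      _ = _ := by rw [← h2]; ring
  · rw [indicator_of_notMem (show t ∉ Ioc (0 : ℝ) 1 from fun h' => h.not_ge h'.2),
      indicator_of_mem (show t ∈ Ioi (1 : ℝ) from h), zero_add, mul_comm]
    exact mul_le_mul_of_nonneg_right (norm_exp_sub_one_le_two hre) (Real.rpow_nonneg ht.le _)

lemma aestronglyMeasurable_finitePartIntegrand (r : ℂ) :
    AEStronglyMeasurable (finitePartIntegrand r) (volume.restrict (Ioi 0)) := by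
  refine Measurable.aestronglyMeasurable ?_
  unfold finitePartIntegrand
  exact (Complex.measurable_ofReal.comp (measurable_id.pow_const _)).mul
    (Continuous.measurable (by fun_prop))

lemma integrableOn_finitePartIntegrand {r : ℂ} (hr : 0 ≤ r.re) :
    IntegrableOn (finitePartIntegrand r) (Ioi 0) := by
  refine (integrableOn_finitePartBound ‖r‖).mono' (aestronglyMeasurable_finitePartIntegrand r) ?_
  filter_upwards [ae_restrict_mem measurableSet_Ioi] with t ht
  exact norm_finitePartIntegrand_le hr le_rfl ht

/-- Integration by parts reduces the finite part to a Gamma integral. -/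
lemma integral_finitePartIntegrand_of_re_pos {r : ℂ} (hr : 0 < r.re) :
    ∫ t in Ioi (0 : ℝ), finitePartIntegrand r t = -2 * (√Real.pi : ℂ) * r ^ (1 / 2 : ℂ) := by
  have hr0 : r ≠ 0 := fun h => by simp [h] at hr
  set F : ℝ → ℂ := fun t =>
    -2 * (((t ^ (-1 / 2 : ℝ) : ℝ) : ℂ) * (Complex.exp (-r * t) - 1)) with hF
  have hi2 : IntegrableOn (fun t : ℝ => 2 * r *
      (((t ^ (-1 / 2 : ℝ) : ℝ) : ℂ) * Complex.exp (-r * t))) (Ioi 0) := by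
    refine Integrable.const_mul ?_ _
    refine (integrableOn_rpow_mul_exp_neg_mul_rpow (s := -1 / 2) (p := 1) (b := r.re)
      (by norm_num) one_pos hr).mono' ?_ ?_
    · refine Measurable.aestronglyMeasurable ?_
      exact (Complex.measurable_ofReal.comp (measurable_id.pow_const _)).mul
        (Continuous.measurable (by fun_prop))
    · filter_upwards [ae_restrict_mem measurableSet_Ioi] with t ht
      have ht : 0 < t := ht
      rw [norm_mul, Complex.norm_of_nonneg (Real.rpow_nonneg ht.le _), Complex.norm_exp,
        Complex.re_mul_ofReal, Complex.neg_re, Real.rpow_one]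
  have hderiv : ∀ t ∈ Ioi (0 : ℝ), HasDerivAt F (finitePartIntegrand r t
      + 2 * r * (((t ^ (-1 / 2 : ℝ) : ℝ) : ℂ) * Complex.exp (-r * t))) t := fun t ht => by
    have h1 := (Real.hasDerivAt_rpow_const (x := t) (p := (-1 / 2 : ℝ))
      (Or.inl (ne_of_gt ht))).ofReal_comp
    have h2 : HasDerivAt (fun t : ℝ => -r * (t : ℂ)) (-r) t := by
      simpa using (Complex.ofRealCLM.hasDerivAt (x := t)).const_mul (-r)
    have h3 := (h1.mul (h2.cexp.sub_const 1)).const_mul (-2 : ℂ)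
    refine h3.congr_deriv ?_
    have e : (-1 / 2 : ℝ) - 1 = -3 / 2 := by norm_num
    rw [finitePartIntegrand, e]
    push_cast
    ring
  have hF0 : F 0 = 0 := by simp [hF]
  have hnorm : ∀ t : ℝ, 0 < t → ‖F t‖ = 2 * (t ^ (-1 / 2 : ℝ) * ‖Complex.exp (-r * t) - 1‖) :=
    fun t ht => by
      rw [hF, norm_mul, norm_mul, Complex.norm_of_nonneg (Real.rpow_nonneg ht.le _), norm_neg]
      norm_num
  have hre : ∀ t : ℝ, 0 < t → (-r * (t : ℂ)).re ≤ 0 := fun t ht => by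
    rw [Complex.re_mul_ofReal, Complex.neg_re]
    nlinarith [mul_nonneg hr.le ht.le]
  have hcont : ContinuousWithinAt F (Ici 0) 0 := by
    rw [← continuousWithinAt_Ioi_iff_Ici, ContinuousWithinAt, hF0]
    have hlim : Tendsto (fun t : ℝ => 4 * ‖r‖ * t ^ (1 / 2 : ℝ)) (𝓝[>] 0) (𝓝 0) := by
      have := ((Real.continuous_rpow_const (q := 1 / 2) (by norm_num)).const_mul
        (4 * ‖r‖)).tendsto 0
      rw [Real.zero_rpow (by norm_num), mul_zero] at this
      exact this.mono_left nhdsWithin_le_nhds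
    refine squeeze_zero_norm' ?_ hlim
    filter_upwards [self_mem_nhdsWithin] with t ht
    have ht : 0 < t := ht
    have h1 := norm_exp_sub_one_le_two_mul (hre t ht)
    rw [norm_mul, norm_neg, Complex.norm_of_nonneg ht.le] at h1
    have h2 : t ^ (-1 / 2 : ℝ) * t = t ^ (1 / 2 : ℝ) := by
      nth_rw 2 [← Real.rpow_one t]
      rw [← Real.rpow_add ht]
      norm_num
    rw [hnorm t ht]
    calc _ ≤ 2 * (t ^ (-1 / 2 : ℝ) * (2 * (‖r‖ * t))) := by
          have := Real.rpow_nonneg ht.le (-1 / 2 : ℝ)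
          gcongr
      _ = _ := by rw [← h2]; ring
  have hinf : Tendsto F atTop (𝓝 0) := by
    have hlim : Tendsto (fun t : ℝ => 4 * t ^ (-(1 / 2) : ℝ)) atTop (𝓝 0) := by
      simpa using (tendsto_rpow_neg_atTop (y := 1 / 2) (by norm_num)).const_mul 4
    refine squeeze_zero_norm' ?_ hlim
    filter_upwards [eventually_gt_atTop 0] with t ht
    have h1 := norm_exp_sub_one_le_two (hre t ht)
    rw [hnorm t ht, ← neg_div]
    nlinarith [Real.rpow_nonneg ht.le (-1 / 2 : ℝ),
      mul_le_mul_of_nonneg_left h1 (Real.rpow_nonneg ht.le (-1 / 2 : ℝ))]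
  have hi1 := integrableOn_finitePartIntegrand hr.le
  have h := integral_Ioi_of_hasDerivAt_of_tendsto hcont hderiv (hi1.add hi2) hinf
  rw [hF0, sub_zero, integral_add hi1 hi2, integral_const_mul,
    integral_rpow_neg_half_mul_cexp hr] at h
  have e : r * r ^ (-1 / 2 : ℂ) = r ^ (1 / 2 : ℂ) := by
    nth_rw 1 [← Complex.cpow_one r]
    rw [← Complex.cpow_add _ _ hr0]
    norm_num
  rw [← e]
  linear_combination h

lemma integral_finitePartIntegrand {β : ℝ} (hβ : β ≠ 0) :
    ∫ t in Ioi (0 : ℝ), finitePartIntegrand (Complex.I * β) t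
      = -2 * (√Real.pi : ℂ) * (Complex.I * β) ^ (1 / 2 : ℂ) := by
  -- let `r = ε + iβ` tend to the imaginary axis
  have hr : Tendsto (fun ε : ℝ => (ε : ℂ) + Complex.I * β) (𝓝[>] 0) (𝓝 (Complex.I * β)) := by
    have : Continuous fun ε : ℝ => (ε : ℂ) + Complex.I * β := by fun_prop
    simpa using (this.tendsto 0).mono_left nhdsWithin_le_nhds
  have hslit : Complex.I * β ∈ Complex.slitPlane := by
    rw [Complex.mem_slitPlane_iff]
    exact Or.inr (by simpa using hβ)
  have h1 : Tendsto (fun ε : ℝ => -2 * (√Real.pi : ℂ) * ((ε : ℂ) + Complex.I * β) ^ (1 / 2 : ℂ))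
      (𝓝[>] 0) (𝓝 (-2 * (√Real.pi : ℂ) * (Complex.I * β) ^ (1 / 2 : ℂ))) :=
    (hr.cpow tendsto_const_nhds hslit).const_mul _
  have h2 : Tendsto
      (fun ε : ℝ => ∫ t in Ioi (0 : ℝ), finitePartIntegrand ((ε : ℂ) + Complex.I * β) t)
      (𝓝[>] 0) (𝓝 (∫ t in Ioi (0 : ℝ), finitePartIntegrand (Complex.I * β) t)) := by
    refine tendsto_integral_filter_of_dominated_convergence (finitePartBound (1 + |β|))
      (Eventually.of_forall fun ε => aestronglyMeasurable_finitePartIntegrand _) ?_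
      (integrableOn_finitePartBound _) ?_
    · filter_upwards [Ioo_mem_nhdsGT (zero_lt_one' ℝ)] with ε hε
      filter_upwards [ae_restrict_mem measurableSet_Ioi] with t ht
      refine norm_finitePartIntegrand_le (by simpa using hε.1.le) ?_ ht
      refine (norm_add_le _ _).trans ?_
      rw [norm_mul, Complex.norm_I, one_mul, Complex.norm_real, Complex.norm_real,
        Real.norm_of_nonneg hε.1.le, Real.norm_eq_abs]
      linarith [hε.2]
    · refine ae_of_all _ fun t => ?_
      have hc : Continuous fun r : ℂ => finitePartIntegrand r t := by
        unfold finitePartIntegrand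
        fun_prop
      exact (hc.tendsto _).comp hr
  refine tendsto_nhds_unique h2 (h1.congr' ?_)
  filter_upwards [self_mem_nhdsWithin] with ε hε
  exact (integral_finitePartIntegrand_of_re_pos (by simpa using hε)).symm

lemma weightConstant_mul_cpow {β : ℝ} (hβ : β ≠ 0) :
    weightConstant * (√Real.pi : ℂ) * (Complex.I * β) ^ (1 / 2 : ℂ) = sqrtMinus β := by
  have hsqrt : ∀ x : ℝ, 0 < x → (√x : ℂ) = Complex.exp (1 / 2 * (Real.log x : ℝ)) := fun x hx => by
    rw [Real.sqrt_eq_rpow, Real.rpow_def_of_pos hx]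
    push_cast
    ring_nf
  have hne : Complex.I * β ≠ 0 := mul_ne_zero Complex.I_ne_zero (by exact_mod_cast hβ)
  have hw := weightConstant_mul
  rw [Complex.cpow_def_of_ne_zero hne]
  rcases hβ.lt_or_gt with h | h
  · have e1 : Complex.I * β = ((-β : ℝ) : ℂ) * -Complex.I := by push_cast; ring
    have e2 : Complex.log (Complex.I * β) * (1 / 2) = Real.pi / 4 * Complex.I
        + (-(Real.pi / 2 * Complex.I) + 1 / 2 * (Real.log (-β) : ℝ)) := by
      rw [e1, Complex.log_ofReal_mul (by linarith) (neg_ne_zero.2 Complex.I_ne_zero),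
        Complex.log_neg_I]
      ring
    rw [e2, Complex.exp_add, Complex.exp_add, ← hsqrt _ (by linarith), Complex.exp_neg,
      Complex.exp_pi_div_two_mul_I, Complex.inv_I, ← mul_assoc, hw, one_mul, sqrtMinus,
      if_neg h.not_gt]
  · have e2 : Complex.log (Complex.I * β) * (1 / 2) = Real.pi / 4 * Complex.I
        + 1 / 2 * (Real.log β : ℝ) := by
      rw [mul_comm Complex.I, Complex.log_ofReal_mul h Complex.I_ne_zero, Complex.log_I]
      ring
    rw [e2, Complex.exp_add, ← hsqrt _ h, ← mul_assoc, hw, one_mul, sqrtMinus, if_pos h]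

lemma integral_Ioi_rpow_neg_three_half {δ : ℝ} (hδ : 0 < δ) :
    ∫ t in Ioi δ, t ^ (-3 / 2 : ℝ) = 2 * δ ^ (-1 / 2 : ℝ) := by
  rw [integral_Ioi_rpow_of_lt (by norm_num) hδ]
  norm_num
  ring

/-- The finite part transform of a multiple of `(-x)^{-3/2}`. -/
lemma hasMinusTransform {f : ℝ → ℂ} {a : ℂ} (hf : ∀ x : ℝ, x < 0 →
      f x = weightConstant / (2 * a) * (((-x) ^ (-3 / 2 : ℝ) : ℝ) : ℂ)) {β : ℝ} (hβ : β ≠ 0) :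
    HasMinusTransform f β (-sqrtMinus β / a) := by
  set c := weightConstant / (2 * a) with hc
  have hi := integrableOn_finitePartIntegrand (r := Complex.I * β) (by simp)
  refine ⟨2 * c, ?_⟩
  have hlim : Tendsto (fun δ : ℝ => c * ∫ t in Ioi δ, finitePartIntegrand (Complex.I * β) t)
      (𝓝[>] 0) (𝓝 (-sqrtMinus β / a)) := by
    have h1 : Tendsto (fun δ : ℝ => ∫ t in Ioi δ, finitePartIntegrand (Complex.I * β) t)
        (𝓝[>] 0) (𝓝 (∫ t in Ioi (0 : ℝ), finitePartIntegrand (Complex.I * β) t)) := by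
      have hcov : AECover (volume.restrict (Ioi (0 : ℝ))) (𝓝[>] (0 : ℝ)) fun δ => Ioi δ :=
        aecover_Ioi_of_Ioi (tendsto_id.mono_left nhdsWithin_le_nhds)
      refine (hcov.integral_tendsto_of_countably_generated hi).congr' ?_
      filter_upwards [self_mem_nhdsWithin] with δ hδ
      rw [Measure.restrict_restrict measurableSet_Ioi,
        inter_eq_left.2 (Ioi_subset_Ioi (le_of_lt hδ))]
    convert! h1.const_mul c using 2
    rw [integral_finitePartIntegrand hβ, hc, ← weightConstant_mul_cpow hβ]
    rcases eq_or_ne a 0 with rfl | ha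
    · simp
    · field_simp
  refine hlim.congr' ?_
  filter_upwards [self_mem_nhdsWithin] with δ hδ
  have hδ : 0 < δ := hδ
  have hsub : Ioi δ ⊆ Ioi 0 := Ioi_subset_Ioi hδ.le
  have hip : IntegrableOn (fun t : ℝ => ((t ^ (-3 / 2 : ℝ) : ℝ) : ℂ)) (Ioi δ) :=
    ((integrableOn_Ioi_rpow_iff hδ).2 (by norm_num)).ofReal
  have h2 : ∫ x in Iio (-δ), f x * Complex.exp (Complex.I * (β : ℂ) * (x : ℂ))
      = ∫ t in Ioi δ,
        c * (finitePartIntegrand (Complex.I * β) t + ((t ^ (-3 / 2 : ℝ) : ℝ) : ℂ)) := by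
    rw [← integral_Iic_eq_integral_Iio, ← integral_comp_neg_Ioi]
    refine setIntegral_congr_fun measurableSet_Ioi fun t ht => ?_
    have ht' : 0 < t := hsub ht
    simp only [hf (-t) (by linarith), neg_neg, finitePartIntegrand]
    push_cast
    rw [mul_neg, neg_mul]
    ring
  rw [h2, integral_const_mul, integral_add (hi.mono_set hsub) hip, integral_complex_ofReal,
    integral_Ioi_rpow_neg_three_half hδ]
  push_cast
  ring

lemma inv_sqrtPlus_eq {β : ℝ} (hβ : β ≠ 0) :
    (sqrtPlus β)⁻¹ = ((1 / |β| : ℝ) : ℂ) * sqrtMinus β := by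
  rcases hβ.lt_or_gt with h | h
  · have h' : 0 < -β := by linarith
    have h1 : (√(-β))⁻¹ = 1 / (-β) * √(-β) := by
      have := Real.sqrt_pos.2 h'
      field_simp
      rw [Real.sq_sqrt h'.le]
      ring
    rw [sqrtPlus, sqrtMinus, if_neg h.not_gt, if_neg h.not_gt, abs_of_neg h, mul_inv,
      Complex.inv_I, ← Complex.ofReal_inv, h1]
    push_cast
    ring
  · have h1 : (√β)⁻¹ = 1 / β * √β := by
      have := Real.sqrt_pos.2 h
      field_simp
      rw [Real.sq_sqrt h.le]
    rw [sqrtPlus, sqrtMinus, if_pos h, if_pos h, abs_of_pos h, ← Complex.ofReal_inv, h1,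
      Complex.ofReal_mul]

end FinitePart

/-! ### Coefficients as limits of integrals against a weight function -/

section WeightIntegral

variable {μp μm : ℝ} {q pp pm : ℝ → ℝ} {U : BimaterialField ℂ}

lemma one_add_I_mul_weightConstant :
    (1 + Complex.I) * weightConstant = ((√(2 / Real.pi) : ℝ) : ℂ) := by
  have h : ((√(2 * Real.pi) : ℝ) : ℂ) ≠ 0 := by
    exact_mod_cast (Real.sqrt_pos.2 (by positivity : 0 < 2 * Real.pi)).ne'
  have hpi : (Real.pi : ℂ) ≠ 0 := by exact_mod_cast Real.pi_ne_zero
  have hsq : ((√(2 * Real.pi) : ℝ) : ℂ) ^ 2 = 2 * Real.pi := by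
    rw [← Complex.ofReal_pow, Real.sq_sqrt (by positivity)]
    push_cast
    ring
  rw [sqrt_two_div_pi, weightConstant, Complex.ofReal_div, ← mul_div_assoc, div_eq_div_iff h hpi]
  linear_combination -hsq - Real.pi * Complex.I_sq

lemma IsLoad.tendsto_integral_shift (hq : IsLoad q) :
    Tendsto (fun x' : ℝ => ∫ x in Iio (0 : ℝ), q x * (x' - x) ^ (-1 / 2 : ℝ)) (𝓝[>] 0)
      (𝓝 (∫ x in Iio (0 : ℝ), q x * (-x) ^ (-1 / 2 : ℝ))) := by
  refine tendsto_integral_filter_of_dominated_convergence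
    (fun x => ‖q x * (-x) ^ (-1 / 2 : ℝ)‖) ?_ ?_
    (hq.integrableOn_mul_rpow (by norm_num)).norm ?_
  · refine Eventually.of_forall fun x' => hq.integrable.aestronglyMeasurable.mul ?_
    exact ((measurable_const.sub measurable_id).pow_const _).aestronglyMeasurable
  · filter_upwards [self_mem_nhdsWithin] with x' hx'
    have hx' : 0 < x' := hx'
    filter_upwards [ae_restrict_mem measurableSet_Iio] with x hx
    have hx : x < 0 := hx
    rw [norm_mul, norm_mul, Real.norm_of_nonneg (Real.rpow_nonneg (by linarith : 0 ≤ x' - x) _),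
      Real.norm_of_nonneg (Real.rpow_nonneg (by linarith : 0 ≤ -x) _)]
    exact mul_le_mul_of_nonneg_left
      (Real.rpow_le_rpow_of_nonpos (by linarith) (by linarith) (by norm_num)) (norm_nonneg _)
  · filter_upwards [ae_restrict_mem measurableSet_Iio] with x hx
    have hx : x < 0 := hx
    have hc : ContinuousAt (fun x' : ℝ => q x * (x' - x) ^ (-1 / 2 : ℝ)) 0 :=
      continuousAt_const.mul ((continuousAt_id.sub continuousAt_const).rpow_const
        (Or.inl (by simpa using hx.ne)))
    simpa using hc.tendsto.mono_left nhdsWithin_le_nhds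

/-- The integrals of a weight function, placed with its tip at `x' > 0`, against loads: the
singularity of the weight lies outside the support of the loads, hence the limit `x' → 0`. -/
lemma IsWeightFunction.tendsto_integral (hμp : 0 < μp) (hμm : 0 < μm)
    (hU : IsWeightFunction μp μm U) (hp : IsLoad pp) (hm : IsLoad pm) :
    Tendsto (fun x' : ℝ => (1 + Complex.I) * ∫ x in Iio (0 : ℝ),
        (jump U (x' - x) * (loadAverage pp pm x : ℂ)
          + average U (x' - x) * (loadJump pp pm x : ℂ))) (𝓝[>] 0)
      (𝓝 ((√(2 / Real.pi) * ((∫ x in Iio (0 : ℝ), effectiveLoad μp μm pp pm x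
        * (-x) ^ (-1 / 2 : ℝ)) / compliance μp μm) : ℝ) : ℂ)) := by
  obtain ⟨hj, ha, -⟩ := hU.traces hμp hμm
  have hl := ((hp.effectiveLoad (μp := μp) (μm := μm) hm).tendsto_integral_shift.div_const
    (compliance μp μm)).const_mul √(2 / Real.pi)
  refine ((Complex.continuous_ofReal.tendsto _).comp hl).congr' ?_
  filter_upwards [self_mem_nhdsWithin] with x' hx'
  have hx' : 0 < x' := hx'
  have h1 : ∫ x in Iio (0 : ℝ), (jump U (x' - x) * (loadAverage pp pm x : ℂ)
        + average U (x' - x) * (loadJump pp pm x : ℂ))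
      = ∫ x in Iio (0 : ℝ), weightConstant / (compliance μp μm : ℂ)
        * ((effectiveLoad μp μm pp pm x * (x' - x) ^ (-1 / 2 : ℝ) : ℝ) : ℂ) := by
    refine setIntegral_congr_fun measurableSet_Iio fun x hx => ?_
    have hx : x < 0 := hx
    have e := congrArg (fun r : ℝ => (r : ℂ))
      (effectiveLoad_div_compliance (pp := pp) (pm := pm) hμp hμm x)
    simp only [ha (x' - x) (by linarith), hj (x' - x) (by linarith)]
    push_cast at e ⊢
    linear_combination weightConstant * (((x' - x) ^ (-1 / 2 : ℝ) : ℝ) : ℂ) * e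
  rw [h1, integral_const_mul, integral_complex_ofReal, ← mul_assoc, ← mul_div_assoc,
    one_add_I_mul_weightConstant]
  simp only [Function.comp]
  push_cast
  ring

lemma integral_effectiveLoad_div_compliance (hμp : 0 < μp) (hμm : 0 < μm) :
    (∫ x in Iio (0 : ℝ), effectiveLoad μp μm pp pm x * (-x) ^ (-1 / 2 : ℝ)) / compliance μp μm
      = ∫ x in Iio (0 : ℝ), (loadAverage pp pm x + eta μp μm / 2 * loadJump pp pm x)
        * (-x) ^ (-1 / 2 : ℝ) := by
  simp_rw [effectiveLoad_div_compliance hμp hμm, div_mul_eq_mul_div]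
  rw [integral_div]

lemma integral_effectiveLoad_deriv (hp : IsSmoothLoad pp) (hm : IsSmoothLoad pm) :
    ∫ x in Iio (0 : ℝ), effectiveLoad μp μm pp pm x * (-x) ^ (-3 / 2 : ℝ)
      = -2 * ∫ x in Iio (0 : ℝ), effectiveLoad μp μm (deriv pp) (deriv pm) x
        * (-x) ^ (-1 / 2 : ℝ) := by
  have hlin : ∀ (f g : ℝ → ℝ) (s : ℝ), s ≤ 0 → IsLoad f → IsLoad g →
      ∫ x in Iio (0 : ℝ), effectiveLoad μp μm f g x * (-x) ^ s
        = (∫ x in Iio (0 : ℝ), f x * (-x) ^ s) / μp + (∫ x in Iio (0 : ℝ), g x * (-x) ^ s) / μm :=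
    fun f g s hs hf hg => by
      rw [← integral_div, ← integral_div, ← integral_add
        ((hf.integrableOn_mul_rpow hs).div_const μp) ((hg.integrableOn_mul_rpow hs).div_const μm)]
      refine integral_congr_ae (ae_of_all _ fun x => ?_)
      simp only [effectiveLoad]
      ring
  rw [hlin pp pm _ (by norm_num) hp.toIsLoad hm.toIsLoad,
    hlin _ _ _ (by norm_num) hp.isLoad_deriv hm.isLoad_deriv, hp.integral_deriv_mul_rpow,
    hm.integral_deriv_mul_rpow]
  ring

end WeightIntegral

end InterfaceCrack

theorem mainTheorem6 (μp μm : ℝ) (hμp : 0 < μp) (hμm : 0 < μm) :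
    -- the weight function exists
    (∃ U : InterfaceCrack.BimaterialField ℂ, InterfaceCrack.IsWeightFunction μp μm U) ∧
    -- its traces
    (∀ U : InterfaceCrack.BimaterialField ℂ, InterfaceCrack.IsWeightFunction μp μm U →
      (∀ x : ℝ, 0 < x → InterfaceCrack.jump U x =
        (1 - Complex.I) / (Real.sqrt (2 * Real.pi) : ℂ) * ((x ^ (-1 / 2 : ℝ) : ℝ) : ℂ)) ∧
      (∀ x : ℝ, x < 0 → InterfaceCrack.jump U x = 0) ∧
      (∀ x : ℝ, 0 < x → InterfaceCrack.tractionUpper μp U x = 0 ∧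
        InterfaceCrack.tractionLower μm U x = 0) ∧
      (∀ x : ℝ, x < 0 →
        InterfaceCrack.tractionUpper μp U x =
          (1 - Complex.I) / ((2 * Real.sqrt (2 * Real.pi) * InterfaceCrack.compliance μp μm : ℝ) : ℂ)
            * (((-x) ^ (-3 / 2 : ℝ) : ℝ) : ℂ) ∧
        InterfaceCrack.tractionLower μm U x = InterfaceCrack.tractionUpper μp U x) ∧
      (∀ x : ℝ, x ≠ 0 → InterfaceCrack.average U x =
        ((InterfaceCrack.eta μp μm / 2 : ℝ) : ℂ) * InterfaceCrack.jump U x) ∧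
      -- the same relations between the Fourier transforms on the real axis
      (∀ β : ℝ, β ≠ 0 → ∃ Jhat Mhat Shat : ℂ,
        InterfaceCrack.HasPlusTransform (InterfaceCrack.jump U) β Jhat ∧
        InterfaceCrack.HasPlusTransform (InterfaceCrack.average U) β Mhat ∧
        InterfaceCrack.HasMinusTransform (InterfaceCrack.tractionUpper μp U) β Shat ∧
        Jhat = (InterfaceCrack.sqrtPlus β)⁻¹ ∧
        Shat = -InterfaceCrack.sqrtMinus β / (InterfaceCrack.compliance μp μm : ℂ) ∧
        Jhat = -(((μp + μm) / (μp * μm) * (1 / |β|) : ℝ) : ℂ) * Shat ∧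
        Mhat = (((μp - μm) / (2 * μp * μm) * (1 / |β|) : ℝ) : ℂ) * Shat ∧
        Mhat = ((InterfaceCrack.eta μp μm / 2 : ℝ) : ℂ) * Jhat)) ∧
    -- the stress intensity factor and the second-order coefficient
    (∀ (pp pm : ℝ → ℝ) (u : InterfaceCrack.BimaterialField ℝ),
      InterfaceCrack.IsLoad pp → InterfaceCrack.IsLoad pm →
      InterfaceCrack.IsPhysicalSolution μp μm pp pm u →
      ∃ K A : ℝ, InterfaceCrack.HasTipAsymptotics μp μm u K A ∧
        K = -Real.sqrt (2 / Real.pi) * ∫ x in Iio (0 : ℝ),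
          (InterfaceCrack.loadAverage pp pm x
            + InterfaceCrack.eta μp μm / 2 * InterfaceCrack.loadJump pp pm x)
            * (-x) ^ (-1 / 2 : ℝ) ∧
        (∀ U : InterfaceCrack.BimaterialField ℂ, InterfaceCrack.IsWeightFunction μp μm U →
          Tendsto (fun x' : ℝ => -(1 + Complex.I) * ∫ x in Iio (0 : ℝ),
            (InterfaceCrack.jump U (x' - x) * (InterfaceCrack.loadAverage pp pm x : ℂ)
              + InterfaceCrack.average U (x' - x) * (InterfaceCrack.loadJump pp pm x : ℂ)))
            (𝓝[>] 0) (𝓝 (K : ℂ))) ∧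
        (InterfaceCrack.IsSmoothLoad pp → InterfaceCrack.IsSmoothLoad pm →
          A = -2 * Real.sqrt (2 / Real.pi) * ∫ x in Iio (0 : ℝ),
            (deriv (InterfaceCrack.loadAverage pp pm) x
              + InterfaceCrack.eta μp μm / 2 * deriv (InterfaceCrack.loadJump pp pm) x)
              * (-x) ^ (-1 / 2 : ℝ) ∧
          ∀ U : InterfaceCrack.BimaterialField ℂ, InterfaceCrack.IsWeightFunction μp μm U →
            Tendsto (fun x' : ℝ => -2 * (1 + Complex.I) * ∫ x in Iio (0 : ℝ),
              (InterfaceCrack.jump U (x' - x)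
                  * ((deriv (InterfaceCrack.loadAverage pp pm) x : ℝ) : ℂ)
                + InterfaceCrack.average U (x' - x)
                  * ((deriv (InterfaceCrack.loadJump pp pm) x : ℝ) : ℂ)))
              (𝓝[>] 0) (𝓝 (A : ℂ)))) := by
  have hc : (InterfaceCrack.compliance μp μm : ℂ) ≠ 0 := by
    exact_mod_cast (InterfaceCrack.compliance_pos hμp hμm).ne'
  refine ⟨InterfaceCrack.exists_isWeightFunction hμp hμm, fun U hU => ?_,
    fun pp pm u hp hm hu => ?_⟩
  · obtain ⟨hj, ha, ht⟩ := hU.traces hμp hμm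
    refine ⟨hj, hU.singular.jump_eq_zero, fun x hx => ⟨hU.singular.traction_free_upper x hx,
      hU.singular.traction_free_lower x hx⟩, fun x hx => ⟨?_,
      (hU.singular.traction_continuous x hx).symm⟩, ha, fun β hβ => ?_⟩
    · rw [ht x hx, InterfaceCrack.weightConstant, div_div]
      push_cast
      ring
    · refine ⟨(InterfaceCrack.sqrtPlus β)⁻¹, _, _, ?_,
        InterfaceCrack.hasPlusTransform (fun x hx => by rw [ha x hx.ne', hj x hx]) hβ,
        InterfaceCrack.hasMinusTransform (fun x hx => by rw [ht x hx]; push_cast; rfl) hβ,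
        rfl, rfl, ?_, ?_, rfl⟩
      · simpa using InterfaceCrack.hasPlusTransform (a := 1)
          (fun x hx => by rw [hj x hx, one_mul]) hβ
      · have h : (μp + μm) / (μp * μm) = InterfaceCrack.compliance μp μm := by
          rw [InterfaceCrack.compliance]
          field_simp
          ring
        rw [InterfaceCrack.inv_sqrtPlus_eq hβ, h, Complex.ofReal_mul]
        field_simp
      · have h : (μp - μm) / (2 * μp * μm)
            = -(InterfaceCrack.eta μp μm / 2) * InterfaceCrack.compliance μp μm := by
          rw [InterfaceCrack.compliance, InterfaceCrack.eta]
          field_simp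
          ring
        rw [InterfaceCrack.inv_sqrtPlus_eq hβ, h, Complex.ofReal_mul, Complex.ofReal_mul,
          Complex.ofReal_neg]
        field_simp
  · refine ⟨_, _, hu.hasTipAsymptotics hμp hμm hp hm, ?_, fun U hU => ?_,
      fun hp' hm' => ⟨?_, fun U hU => ?_⟩⟩
    · rw [← InterfaceCrack.integral_effectiveLoad_div_compliance hμp hμm]
    · convert! (hU.tendsto_integral hμp hμm hp hm).neg using 2
      · ring
      · push_cast
        ring
    · rw [InterfaceCrack.integral_effectiveLoad_deriv hp' hm', mul_div_assoc,
        InterfaceCrack.integral_effectiveLoad_div_compliance hμp hμm, ← mul_assoc,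
        mul_comm (√_) (-2)]
      congr 1
      refine setIntegral_congr_fun measurableSet_Iio fun x hx => ?_
      obtain ⟨h1, h2⟩ := InterfaceCrack.deriv_loads hp' hm' hx
      simp only [h1, h2]
    · rw [InterfaceCrack.integral_effectiveLoad_deriv hp' hm', mul_div_assoc]
      convert! (hU.tendsto_integral hμp hμm hp'.isLoad_deriv hm'.isLoad_deriv).const_mul (-2)
        using 2 with x'
      · rw [mul_assoc]
        congr 2
        refine setIntegral_congr_fun measurableSet_Iio fun x hx => ?_
        obtain ⟨h1, h2⟩ := InterfaceCrack.deriv_loads hp' hm' hx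
        simp only [h1, h2]
      · push_cast
        ring
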